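/- Theorem 1.3. Let $\mu>0$, $\nu>0$ and let $m\ge 3$ be an integer. Consider on $\mathbb{R}^3$ the incompressible Oldroyd system with damping for a velocity $u(t,x)\in\mathbb{R}^3$, a pressure $p(t,x)\in\mathbb{R}$ and a deformation tensor $F(t,x)\in\mathbb{R}^{3\times 3}$ with columns $F_{\cdot 1},F_{\cdot 2},F_{\cdot 3}$: $$\begin{cases}\partial_t u-\mu\Delta u+u\cdot\nabla u+\nabla p=\sum_{i=1}^3 F_{\cdot i}\cdot\nabla F_{\cdot i},\\ \partial_t F_{\cdot j}+\nu F_{\cdot j}+u\cdot\nabla F_{\cdot j}=F_{\cdot j}\cdot\nabla u,\qquad j=1,2,3,\\ \operatorname{div}u=0,\quad \operatorname{div}F^T=0,\end{cases}$$ where $(\operatorname{div}F^T)_j=\sum_l\partial_{x_l}F_{lj}$. By a global solution with data $(u_0,F_0)$ we mean $u,F\in C([0,\infty);H^m(\mathbb{R}^3))$ with $(u,F)(0)=(u_0,F_0)$, divergence free as above for all $t\ge0$, such that for some $p$ the two evolution equations hold for every $t>0$, time derivatives being taken in $L^2$ and space derivatives in the weak sense. There is $\delta_0=\delta_0(m,\mu,\nu)>0$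 such that the following holds. Let $u_0,F_0\in L^1(\mathbb{R}^3)\cap H^m(\mathbb{R}^3)$ with $\|u_0\|_{H^m}+\|F_0\|_{H^m}\le\delta_0$, and let $j\ge0$ be any integer such that $u_0,F_0\in H^j(\mathbb{R}^3)$ (which is automatic for $j\le m$). Then there are a time $T_0\ge0$ and a constant $C>0$, depending only on $j$, the initial data and $m,\mu,\nu$, such that every global solution $(u,F)$ with data $(u_0,F_0)$ satisfies $$\|\nabla^j u(t)\|_{L^2}^2+\|\nabla^j F(t)\|_{L^2}^2\le C(t+1)^{-\frac32-j}\qquad\text{for all } t>T_0;$$ in particular $\nabla^j u(t),\nabla^j F(t)\in L^2(\mathbb{R}^3)$ for these $t$. -/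

import Mathlib

open MeasureTheory Filter Topology
open scoped ENNReal ContDiff

namespace Oldroyd

noncomputable section

/-- Physical space `ℝ³`. -/
abbrev E : Type := EuclideanSpace ℝ (Fin 3)

/-- `g` is the weak derivative `∂_{I 0} ⋯ ∂_{I (k-1)} f` on `ℝ³`: both functions are locally
integrable and `∫ f ∂_I φ = (-1)^k ∫ g φ` for every smooth compactly supported `φ`. -/
def IsWeakDeriv {k : ℕ} (I : Fin k → Fin 3) (f g : E → ℝ) : Prop :=
  LocallyIntegrable f volume ∧ LocallyIntegrable g volume ∧
    ∀ φ : E → ℝ, ContDiff ℝ ∞ φ → HasCompactSupport φ →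
      ∫ x, f x * iteratedFDeriv ℝ k φ x (fun r => EuclideanSpace.single (I r) (1 : ℝ)) =
        (-1) ^ k * ∫ x, g x * φ x

open Classical in
/-- The weak derivative `∂_I f` (unique up to null sets); `0` if there is none. -/
def weakDeriv {k : ℕ} (I : Fin k → Fin 3) (f : E → ℝ) : E → ℝ :=
  if h : ∃ g, IsWeakDeriv I f g then h.choose else 0

/-- `‖∇^j w‖²_{L²}` for a field `w` with finitely many real components: the sum over all
components `a` and all index tuples `I` of `‖∂_I w_a‖²_{L²}`, where `∂_I` is the weak derivative.
It is `∞` as soon as one of these weak derivatives does not exist (an infimum over the empty set)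
or is not square integrable. -/
def gradNormSq {ι : Type} [Fintype ι] (j : ℕ) (w : E → ι → ℝ) : ℝ≥0∞ :=
  ∑ a : ι, ∑ I : Fin j → Fin 3,
    ⨅ (g : E → ℝ) (_ : IsWeakDeriv I (fun x => w x a) g), eLpNorm g 2 volume ^ 2

/-- The norm of `H^m(ℝ³)`, `‖w‖_{H^m} = (∑_{k ≤ m} ‖∇^k w‖²_{L²})^{1/2}`; it is finite exactly
when `w` belongs to `H^m`. -/
def sobolevNorm {ι : Type} [Fintype ι] (m : ℕ) (w : E → ι → ℝ) : ℝ≥0∞ :=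
  (∑ k ∈ Finset.range (m + 1), gradNormSq k w) ^ (1 / 2 : ℝ)

/-- The nine components of a matrix field, as a single family. -/
def entries (F : E → Matrix (Fin 3) (Fin 3) ℝ) : E → Fin 3 × Fin 3 → ℝ :=
  fun x a => F x a.1 a.2

/-- The curve `s ↦ f s` of real functions is differentiable at the time `t` in `L²(ℝ³)`, with
derivative `g`. -/
def HasL2DerivAt (f : ℝ → E → ℝ) (g : E → ℝ) (t : ℝ) : Prop :=
  Tendsto (fun s => eLpNorm (fun x => (s - t)⁻¹ * (f s x - f t x) - g x) 2 volume)
    (𝓝[≠] t) (𝓝 0)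

/-- `w ∈ C([0,∞); H^m(ℝ³))`. -/
def ContinuousInSobolev {ι : Type} [Fintype ι] (m : ℕ) (w : ℝ → E → ι → ℝ) : Prop :=
  ∀ t, 0 ≤ t → sobolevNorm m (w t) < ⊤ ∧
    Tendsto (fun s => sobolevNorm m (fun x => w s x - w t x)) (𝓝[Set.Ici 0] t) (𝓝 0)

/-- `(u, F)` is a global-in-time strong solution in `C([0,∞); H^m)` of the damped
incompressible Oldroyd system
`∂ₜu - μΔu + u·∇u + ∇p = ∑ᵢ F_{·i}·∇F_{·i}`, `∂ₜF_{·j} + νF_{·j} + u·∇F_{·j} = F_{·j}·∇u`,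
`div u = 0`, `div Fᵀ = 0`, where `F_{·j}` is the `j`-th column of `F` and
`(div Fᵀ)_j = ∑ₗ ∂ₗ F_{lj}`. Time derivatives are taken in `L²`, space derivatives are weak. -/
structure IsGlobalSolution (m : ℕ) (μ ν : ℝ) (u : ℝ → E → Fin 3 → ℝ)
    (F : ℝ → E → Matrix (Fin 3) (Fin 3) ℝ) : Prop where
  velocity_mem : ContinuousInSobolev m u
  deformation_mem : ContinuousInSobolev m (fun t => entries (F t))
  velocity_div : ∀ t, 0 ≤ t →
    ∀ᵐ x, ∑ l : Fin 3, weakDeriv ![l] (fun y => u t y l) x = 0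
  deformation_div : ∀ t, 0 ≤ t → ∀ j : Fin 3,
    ∀ᵐ x, ∑ l : Fin 3, weakDeriv ![l] (fun y => F t y l j) x = 0
  momentum : ∃ p : ℝ → E → ℝ, ∀ t, 0 < t → ∀ k : Fin 3,
    (∃ g, IsWeakDeriv ![k] (p t) g) ∧
    HasL2DerivAt (fun s x => u s x k)
      (fun x => μ * ∑ l : Fin 3, weakDeriv ![l, l] (fun y => u t y k) x
        - ∑ l : Fin 3, u t x l * weakDeriv ![l] (fun y => u t y k) x
        - weakDeriv ![k] (p t) x
        + ∑ i : Fin 3, ∑ l : Fin 3, F t x l i * weakDeriv ![l] (fun y => F t y k i) x) t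
  transport : ∀ t, 0 < t → ∀ k j : Fin 3,
    HasL2DerivAt (fun s x => F s x k j)
      (fun x => -(ν * F t x k j)
        - ∑ l : Fin 3, u t x l * weakDeriv ![l] (fun y => F t y k j) x
        + ∑ l : Fin 3, F t x l j * weakDeriv ![l] (fun y => u t y k) x) t

end

end Oldroyd

/-!
The proof is an energy method on the Fourier side. By Plancherel's formula (`gradNormSq_eq`) the
quantities `‖∇^k u‖²` and `‖∇^k F‖²` are weighted `L²` norms of the Fourier transforms. The weights
are truncated, `min(|ξ|, R)^k`, so that the energies `total k R u F` are finite and differentiable in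
time for every `k`, although the solution is only known to be in `H^m`; all estimates are uniform in
`R`, and `R → ∞` at the end by monotone convergence (`gradNormSq_le_of_energy_le`). This also yields
the existence of the weak derivatives of order `j > m`.

The structure of the system enters in three ways. The pressure drops out because `div u = 0`
(`sum_pair_gradient_eq_zero`). In the transport of `F` by `u` only the commutator of the weight with
`u·∇` remains (`DivFree.enorm_pair_self_adv_le`), so no derivative of `F`, which is damped but not
smoothed, is lost (`abs_wt_sub_wt_mul_le`). In the other nonlinear terms the derivative is put on `u`,
either directly or by means of `div u = 0` and `div Fᵀ = 0`. As `H^m` with `m ≥ 3` embeds in the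
Wiener algebra of functions with integrable Fourier transform, Young's inequality for convolutions
then bounds the nonlinear terms by the size of the solution times the dissipation of `u` and the
damping of `F` (`Slice.abs_nonlinear_le`, `Slice.abs_nonlinear_zero_le`). For small data they are
absorbed, and the solution stays small for all times (`IsGlobalSolution.total_le`).

The decay comes from Fourier splitting. The Fourier transform of `u₀ ∈ L¹` is bounded, and the
nonlinear terms of the momentum equation are in divergence form, so that the kinetic energy at
frequencies below `ρ` is of order `ρ³` up to a nonlinear contribution, which is controlled by the
decay known so far (`SmallSolution.exists_low_le`). Above `ρ` the dissipation is at least a multiple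
of `ρ²` times the energy, and `F` is damped anyway. With `ρ²` proportional to `1 / (1 + t)` this
improves a decay rate of the energy (`SmallSolution.exists_total_le`); two steps lead from boundedness
to `(1 + t)^(-3/2)`. For the energy of order `j`, the nonlinear coefficients then decay in time: the
energy grows at most exponentially up to a time `T₀` after which they are small, and from then on
splitting gives the rate `(1 + t)^(-3/2 - j)`, as the weight contributes a factor `ρ^(2j)` at low
frequencies (`SmallSolution.exists_total_le_order`).
-/

namespace Oldroyd

open FourierTransform SchwartzMap LineDeriv ComplexConjugate

/-! ### The Fourier transform on `L²(ℝ³)` -/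

/-- The complex Hilbert space `L²(ℝ³; ℂ)`. -/
abbrev L2C : Type := Lp (α := E) ℂ 2 (volume : Measure E)

/-- The pairing between an `L²` function and a Schwartz function is symmetric under the Fourier
transform. -/
theorem integral_mul_fourier (h : L2C) (ψ : 𝓢(E, ℂ)) :
    ∫ x, ψ x * (𝓕 h : L2C) x = ∫ x, 𝓕 ψ x * h x := by
  have := congrArg (fun T => T ψ) (Lp.fourier_toTemperedDistribution_eq h)
  simpa [TemperedDistribution.fourier_apply] using this.symm

theorem integral_mul_fourierInv (h : L2C) (ψ : 𝓢(E, ℂ)) :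
    ∫ x, ψ x * (𝓕⁻ h : L2C) x = ∫ x, 𝓕⁻ ψ x * h x := by
  have := congrArg (fun T => T ψ) (Lp.fourierInv_toTemperedDistribution_eq h)
  simpa [TemperedDistribution.fourierInv_apply] using this.symm

/-- Locally integrable functions are determined by their pairings with Schwartz functions. -/
theorem ae_eq_of_integral_schwartz {f g : E → ℂ} (hf : LocallyIntegrable f)
    (hg : LocallyIntegrable g) (h : ∀ ψ : 𝓢(E, ℂ), ∫ x, ψ x * f x = ∫ x, ψ x * g x) :
    f =ᵐ[volume] g := by
  refine ae_eq_of_integral_contDiff_smul_eq hf hg fun φ hφ hc => ?_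
  have h1 : HasCompactSupport (Complex.ofRealCLM ∘ φ) := hc.comp_left rfl
  have h2 : ContDiff ℝ ∞ (Complex.ofRealCLM ∘ φ) := by fun_prop
  simpa using h (h1.toSchwartzMap h2)

theorem locallyIntegrable_coe (h : L2C) : LocallyIntegrable (h : E → ℂ) :=
  (Lp.memLp h).locallyIntegrable one_le_two

theorem locallyIntegrable_fourier {f : E → ℂ} (hf : Integrable f) :
    LocallyIntegrable (𝓕 f) :=
  (VectorFourier.fourierIntegral_continuous Real.continuous_fourierChar
    (L := innerₗ E) (by exact continuous_inner) hf).locallyIntegrable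

/-- On `L¹ ∩ L²` the `L²` Fourier transform is given by the Fourier integral. -/
theorem fourier_coe_ae_eq (h : L2C) (hi : Integrable (h : E → ℂ)) :
    ((𝓕 h : L2C) : E → ℂ) =ᵐ[volume] 𝓕 (h : E → ℂ) := by
  refine ae_eq_of_integral_schwartz (locallyIntegrable_coe _) (locallyIntegrable_fourier hi)
    fun ψ => ?_
  rw [integral_mul_fourier]
  have := VectorFourier.integral_bilin_fourierIntegral_eq_flip (ContinuousLinearMap.mul ℂ ℂ)
    (L := innerₗ E) Real.continuous_fourierChar continuous_inner (ψ.integrable (μ := volume)) hi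
  simpa using! this

theorem fourierInv_coe_ae_eq (h : L2C) (hi : Integrable (h : E → ℂ)) :
    ((𝓕⁻ h : L2C) : E → ℂ) =ᵐ[volume] 𝓕⁻ (h : E → ℂ) := by
  have hc : Continuous (𝓕⁻ (h : E → ℂ)) :=
    VectorFourier.fourierIntegral_continuous Real.continuous_fourierChar
      (L := -innerₗ E) (by exact continuous_inner.neg) hi
  refine ae_eq_of_integral_schwartz (locallyIntegrable_coe _) hc.locallyIntegrable
    fun ψ => ?_
  rw [integral_mul_fourierInv, eq_comm]
  have := VectorFourier.integral_bilin_fourierIntegral_eq_flip (ContinuousLinearMap.mul ℂ ℂ)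
    (L := -innerₗ E) Real.continuous_fourierChar continuous_inner.neg (ψ.integrable (μ := volume)) hi
  have e : (-innerₗ E).flip = -innerₗ E := by ext; simp [real_inner_comm]
  rw [e] at this
  rw [SchwartzMap.fourierInv_coe]
  exact this.symm

/-- The Schwartz function `η ↦ conj (ψ (ξ - η))`. -/
noncomputable def conjReflect (ξ : E) (ψ : 𝓢(E, ℂ)) : 𝓢(E, ℂ) :=
  (compCLMOfAntilipschitz (K := 1) ℝ (g := fun η : E => ξ - η) (by fun_prop)
    (AntilipschitzWith.of_le_mul_dist fun x y => by simp [dist_eq_norm, norm_sub_rev]) ψ).postcompCLM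
      (Complex.conjCLE : ℂ →L[ℝ] ℂ)

theorem conjReflect_apply (ξ : E) (ψ : 𝓢(E, ℂ)) (η : E) :
    conjReflect ξ ψ η = conj (ψ (ξ - η)) := by
  simp [conjReflect]

theorem fourier_conjReflect (ξ : E) (ψ : 𝓢(E, ℂ)) (x : E) :
    𝓕 (conjReflect ξ ψ) x = (Real.fourierChar (-inner ℝ x ξ) : ℂ) * conj (𝓕 ψ x) := by
  rw [SchwartzMap.fourier_coe, SchwartzMap.fourier_coe, Real.fourier_eq, Real.fourier_eq,
    ← integral_conj, ← integral_const_mul, ← integral_sub_left_eq_self _ volume ξ]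
  refine integral_congr_ae (Eventually.of_forall fun η => ?_)
  have : conj ((Real.fourierChar (-inner ℝ η x) : Circle) : ℂ)
      = (Real.fourierChar (inner ℝ η x) : Circle) := by
    rw [← Circle.coe_inv_eq_conj, ← AddChar.map_neg_eq_inv, neg_neg]
  simp only [conjReflect_apply, Circle.smul_def, smul_eq_mul, map_mul, this, sub_sub_cancel]
  rw [← mul_assoc, ← Circle.coe_mul, ← AddChar.map_add_eq_mul, inner_sub_left,
    real_inner_comm x ξ]
  congr 4
  ring

/-- Conjugating and modulating an `L²` function reflects, conjugates and translates its Fourier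
transform. -/
theorem fourier_modulate_conj (f h : L2C) (ξ : E)
    (hh : ∀ᵐ x, h x = (Real.fourierChar (inner ℝ x ξ) : ℂ) * conj (f x)) :
    ((𝓕 h : L2C) : E → ℂ)
      =ᵐ[volume] fun η => conj ((𝓕 f : L2C) (ξ - η)) := by
  have hm : MemLp (fun η => conj ((𝓕 f : L2C) (ξ - η))) 2 volume := by
    have := (Lp.memLp (𝓕 f : L2C) (μ := volume)).comp_measurePreserving
      (Measure.measurePreserving_sub_left volume ξ)
    exact this.star
  refine ae_eq_of_integral_schwartz (locallyIntegrable_coe _)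
    (hm.locallyIntegrable one_le_two) fun ψ => ?_
  have key := integral_mul_fourier f (conjReflect ξ ψ)
  rw [← integral_sub_left_eq_self (fun x => conjReflect ξ ψ x * _) volume ξ] at key
  have key2 := congrArg conj key
  rw [← integral_conj, ← integral_conj] at key2
  rw [integral_mul_fourier]
  simp only [conjReflect_apply, map_mul, Complex.conj_conj, sub_sub_cancel] at key2
  rw [key2]
  refine integral_congr_ae ?_
  filter_upwards [hh] with x hx
  have : conj ((Real.fourierChar (-inner ℝ x ξ) : Circle) : ℂ)
      = (Real.fourierChar (inner ℝ x ξ) : Circle) := by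
    rw [← Circle.coe_inv_eq_conj, ← AddChar.map_neg_eq_inv, neg_neg]
  rw [hx, fourier_conjReflect, map_mul, Complex.conj_conj, this]
  ring

/-- The Fourier integral of a product of two `L²` functions is the convolution of their Fourier
transforms. -/
theorem fourier_mul_eq_convolution (f g : L2C) (ξ : E) :
    𝓕 (fun x => f x * g x) ξ
      = ∫ η, (𝓕 f : L2C) (ξ - η) * (𝓕 g : L2C) η := by
  have hm : MemLp (fun x => (Real.fourierChar (inner ℝ x ξ) : ℂ) * conj (f x)) 2 volume := by
    refine MemLp.of_le (Lp.memLp f) ?_ (Eventually.of_forall fun x => by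
      rw [norm_mul, Circle.norm_coe, one_mul, RCLike.norm_conj])
    refine AEStronglyMeasurable.mul ?_ (Lp.memLp f).star.1
    exact (continuous_subtype_val.comp (Real.continuous_fourierChar.comp
      (by fun_prop))).aestronglyMeasurable
  have h1 := fourier_modulate_conj f (hm.toLp _) ξ hm.coeFn_toLp
  have h2 := Lp.inner_fourier_eq (hm.toLp _) g
  rw [L2.inner_def, L2.inner_def] at h2
  rw [Real.fourier_eq]
  calc _ = ∫ x, inner ℂ ((hm.toLp _ : L2C) x) (g x) := by
        refine integral_congr_ae ?_
        filter_upwards [hm.coeFn_toLp] with x hx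
        rw [hx, RCLike.inner_apply, map_mul, Complex.conj_conj, Circle.smul_def, smul_eq_mul,
          ← Circle.coe_inv_eq_conj, ← AddChar.map_neg_eq_inv]
        ring
    _ = _ := h2.symm
    _ = _ := by
        refine integral_congr_ae ?_
        filter_upwards [h1] with x hx
        rw [hx, RCLike.inner_apply, Complex.conj_conj, mul_comm]

/-- A square integrable function with integrable Fourier transform is essentially bounded. -/
theorem memLp_top_of_integrable_fourier (f : L2C)
    (hi : Integrable ((𝓕 f : L2C) : E → ℂ)) : MemLp (f : E → ℂ) ∞ volume := by
  have h := fourierInv_coe_ae_eq (𝓕 f : L2C) hi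
  rw [FourierTransform.fourierInv_fourier_eq] at h
  refine memLp_top_of_bound (Lp.memLp f).1 (∫ ξ, ‖(𝓕 f : L2C) ξ‖) ?_
  filter_upwards [h] with x hx
  rw [hx]
  exact VectorFourier.norm_fourierIntegral_le_integral_norm _ _ _ _ _

theorem norm_fourier_le (f : L2C) (hi : Integrable (f : E → ℂ)) :
    ∀ᵐ ξ, ‖(𝓕 f : L2C) ξ‖ ≤ ∫ x, ‖f x‖ := by
  filter_upwards [fourier_coe_ae_eq f hi] with ξ hξ
  rw [hξ]
  exact VectorFourier.norm_fourierIntegral_le_integral_norm _ _ _ _ _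

/-! ### The Fourier transform of real square integrable functions -/

/-- The class in `L²(ℝ³; ℂ)` of a real function; `0` if the function is not square integrable. -/
noncomputable def toL2 (f : E → ℝ) : L2C :=
  open Classical in if h : MemLp (fun x => (f x : ℂ)) 2 volume then h.toLp _ else 0

/-- The `L²` Fourier transform of a real function. -/
noncomputable def hat (f : E → ℝ) : L2C := 𝓕 (toL2 f)

theorem memLp_ofReal {f : E → ℝ} {p : ℝ≥0∞} (hf : MemLp f p volume) :
    MemLp (fun x => (f x : ℂ)) p volume := hf.ofReal

theorem toL2_eq {f : E → ℝ} (hf : MemLp f 2 volume) : toL2 f = (memLp_ofReal hf).toLp _ := by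
  rw [toL2, dif_pos (memLp_ofReal hf)]

theorem coe_toL2 {f : E → ℝ} (hf : MemLp f 2 volume) :
    (toL2 f : E → ℂ) =ᵐ[volume] fun x => (f x : ℂ) := by
  rw [toL2_eq hf]; exact MemLp.coeFn_toLp _

theorem enorm_toL2 {f : E → ℝ} (hf : MemLp f 2 volume) : ‖toL2 f‖ₑ = eLpNorm f 2 volume := by
  rw [toL2_eq hf, Lp.enorm_toLp]
  exact eLpNorm_congr_norm_ae (Eventually.of_forall fun x => by simp)

theorem enorm_hat {f : E → ℝ} (hf : MemLp f 2 volume) : ‖hat f‖ₑ = eLpNorm f 2 volume := by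
  rw [hat, ← enorm_toL2 hf, ← ofReal_norm, ← ofReal_norm, Lp.norm_fourier_eq]

theorem eLpNorm_two_sq {F : Type*} [NormedAddCommGroup F] (f : E → F) :
    eLpNorm f 2 volume ^ 2 = ∫⁻ x, ‖f x‖ₑ ^ 2 := by
  have := eLpNorm_nnreal_pow_eq_lintegral (f := f) (p := 2) (μ := volume) (by norm_num)
  simpa using this

theorem enorm_sq_eq_lintegral (h : L2C) : ‖h‖ₑ ^ 2 = ∫⁻ x, ‖h x‖ₑ ^ 2 := by
  rw [Lp.enorm_def, eLpNorm_two_sq]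

theorem hat_congr {f g : E → ℝ} (hf : MemLp f 2 volume) (h : f =ᵐ[volume] g) :
    hat f = hat g := by
  have hg : MemLp g 2 volume := hf.ae_eq h
  rw [hat, hat, toL2_eq hf, toL2_eq hg]
  congr 1
  rw [MemLp.toLp_eq_toLp_iff]
  filter_upwards [h] with x hx
  rw [hx]

theorem hat_add {f g : E → ℝ} (hf : MemLp f 2 volume) (hg : MemLp g 2 volume) :
    hat (fun x => f x + g x) = hat f + hat g := by
  rw [hat, hat, hat, ← FourierTransform.fourier_add]
  congr 1
  refine Lp.ext ?_
  filter_upwards [coe_toL2 hf, coe_toL2 hg, coe_toL2 (hf.add hg),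
    Lp.coeFn_add (toL2 f) (toL2 g)] with x h1 h2 h3 h4
  simp only [Pi.add_apply] at h3 h4
  rw [h4, h1, h2]
  refine Eq.trans ?_ (h3.trans (by push_cast; rfl))
  rfl

theorem hat_smul {f : E → ℝ} (c : ℝ) (hf : MemLp f 2 volume) :
    hat (fun x => c * f x) = (c : ℂ) • hat f := by
  rw [hat, hat, ← FourierTransform.fourier_smul]
  congr 1
  refine Lp.ext ?_
  filter_upwards [coe_toL2 hf, coe_toL2 (hf.const_mul c),
    Lp.coeFn_smul (c : ℂ) (toL2 f)] with x h1 h3 h4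
  rw [h4, Pi.smul_apply, h1, h3]
  simp

theorem hat_zero : hat (fun _ => 0) = 0 := by
  have := hat_smul (f := fun _ => 0) 0 MemLp.zero
  simpa using this

theorem hat_sub {f g : E → ℝ} (hf : MemLp f 2 volume) (hg : MemLp g 2 volume) :
    hat (fun x => f x - g x) = hat f - hat g := by
  have h := hat_add hf (hg.const_mul (-1))
  rw [hat_smul _ hg] at h
  simpa [sub_eq_add_neg] using h

theorem hat_neg {f : E → ℝ} (hf : MemLp f 2 volume) :
    hat (fun x => - f x) = - hat f := by
  have h := hat_smul (-1) hf
  simpa using h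

theorem hat_sum {κ : Type*} (s : Finset κ) {f : κ → E → ℝ} (hf : ∀ i ∈ s, MemLp (f i) 2 volume) :
    hat (fun x => ∑ i ∈ s, f i x) = ∑ i ∈ s, hat (f i) := by
  classical
  induction s using Finset.induction_on with
  | empty => simpa using hat_zero
  | insert a s ha ih =>
    have h1 := hf a (Finset.mem_insert_self a s)
    have h2 : ∀ i ∈ s, MemLp (f i) 2 volume := fun i hi => hf i (Finset.mem_insert_of_mem hi)
    simp only [Finset.sum_insert ha]
    rw [hat_add h1 (memLp_finsetSum s h2), ih h2]

/-- The Fourier transform of a real function is Hermitian. -/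
theorem hat_sub_conj (f : E → ℝ) :
    (fun ξ => hat f (-ξ)) =ᵐ[volume] fun ξ => conj (hat f ξ) := by
  have h := fourier_modulate_conj (toL2 f) (toL2 f) 0 (by
    by_cases hf : MemLp (fun x => (f x : ℂ)) 2 volume
    · have : (toL2 f : E → ℂ) =ᵐ[volume] fun x => (f x : ℂ) := by
        rw [toL2, dif_pos hf]; exact MemLp.coeFn_toLp _
      filter_upwards [this] with x hx
      rw [hx]; simp
    · rw [toL2, dif_neg hf]
      filter_upwards [Lp.coeFn_zero ℂ 2 (volume : Measure E)] with x hx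
      rw [hx]; simp)
  filter_upwards [h] with ξ hξ
  change (𝓕 (toL2 f) : L2C) ξ = _ at hξ
  rw [zero_sub] at hξ
  rw [hat, hξ, Complex.conj_conj]

/-- The Fourier multiplier `∏ᵣ 2πi ξ_{I r}` of the derivative `∂_I`. -/
noncomputable def symb {k : ℕ} (I : Fin k → Fin 3) (ξ : E) : ℂ :=
  ∏ r, (2 * Real.pi * Complex.I * (ξ (I r) : ℂ))

theorem continuous_symb {k : ℕ} (I : Fin k → Fin 3) : Continuous (symb I) := by
  unfold symb
  refine continuous_finsetProd _ fun r _ => ?_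
  have : Continuous fun ξ : E => ξ (I r) := by fun_prop
  fun_prop

theorem fourierInv_iteratedLineDeriv {k : ℕ} (I : Fin k → Fin 3) (φ : 𝓢(E, ℂ)) (ξ : E) :
    𝓕⁻ (∂^{fun r => EuclideanSpace.single (I r) (1 : ℝ)} φ) ξ
      = (-1) ^ k * symb I ξ * 𝓕⁻ φ ξ := by
  induction k with
  | zero => simp [symb]
  | succ k ih =>
    have := ih (fun r => I r.succ)
    rw [iteratedLineDerivOp_succ_left, SchwartzMap.fourierInv_lineDerivOp_eq]
    have ht : (fun x : E => (inner ℝ x (EuclideanSpace.single (I 0) (1 : ℝ)) : ℝ)).HasTemperateGrowth :=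
      by fun_prop
    have e : Fin.tail (fun r => EuclideanSpace.single (I r) (1 : ℝ))
      = fun r => EuclideanSpace.single (I r.succ) (1 : ℝ) := rfl
    rw [smul_apply, SchwartzMap.smulLeftCLM_apply_apply ht, e, this]
    rw [symb, symb, Fin.prod_univ_succ, EuclideanSpace.inner_single_right]
    simp only [smul_eq_mul, Complex.real_smul, RCLike.conj_to_real, one_mul, pow_succ]
    ring

/-! ### From test functions to Schwartz functions -/

/-- `dirs I` lists the coordinate directions of the derivative `∂_I`. -/
noncomputable def dirs {k : ℕ} (I : Fin k → Fin 3) : Fin k → E :=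
  fun r => EuclideanSpace.single (I r) (1 : ℝ)

/-- Smooth cutoffs with uniformly bounded derivatives that are `1` on large balls. -/
theorem exists_cutoff : ∃ χ : ℕ → E → ℝ, (∀ n, ContDiff ℝ ∞ (χ n)) ∧ (∀ n, HasCompactSupport (χ n)) ∧
    (∀ (n : ℕ) x, ‖x‖ < n + 1 → χ n =ᶠ[𝓝 x] fun _ => 1) ∧
    ∀ i, ∃ B : ℝ, 0 ≤ B ∧ ∀ n x, ‖iteratedFDeriv ℝ i (χ n) x‖ ≤ B := by
  let χ : ContDiffBump (0 : E) := ⟨1, 2, one_pos, one_lt_two⟩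
  let S : 𝓢(E, ℝ) := χ.hasCompactSupport.toSchwartzMap χ.contDiff
  let g : ℕ → E →L[ℝ] E := fun n => ((n + 1 : ℝ)⁻¹) • ContinuousLinearMap.id ℝ E
  have hg : ∀ n x, g n x = ((n + 1 : ℝ)⁻¹) • x := fun n x => rfl
  have hg1 : ∀ n, ‖g n‖ ≤ 1 := fun n => by
    refine ContinuousLinearMap.opNorm_le_bound _ zero_le_one fun x => ?_
    rw [hg, norm_smul, Real.norm_of_nonneg (by positivity)]
    gcongr
    exact inv_le_one_of_one_le₀ (by linarith [n.cast_nonneg (α := ℝ)])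
  refine ⟨fun n => χ ∘ g n, fun n => χ.contDiff.comp (g n).contDiff, fun n => ?_, fun n x hx => ?_,
    fun i => ⟨SchwartzMap.seminorm ℝ 0 i S, apply_nonneg _ _, fun n x => ?_⟩⟩
  · have hn : ((n + 1 : ℝ)⁻¹) ≠ 0 := by positivity
    exact χ.hasCompactSupport.comp_homeomorph (Homeomorph.smulOfNeZero _ hn)
  · have h1 : g n x ∈ Metric.ball (0 : E) 1 := by
      rw [mem_ball_zero_iff, hg, norm_smul, Real.norm_of_nonneg (by positivity)]
      rw [inv_mul_lt_one₀ (by positivity)]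
      exact hx
    have h2 : χ =ᶠ[𝓝 (g n x)] 1 := χ.eventuallyEq_one_of_mem_ball h1
    exact (g n).continuous.continuousAt.eventually h2
  · have := (g n).iteratedFDeriv_comp_right (f := χ) χ.contDiff x (i := i) (n := ∞)
      (mod_cast le_top)
    rw [this]
    refine (ContinuousMultilinearMap.norm_compContinuousLinearMap_le _ _).trans ?_
    calc _ ≤ ‖iteratedFDeriv ℝ i χ (g n x)‖ * 1 := by
          gcongr
          exact Finset.prod_le_one (fun _ _ => norm_nonneg _) fun _ _ => hg1 n
      _ ≤ _ := by
          rw [mul_one]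
          exact SchwartzMap.norm_iteratedFDeriv_le_seminorm ℝ S i (g n x)

/-- Derivatives of Schwartz functions are dominated by a fixed square integrable function. -/
theorem exists_iteratedFDeriv_bound (φ : 𝓢(E, ℂ)) (k : ℕ) : ∃ C : ℝ, 0 ≤ C ∧ ∀ i ≤ k, ∀ x,
    ‖iteratedFDeriv ℝ i φ x‖ ≤ C * (1 + ‖x‖) ^ (-(4 : ℝ)) := by
  refine ⟨2 ^ 4 * (Finset.Iic (4, k)).sup (fun m => SchwartzMap.seminorm ℝ m.1 m.2) φ, by positivity,
    fun i hi x => ?_⟩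
  have := SchwartzMap.one_add_le_sup_seminorm_apply (𝕜 := ℝ) (m := (4, k)) (k := 4) (n := i) le_rfl hi φ x
  rw [Real.rpow_neg (by positivity), ← div_eq_mul_inv, le_div_iff₀ (by positivity), mul_comm]
  exact_mod_cast this

theorem memLp_weight : MemLp (fun x : E => (1 + ‖x‖) ^ (-(4 : ℝ))) 2 volume := by
  have hc : Continuous fun x : E => (1 + ‖x‖) ^ (-(4 : ℝ)) := by
    refine Continuous.rpow_const (by fun_prop) fun x => Or.inl (by positivity)
  rw [memLp_two_iff_integrable_sq hc.aestronglyMeasurable]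
  have : Integrable (fun x : E => (1 + ‖x‖) ^ (-(8 : ℝ))) volume :=
    integrable_one_add_norm (by simp; norm_num)
  refine this.congr (Eventually.of_forall fun x => ?_)
  simp only
  rw [← Real.rpow_natCast, ← Real.rpow_mul (by positivity)]
  norm_num

/-- An identity between integrals against derivatives of real test functions extends to Schwartz
functions. -/
theorem integral_schwartz_of_test {k l : ℕ} (I : Fin k → Fin 3) (J : Fin l → Fin 3) {f g : E → ℝ}
    (hf : MemLp f 2 volume) (hg : MemLp g 2 volume) (c : ℝ)
    (h : ∀ φ : E → ℝ, ContDiff ℝ ∞ φ → HasCompactSupport φ →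
      ∫ x, f x * iteratedFDeriv ℝ k φ x (dirs I) = c * ∫ x, g x * iteratedFDeriv ℝ l φ x (dirs J))
    (φ : 𝓢(E, ℂ)) :
    ∫ x, (f x : ℂ) * iteratedFDeriv ℝ k φ x (dirs I)
      = c * ∫ x, (g x : ℂ) * iteratedFDeriv ℝ l φ x (dirs J) := by
  have intg : ∀ {k : ℕ} (I : Fin k → Fin 3) {f : E → ℝ} (hf : MemLp f 2 volume) {Φ : E → ℂ}
      (hΦ : ContDiff ℝ ∞ Φ) (hc : HasCompactSupport Φ),
      Integrable (fun x => (f x : ℂ) * iteratedFDeriv ℝ k Φ x (dirs I)) := by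
    intro k I f hf Φ hΦ hc
    have h1 : Continuous fun x => iteratedFDeriv ℝ k Φ x (dirs I) := by
      have := hΦ.continuous_iteratedFDeriv (m := k) (mod_cast le_top)
      exact (ContinuousMultilinearMap.apply ℝ (fun _ => E) ℂ (dirs I)).continuous.comp this
    have h2 : HasCompactSupport fun x => iteratedFDeriv ℝ k Φ x (dirs I) :=
      (hc.iteratedFDeriv k).comp_left (g := fun T : E [×k]→L[ℝ] ℂ => T (dirs I)) rfl
    exact (memLp_ofReal hf).integrable_mul (q := 2) (h1.memLp_of_hasCompactSupport h2)
  have hcomp : ∀ {k : ℕ} (I : Fin k → Fin 3) (L : ℂ →L[ℝ] ℝ) {Φ : E → ℂ} (hΦ : ContDiff ℝ ∞ Φ)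
      (x : E), iteratedFDeriv ℝ k (L ∘ Φ) x (dirs I) = L (iteratedFDeriv ℝ k Φ x (dirs I)) := by
    intro k I L Φ hΦ x
    rw [L.iteratedFDeriv_comp_left hΦ.contDiffAt (mod_cast le_top)]
    rfl
  -- The identity for complex test functions with compact support; cutoffs then reach `φ`.
  have step : ∀ Φ : E → ℂ, ContDiff ℝ ∞ Φ → HasCompactSupport Φ →
      ∫ x, (f x : ℂ) * iteratedFDeriv ℝ k Φ x (dirs I)
        = c * ∫ x, (g x : ℂ) * iteratedFDeriv ℝ l Φ x (dirs J) := by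
    intro Φ hΦ hc
    have hL : ∀ L : ℂ →L[ℝ] ℝ, L (∫ x, (f x : ℂ) * iteratedFDeriv ℝ k Φ x (dirs I))
        = c * L (∫ x, (g x : ℂ) * iteratedFDeriv ℝ l Φ x (dirs J)) := by
      intro L
      have := h (L ∘ Φ) (L.contDiff.comp hΦ) (hc.comp_left (map_zero L))
      rw [← L.integral_comp_comm (intg I hf hΦ hc), ← L.integral_comp_comm (intg J hg hΦ hc)]
      simp only [hcomp _ L hΦ] at this
      have e : ∀ (r : ℝ) (z : ℂ), L ((r : ℂ) * z) = r * L z := fun r z => by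
        rw [← Complex.real_smul, map_smul, smul_eq_mul]
      simpa only [e] using this
    apply Complex.ext
    · simpa using hL Complex.reCLM
    · simpa using hL Complex.imCLM
  obtain ⟨χ, χs, χc, χ1, χb⟩ := exists_cutoff
  have lim : ∀ {k : ℕ} (I : Fin k → Fin 3) {f : E → ℝ} (hf : MemLp f 2 volume),
      Tendsto (fun n => ∫ x, (f x : ℂ) * iteratedFDeriv ℝ k (fun x => (χ n x) • φ x) x (dirs I)) atTop
        (𝓝 (∫ x, (f x : ℂ) * iteratedFDeriv ℝ k φ x (dirs I))) := by
    intro k I f hf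
    choose B hB0 hB using χb
    obtain ⟨C, hC0, hC⟩ := exists_iteratedFDeriv_bound φ k
    let K : ℝ := ∑ i ∈ Finset.range (k + 1), (k.choose i : ℝ) * B i * C
    have hdir : ∏ r, ‖dirs I r‖ = 1 := by simp [dirs]
    refine tendsto_integral_of_dominated_convergence
      (fun x => ‖f x‖ * (K * (1 + ‖x‖) ^ (-(4 : ℝ)))) (fun n => ?_) ?_ (fun n => ?_) ?_
    · refine (intg I hf ((χs n).smul (φ.smooth ⊤)) ?_).1
      exact (χc n).smul_right
    · exact hf.norm.integrable_mul (memLp_weight.const_mul K)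
    · refine Eventually.of_forall fun x => ?_
      rw [norm_mul, Complex.norm_real]
      gcongr
      refine (ContinuousMultilinearMap.le_opNorm _ _).trans ?_
      rw [hdir, mul_one]
      refine (norm_iteratedFDeriv_smul_le (χs n) (φ.smooth ⊤) x (mod_cast le_top)).trans ?_
      rw [Finset.sum_mul]
      refine Finset.sum_le_sum fun i hi => ?_
      rw [mul_assoc _ C]
      gcongr
      · have := hB0 i; positivity
      · exact hB i n x
      · exact hC _ (Nat.sub_le k i) x
    · refine Eventually.of_forall fun x => ?_
      refine tendsto_const_nhds.congr' ?_
      obtain ⟨N, hN⟩ := exists_nat_gt ‖x‖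
      filter_upwards [eventually_ge_atTop N] with n hn
      have hx : ‖x‖ < n + 1 := by
        have : (N : ℝ) ≤ n := by exact_mod_cast hn
        linarith
      have : (fun x => (χ n x) • φ x) =ᶠ[𝓝 x] φ := by
        filter_upwards [χ1 n x hx] with y hy
        rw [hy, one_smul]
      rw [(this.iteratedFDeriv ℝ k).self_of_nhds]
  refine tendsto_nhds_unique (lim I hf) ?_
  refine Tendsto.congr (fun n => ?_) ((lim J hg).const_mul (c : ℂ))
  exact (step _ ((χs n).smul (φ.smooth ⊤)) (χc n).smul_right).symm

/-! ### Weak derivatives on the Fourier side -/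

theorem locallyIntegrable_continuous_mul {s h : E → ℂ} (hs : Continuous s)
    (hh : LocallyIntegrable h) : LocallyIntegrable fun ξ => s ξ * h ξ := by
  rw [← locallyIntegrableOn_univ] at hh ⊢
  exact hh.continuousOn_mul hs.continuousOn isOpen_univ.isLocallyClosed

/-- The pairing of `f` with a derivative of a Schwartz function, by Parseval's formula. -/
theorem integral_mul_iteratedFDeriv {k : ℕ} (I : Fin k → Fin 3) {f : E → ℝ}
    (hf : MemLp f 2 volume) (φ : 𝓢(E, ℂ)) :
    ∫ x, (f x : ℂ) * iteratedFDeriv ℝ k φ x (dirs I)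
      = ∫ ξ, 𝓕⁻ φ ξ * ((-1) ^ k * symb I ξ * hat f ξ) := by
  have := integral_mul_fourierInv (hat f) (∂^{dirs I} φ)
  rw [hat, FourierTransform.fourierInv_fourier_eq, ← hat] at this
  calc _ = ∫ x, (∂^{dirs I} φ) x * toL2 f x := by
        refine integral_congr_ae ?_
        filter_upwards [coe_toL2 hf] with x hx
        rw [hx, SchwartzMap.iteratedLineDerivOp_eq_iteratedFDeriv, mul_comm]
    _ = _ := this
    _ = _ := by
        refine integral_congr_ae (Eventually.of_forall fun ξ => ?_)
        beta_reduce
        rw [show dirs I = fun r => EuclideanSpace.single (I r) (1 : ℝ) from rfl,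
          fourierInv_iteratedLineDeriv]
        ring

/-- A relation between distributional derivatives of square integrable functions, read on the
Fourier side. -/
theorem symb_mul_hat_of_test {k l : ℕ} (I : Fin k → Fin 3) (J : Fin l → Fin 3) {f g : E → ℝ}
    (hf : MemLp f 2 volume) (hg : MemLp g 2 volume) (c : ℝ)
    (h : ∀ φ : E → ℝ, ContDiff ℝ ∞ φ → HasCompactSupport φ →
      ∫ x, f x * iteratedFDeriv ℝ k φ x (dirs I) = c * ∫ x, g x * iteratedFDeriv ℝ l φ x (dirs J)) :
    ∀ᵐ ξ, (-1) ^ k * symb I ξ * hat f ξ = c * ((-1) ^ l * symb J ξ * hat g ξ) := by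
  have li : ∀ {k : ℕ} (I : Fin k → Fin 3) (f : E → ℝ),
      LocallyIntegrable fun ξ => (-1) ^ k * symb I ξ * hat f ξ := fun I f =>
    locallyIntegrable_continuous_mul (continuous_const.mul (continuous_symb I))
      (locallyIntegrable_coe _)
  refine ae_eq_of_integral_schwartz (li I f) ((li J g).smul (c : ℂ)) fun θ => ?_
  have := integral_schwartz_of_test I J hf hg c h (𝓕 θ)
  rw [integral_mul_iteratedFDeriv I hf, integral_mul_iteratedFDeriv J hg,
    FourierTransform.fourierInv_fourier_eq] at this
  rw [this, ← integral_const_mul]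
  refine integral_congr_ae (Eventually.of_forall fun ξ => ?_)
  beta_reduce
  ring

theorem symb_fin_zero (I : Fin 0 → Fin 3) (ξ : E) : symb I ξ = 1 := by simp [symb]

theorem IsWeakDeriv.hat_eq {k : ℕ} {I : Fin k → Fin 3} {f g : E → ℝ} (h : IsWeakDeriv I f g)
    (hf : MemLp f 2 volume) (hg : MemLp g 2 volume) :
    ∀ᵐ ξ, hat g ξ = symb I ξ * hat f ξ := by
  have := symb_mul_hat_of_test I (![] : Fin 0 → Fin 3) hf hg ((-1) ^ k) (by
    intro φ h1 h2
    simpa using! h.2.2 φ h1 h2)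
  filter_upwards [this] with ξ hξ
  rw [symb_fin_zero] at hξ
  push_cast at hξ
  have h1 : ((-1 : ℂ) ^ k) * (-1) ^ k = 1 := by rw [← mul_pow]; simp
  calc hat g ξ = ((-1 : ℂ) ^ k * (-1) ^ k) * hat g ξ := by rw [h1, one_mul]
    _ = (-1) ^ k * ((-1) ^ k * symb I ξ * hat f ξ) := by rw [hξ]; ring
    _ = ((-1 : ℂ) ^ k * (-1) ^ k) * (symb I ξ * hat f ξ) := by ring
    _ = _ := by rw [h1, one_mul]

/-- A square integrable function whose Fourier transform remains square integrable after
multiplication by the symbol of `∂_I` has a square integrable weak derivative `∂_I f`. -/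
theorem exists_isWeakDeriv {k : ℕ} (I : Fin k → Fin 3) {f : E → ℝ} (hf : MemLp f 2 volume)
    (hw : MemLp (fun ξ => symb I ξ * hat f ξ) 2 volume) :
    ∃ g, IsWeakDeriv I f g ∧ MemLp g 2 volume ∧
      eLpNorm g 2 volume ≤ eLpNorm (fun ξ => symb I ξ * hat f ξ) 2 volume := by
  let W : L2C := hw.toLp _
  let G : L2C := 𝓕⁻ W
  have hG : MemLp (fun x => (G x).re) 2 volume := (Lp.memLp G).re
  refine ⟨fun x => (G x).re, ⟨hf.locallyIntegrable one_le_two, hG.locallyIntegrable one_le_two,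
    fun φ h1 h2 => ?_⟩, hG, ?_⟩
  · have hc : HasCompactSupport (Complex.ofRealCLM ∘ φ) := h2.comp_left rfl
    have hs : ContDiff ℝ ∞ (Complex.ofRealCLM ∘ φ) := by fun_prop
    let Φ : 𝓢(E, ℂ) := hc.toSchwartzMap hs
    have hΦ : ∀ x, Φ x = (φ x : ℂ) := fun x => rfl
    have e1 := integral_mul_iteratedFDeriv I hf Φ
    have e2 : ∫ x, Φ x * G x = ∫ ξ, 𝓕⁻ Φ ξ * (symb I ξ * hat f ξ) := by
      rw [integral_mul_fourierInv]
      refine integral_congr_ae ?_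
      filter_upwards [hw.coeFn_toLp] with ξ hξ
      rw [hξ]
    have e3 : ∫ x, (f x : ℂ) * iteratedFDeriv ℝ k Φ x (dirs I) = (-1) ^ k * ∫ x, Φ x * G x := by
      rw [e1, e2, ← integral_const_mul]
      refine integral_congr_ae (Eventually.of_forall fun ξ => ?_)
      simp only
      ring
    have e4 : ∀ x, (f x : ℂ) * iteratedFDeriv ℝ k Φ x (dirs I)
        = ((f x * iteratedFDeriv ℝ k φ x (dirs I) : ℝ) : ℂ) := fun x => by
      have : (Φ : E → ℂ) = Complex.ofRealCLM ∘ φ := rfl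
      rw [this, Complex.ofRealCLM.iteratedFDeriv_comp_left h1.contDiffAt (mod_cast le_top)]
      simp
    have e5 := congrArg Complex.re e3
    simp only [e4] at e5
    rw [integral_complex_ofReal, Complex.ofReal_re] at e5
    have e6 : ((-1 : ℂ) ^ k) = (((-1) ^ k : ℝ) : ℂ) := by push_cast; rfl
    rw [e6, Complex.re_ofReal_mul] at e5
    change ∫ x, f x * iteratedFDeriv ℝ k φ x (dirs I) = _
    rw [e5]
    congr 1
    have hi : Integrable fun x => Φ x * G x :=
      (Φ.memLp 2 volume).integrable_mul (Lp.memLp G)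
    rw [← RCLike.re_eq_complex_re, ← integral_re hi]
    refine integral_congr_ae (Eventually.of_forall fun x => ?_)
    simp only [hΦ, RCLike.re_eq_complex_re, Complex.re_ofReal_mul]
    ring
  · calc eLpNorm (fun x => (G x).re) 2 volume ≤ eLpNorm G 2 volume :=
          eLpNorm_mono fun x => by simpa using Complex.abs_re_le_norm (G x)
      _ = ‖G‖ₑ := (Lp.enorm_def G).symm
      _ = ‖W‖ₑ := by
          have : ‖G‖ = ‖W‖ := by
            rw [← Lp.norm_fourier_eq, FourierTransform.fourier_fourierInv_eq]
          rw [← ofReal_norm, ← ofReal_norm, this]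
      _ = _ := Lp.enorm_toLp _

theorem eLpNorm_symb_mul_hat {k : ℕ} (I : Fin k → Fin 3) (f : E → ℝ) :
    eLpNorm (fun ξ => symb I ξ * hat f ξ) 2 volume ^ 2
      = ∫⁻ ξ, ‖symb I ξ‖ₑ ^ 2 * ‖hat f ξ‖ₑ ^ 2 := by
  rw [eLpNorm_two_sq]
  simp only [enorm_mul, mul_pow]

theorem aestronglyMeasurable_symb_mul_hat {k : ℕ} (I : Fin k → Fin 3) (f : E → ℝ) :
    AEStronglyMeasurable (fun ξ => symb I ξ * hat f ξ) volume :=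
  (continuous_symb I).aestronglyMeasurable.mul (Lp.memLp (hat f)).1

theorem memLp_symb_mul_hat {k : ℕ} {I : Fin k → Fin 3} {f : E → ℝ}
    (h : ∫⁻ ξ, ‖symb I ξ‖ₑ ^ 2 * ‖hat f ξ‖ₑ ^ 2 < ⊤) :
    MemLp (fun ξ => symb I ξ * hat f ξ) 2 volume := by
  refine ⟨aestronglyMeasurable_symb_mul_hat I f, ?_⟩
  rw [← eLpNorm_symb_mul_hat] at h
  by_contra hn
  rw [not_lt, top_le_iff] at hn
  rw [hn] at h
  simp at h

/-- The size of a weak derivative is computed on the Fourier side, whether or not it is finite. -/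
theorem iInf_eLpNorm_weakDeriv {k : ℕ} (I : Fin k → Fin 3) {f : E → ℝ} (hf : MemLp f 2 volume) :
    ⨅ (g : E → ℝ) (_ : IsWeakDeriv I f g), eLpNorm g 2 volume ^ 2
      = ∫⁻ ξ, ‖symb I ξ‖ₑ ^ 2 * ‖hat f ξ‖ₑ ^ 2 := by
  apply le_antisymm
  · by_cases h : ∫⁻ ξ, ‖symb I ξ‖ₑ ^ 2 * ‖hat f ξ‖ₑ ^ 2 < ⊤
    · obtain ⟨g, hg, -, hle⟩ := exists_isWeakDeriv I hf (memLp_symb_mul_hat h)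
      refine (iInf₂_le g hg).trans ?_
      rw [← eLpNorm_symb_mul_hat]
      gcongr
    · rw [not_lt, top_le_iff] at h
      rw [h]; exact le_top
  · refine le_iInf₂ fun g hg => ?_
    by_cases hn : eLpNorm g 2 volume = ⊤
    · rw [hn]; simp
    · have hm : MemLp g 2 volume := ⟨hg.2.1.aestronglyMeasurable, lt_top_iff_ne_top.2 hn⟩
      rw [← enorm_hat hm, enorm_sq_eq_lintegral]
      refine le_of_eq (lintegral_congr_ae ?_)
      filter_upwards [hg.hat_eq hf hm] with ξ hξ
      rw [hξ, enorm_mul, mul_pow]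

theorem sum_enorm_symb_sq (k : ℕ) (ξ : E) :
    ∑ I : Fin k → Fin 3, ‖symb I ξ‖ₑ ^ 2 = ENNReal.ofReal ((2 * Real.pi * ‖ξ‖) ^ (2 * k)) := by
  have h1 : ∀ I : Fin k → Fin 3, ‖symb I ξ‖ₑ ^ 2
      = ENNReal.ofReal (∏ r, (2 * Real.pi) ^ 2 * ξ (I r) ^ 2) := fun I => by
    rw [← ofReal_norm, ← ENNReal.ofReal_pow (norm_nonneg _), symb, norm_prod, ← Finset.prod_pow]
    congr 1
    refine Finset.prod_congr rfl fun r _ => ?_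
    simp only [norm_mul, Complex.norm_real, Complex.norm_I, mul_one, Complex.norm_ofNat, mul_pow,
      Real.norm_eq_abs, sq_abs]
  simp only [h1]
  rw [← ENNReal.ofReal_sum_of_nonneg fun I _ => Finset.prod_nonneg fun r _ => by positivity]
  congr 1
  rw [← Fintype.sum_pow (fun l => (2 * Real.pi) ^ 2 * ξ l ^ 2) k, pow_mul,
    mul_pow (2 * Real.pi) ‖ξ‖, EuclideanSpace.real_norm_sq_eq, Finset.mul_sum]

/-- Plancherel's formula for `‖∇^j w‖²`. -/
theorem gradNormSq_eq {ι : Type} [Fintype ι] (j : ℕ) {w : E → ι → ℝ}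
    (hw : ∀ a, MemLp (fun x => w x a) 2 volume) :
    gradNormSq j w = ∑ a, ∫⁻ ξ, ENNReal.ofReal ((2 * Real.pi * ‖ξ‖) ^ (2 * j))
      * ‖hat (fun x => w x a) ξ‖ₑ ^ 2 := by
  unfold gradNormSq
  refine Finset.sum_congr rfl fun a _ => ?_
  simp only [iInf_eLpNorm_weakDeriv _ (hw a)]
  rw [← lintegral_finsetSum' _ fun I _ => ?_]
  · simp only [← Finset.sum_mul, sum_enorm_symb_sq]
  · exact ((continuous_symb I).enorm.measurable.pow_const 2).aemeasurable.mul
      ((Lp.memLp (hat _)).1.enorm.pow_const 2)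

theorem IsWeakDeriv.unique {k : ℕ} {I : Fin k → Fin 3} {f g g' : E → ℝ}
    (h : IsWeakDeriv I f g) (h' : IsWeakDeriv I f g') : g =ᵐ[volume] g' := by
  refine ae_eq_of_integral_contDiff_smul_eq h.2.1 h'.2.1 fun φ h1 h2 => ?_
  have e := (h.2.2 φ h1 h2).symm.trans (h'.2.2 φ h1 h2)
  have := mul_left_cancel₀ (pow_ne_zero k (by norm_num : (-1 : ℝ) ≠ 0)) e
  simpa [mul_comm] using this

/-- The weak derivative of order `0` is the function itself. -/
theorem memLp_of_gradNormSq_zero {ι : Type} [Fintype ι] {w : E → ι → ℝ}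
    (h : gradNormSq 0 w < ⊤) (a : ι) : MemLp (fun x => w x a) 2 volume := by
  unfold gradNormSq at h
  have h1 := ENNReal.sum_lt_top.1 (ENNReal.sum_lt_top.1 h a (Finset.mem_univ a))
    (![] : Fin 0 → Fin 3) (Finset.mem_univ _)
  simp only [iInf_lt_iff] at h1
  obtain ⟨g, hg, hlt⟩ := h1
  have hm : MemLp g 2 volume := by
    refine ⟨hg.2.1.aestronglyMeasurable, ?_⟩
    by_contra hn
    rw [not_lt, top_le_iff] at hn
    rw [hn] at hlt
    simp at hlt
  refine hm.ae_eq ?_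
  refine ae_eq_of_integral_contDiff_smul_eq hg.2.1 hg.1 fun φ h1 h2 => ?_
  have := hg.2.2 φ h1 h2
  simpa [mul_comm] using this.symm

theorem isWeakDeriv_weakDeriv {k : ℕ} {I : Fin k → Fin 3} {f : E → ℝ}
    (h : ∃ g, IsWeakDeriv I f g) : IsWeakDeriv I f (weakDeriv I f) := by
  rw [weakDeriv, dif_pos h]; exact h.choose_spec

/-- `weakDeriv` is the expected Fourier multiplier as soon as the latter is square integrable. -/
theorem weakDeriv_spec {k : ℕ} {I : Fin k → Fin 3} {f : E → ℝ} (hf : MemLp f 2 volume)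
    (h : ∫⁻ ξ, ‖symb I ξ‖ₑ ^ 2 * ‖hat f ξ‖ₑ ^ 2 < ⊤) :
    MemLp (weakDeriv I f) 2 volume ∧ ∀ᵐ ξ, hat (weakDeriv I f) ξ = symb I ξ * hat f ξ := by
  obtain ⟨g, hg, hm, -⟩ := exists_isWeakDeriv I hf (memLp_symb_mul_hat h)
  have h1 := isWeakDeriv_weakDeriv ⟨g, hg⟩
  have h2 : MemLp (weakDeriv I f) 2 volume := hm.ae_eq (hg.unique h1)
  exact ⟨h2, h1.hat_eq hf h2⟩

/-! ### Trilinear convolution forms and truncated weights -/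

/-- The Cauchy–Schwarz inequality. -/
theorem lintegral_mul_le_sqrt {g h : E → ℝ≥0∞} (mg : AEMeasurable g) (mh : AEMeasurable h) {x y : ℝ}
    (hg : ∫⁻ ξ, g ξ ^ 2 ≤ ENNReal.ofReal x) (hh : ∫⁻ ξ, h ξ ^ 2 ≤ ENNReal.ofReal y) :
    ∫⁻ ξ, g ξ * h ξ ≤ ENNReal.ofReal (√x * √y) := by
  have key := ENNReal.lintegral_mul_le_Lp_mul_Lq (volume : Measure E) Real.HolderConjugate.two_two mg mh
  have e : ∀ (f : E → ℝ≥0∞) (z : ℝ), ∫⁻ ξ, f ξ ^ 2 ≤ ENNReal.ofReal z →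
      (∫⁻ ξ, f ξ ^ (2 : ℝ)) ^ (1 / 2 : ℝ) ≤ ENNReal.ofReal √z := fun f z hz => by
    simp only [ENNReal.rpow_two]
    calc _ ≤ (ENNReal.ofReal z) ^ (1 / 2 : ℝ) := by gcongr
      _ ≤ (ENNReal.ofReal (√z ^ 2)) ^ (1 / 2 : ℝ) := by
          gcongr
          rcases le_total 0 z with h | h
          · rw [Real.sq_sqrt h]
          · exact h.trans (sq_nonneg _)
      _ = _ := by
          rw [ENNReal.ofReal_pow (Real.sqrt_nonneg _), ← ENNReal.rpow_natCast, ← ENNReal.rpow_mul]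
          norm_num
  refine key.trans ?_
  rw [ENNReal.ofReal_mul (Real.sqrt_nonneg _)]
  exact mul_le_mul' (e g x hg) (e h y hh)

/-- The trilinear convolution form `∫∫ f(ξ - η) g(η) h(ξ) dη dξ`. -/
noncomputable def tri (f g h : E → ℝ≥0∞) : ℝ≥0∞ := ∫⁻ ξ, ∫⁻ η, f (ξ - η) * g η * h ξ

theorem lintegral_sub_right_sq (f : E → ℝ≥0∞) (η : E) :
    ∫⁻ ξ, f (ξ - η) ^ 2 = ∫⁻ ξ, f ξ ^ 2 :=
  lintegral_sub_right_eq_self (fun ξ => f ξ ^ 2) η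

/-- Young's and Cauchy–Schwarz' inequalities, with the second factor in `L¹`. -/
theorem tri_le_of_right {f g h : E → ℝ≥0∞} (mf : Measurable f) (mg : Measurable g)
    (mh : Measurable h) {n x y : ℝ} (hn : 0 ≤ n) (hf : ∫⁻ ξ, f ξ ^ 2 ≤ ENNReal.ofReal x)
    (hg : ∫⁻ ξ, g ξ ≤ ENNReal.ofReal n) (hh : ∫⁻ ξ, h ξ ^ 2 ≤ ENNReal.ofReal y) :
    tri f g h ≤ ENNReal.ofReal (n * (√x * √y)) := by
  unfold tri
  rw [lintegral_lintegral_swap (by fun_prop)]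
  calc _ = ∫⁻ η, g η * ∫⁻ ξ, f (ξ - η) * h ξ := by
        refine lintegral_congr fun η => ?_
        rw [← lintegral_const_mul _ (by fun_prop)]
        exact lintegral_congr fun ξ => by ring
    _ ≤ ∫⁻ η, g η * ENNReal.ofReal (√x * √y) := by
        refine lintegral_mono fun η => ?_
        refine mul_le_mul_right ?_ _
        refine lintegral_mul_le_sqrt (by fun_prop) mh.aemeasurable ?_ hh
        rwa [lintegral_sub_right_sq]
    _ ≤ _ := by
        rw [lintegral_mul_const _ mg, ENNReal.ofReal_mul hn]
        gcongr

/-- Young's and Cauchy–Schwarz' inequalities, with the first factor in `L¹`. -/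
theorem tri_le_of_left {f g h : E → ℝ≥0∞} (mf : Measurable f) (mg : Measurable g)
    (mh : Measurable h) {n x y : ℝ} (hn : 0 ≤ n) (hf : ∫⁻ ξ, f ξ ≤ ENNReal.ofReal n)
    (hg : ∫⁻ ξ, g ξ ^ 2 ≤ ENNReal.ofReal x) (hh : ∫⁻ ξ, h ξ ^ 2 ≤ ENNReal.ofReal y) :
    tri f g h ≤ ENNReal.ofReal (n * (√x * √y)) := by
  have : tri f g h = tri g f h := by
    unfold tri
    refine lintegral_congr fun ξ => ?_
    rw [← lintegral_sub_left_eq_self _ ξ]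
    exact lintegral_congr fun η => by rw [sub_sub_cancel]; ring
  rw [this]
  exact tri_le_of_right mg mf mh hn hg hf hh

theorem tri_mono {f g h f' g' h' : E → ℝ≥0∞} (hf : ∀ ξ, f ξ ≤ f' ξ) (hg : ∀ ξ, g ξ ≤ g' ξ)
    (hh : ∀ ξ, h ξ ≤ h' ξ) : tri f g h ≤ tri f' g' h' :=
  lintegral_mono fun ξ => lintegral_mono fun η => by
    dsimp only
    gcongr
    · exact hf _
    · exact hg _
    · exact hh _

/-- The truncated homogeneous weight `min(|ξ|, R)^k`. The truncation keeps the weighted energies of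
every order finite and differentiable in time, whatever the regularity of the solution. -/
noncomputable def wt (k : ℕ) (R : ℝ) (ξ : E) : ℝ := min ‖ξ‖ R ^ k

theorem wt_nonneg (k : ℕ) {R : ℝ} (hR : 0 ≤ R) (ξ : E) : 0 ≤ wt k R ξ :=
  pow_nonneg (le_min (norm_nonneg _) hR) _

theorem wt_le (k : ℕ) {R : ℝ} (hR : 0 ≤ R) (ξ : E) : wt k R ξ ≤ R ^ k :=
  pow_le_pow_left₀ (le_min (norm_nonneg _) hR) (min_le_right _ _) _

theorem wt_le_norm (k : ℕ) {R : ℝ} (hR : 0 ≤ R) (ξ : E) : wt k R ξ ≤ ‖ξ‖ ^ k :=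
  pow_le_pow_left₀ (le_min (norm_nonneg _) hR) (min_le_left _ _) _

theorem continuous_wt (k : ℕ) (R : ℝ) : Continuous (wt k R) := by
  unfold wt; fun_prop

theorem wt_zero (R : ℝ) (ξ : E) : wt 0 R ξ = 1 := pow_zero _

theorem pow_add_le {b c : ℝ} (hb : 0 ≤ b) (hc : 0 ≤ c) (k : ℕ) :
    (b + c) ^ k ≤ 2 ^ k * (b ^ k + c ^ k) := by
  have h : b + c ≤ 2 * max b c := by
    have := le_max_left b c; have := le_max_right b c; linarith
  calc (b + c) ^ k ≤ (2 * max b c) ^ k := pow_le_pow_left₀ (by positivity) h _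
    _ = 2 ^ k * max b c ^ k := mul_pow _ _ _
    _ ≤ _ := by
        gcongr
        rcases max_cases b c with ⟨h, -⟩ | ⟨h, -⟩ <;> rw [h]
        · have := pow_nonneg hc k; linarith
        · have := pow_nonneg hb k; linarith

theorem min_norm_le {R : ℝ} (hR : 0 ≤ R) (ξ η : E) :
    min ‖ξ‖ R ≤ min ‖η‖ R + min ‖ξ - η‖ R := by
  have h : ‖ξ‖ ≤ ‖η‖ + ‖ξ - η‖ := by simpa using norm_add_le η (ξ - η)
  have := norm_nonneg η
  have := norm_nonneg (ξ - η)
  rcases min_cases ‖η‖ R with ⟨h1, -⟩ | ⟨h1, -⟩ <;>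
    rcases min_cases ‖ξ - η‖ R with ⟨h2, -⟩ | ⟨h2, -⟩ <;> rw [h1, h2] <;>
    first
    | exact (min_le_left _ _).trans h
    | (refine (min_le_right _ _).trans ?_; linarith)

theorem wt_subadditive (k : ℕ) {R : ℝ} (hR : 0 ≤ R) (ξ η : E) :
    wt k R ξ ≤ 2 ^ k * (wt k R η + wt k R (ξ - η)) :=
  (pow_le_pow_left₀ (le_min (norm_nonneg _) hR) (min_norm_le hR ξ η) k).trans
    (pow_add_le (le_min (norm_nonneg _) hR) (le_min (norm_nonneg _) hR) k)

/-- The commutator estimate for the truncated weights: a derivative falling on the factor of frequency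
`η` is moved to the factor of frequency `ξ - η`. The constant does not depend on the truncation. -/
theorem abs_wt_sub_wt_mul_le (k : ℕ) {R : ℝ} (hR : 0 ≤ R) (ξ η : E) :
    |wt k R ξ - wt k R η| * ‖η‖
      ≤ ((k + 4) * 2 ^ k) * (‖ξ - η‖ * (wt k R η + wt k R (ξ - η))) := by
  have hz := norm_nonneg (ξ - η)
  have hη := norm_nonneg η
  have w1 := wt_nonneg k hR ξ
  have w2 := wt_nonneg k hR η
  have w3 := wt_nonneg k hR (ξ - η)
  have h1 : (1 : ℝ) ≤ 2 ^ k := one_le_pow₀ one_le_two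
  rcases le_or_gt ‖η‖ (2 * ‖ξ - η‖) with h | h
  -- `ξ - η` carries the high frequency, and no cancellation is needed.
  · have hs := wt_subadditive k hR ξ η
    have hd : |wt k R ξ - wt k R η| ≤ 2 * 2 ^ k * (wt k R η + wt k R (ξ - η)) := by
      rw [abs_le]
      constructor <;> nlinarith
    calc _ ≤ (2 * 2 ^ k * (wt k R η + wt k R (ξ - η))) * (2 * ‖ξ - η‖) := by gcongr
      _ = (4 * 2 ^ k) * (‖ξ - η‖ * (wt k R η + wt k R (ξ - η))) := by ring
      _ ≤ _ := by
          gcongr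
          linarith [k.cast_nonneg (α := ℝ)]
  -- Otherwise `|ξ|` and `|η|` are comparable; the weights coincide at frequencies above `R`,
  -- and below the mean value theorem trades one power of `|η|` for `|ξ - η|`.
  · have hx1 : ‖ξ‖ ≤ ‖η‖ + ‖ξ - η‖ := by simpa using norm_add_le η (ξ - η)
    have hx2 : ‖η‖ ≤ ‖ξ‖ + ‖ξ - η‖ := by simpa using norm_sub_le ξ (ξ - η)
    rcases le_or_gt (2 * R) ‖η‖ with h2 | h2
    · have e1 : min ‖ξ‖ R = R := min_eq_right (by linarith)
      have e2 : min ‖η‖ R = R := min_eq_right (by linarith)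
      rw [wt, wt, e1, e2, sub_self, abs_zero, zero_mul]
      have := wt_nonneg k hR (ξ - η)
      positivity
    · set a := min ‖ξ‖ R with ha
      set b := min ‖η‖ R with hb
      have ha0 : 0 ≤ a := le_min (norm_nonneg _) hR
      have hb0 : 0 ≤ b := le_min (norm_nonneg _) hR
      have hyb : ‖η‖ ≤ 2 * b := by
        rcases min_cases ‖η‖ R with ⟨h3, -⟩ | ⟨h3, -⟩ <;> rw [hb, h3] <;> linarith
      have hab : a ≤ 2 * b := by
        have ha1 : a ≤ ‖ξ‖ := min_le_left _ _
        have ha2 : a ≤ R := min_le_right _ _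
        rcases min_cases ‖η‖ R with ⟨h3, -⟩ | ⟨h3, -⟩ <;> rw [hb, h3] <;> linarith
      have hd : |a - b| ≤ ‖ξ - η‖ :=
        (abs_min_sub_min_le_max _ _ _ _).trans (by simpa using abs_norm_sub_norm_le ξ η)
      have hp := abs_pow_sub_pow_le a b k
      have hm : max |a| |b| ≤ 2 * b := by
        rw [abs_of_nonneg ha0, abs_of_nonneg hb0]; exact max_le hab (by linarith)
      change |a ^ k - b ^ k| * ‖η‖ ≤ _
      rcases Nat.eq_zero_or_pos k with hk | hk
      · subst hk
        simp only [pow_zero, sub_self, abs_zero, zero_mul]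
        positivity
      calc _ ≤ (‖ξ - η‖ * k * (2 * b) ^ (k - 1)) * (2 * b) := by
            gcongr
            refine hp.trans ?_
            gcongr
        _ = ‖ξ - η‖ * k * ((2 * b) ^ (k - 1) * (2 * b)) := by ring
        _ = ‖ξ - η‖ * k * (2 ^ k * b ^ k) := by
            rw [← pow_succ, Nat.sub_add_cancel hk, mul_pow]
        _ = (k * 2 ^ k) * (‖ξ - η‖ * (wt k R η + 0)) := by
            rw [wt, ← hb]; ring
        _ ≤ _ := by
            gcongr
            linarith

/-! ### The advection term on the Fourier side -/

theorem measurable_coe (h : L2C) : Measurable (h : E → ℂ) := (Lp.stronglyMeasurable h).measurable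

/-- The Fourier transform of a product of two real `L²` functions, one of which has an integrable
Fourier transform. -/
theorem hat_mul {f g : E → ℝ} (hf : MemLp f 2 volume) (hg : MemLp g 2 volume)
    (hi : Integrable (hat f : E → ℂ) volume) :
    MemLp (fun x => f x * g x) 2 volume ∧
      ∀ᵐ ξ, hat (fun x => f x * g x) ξ = ∫ η, hat f (ξ - η) * hat g η := by
  have hft : MemLp f ∞ volume := by
    have h1 := memLp_top_of_integrable_fourier (toL2 f) hi
    refine (h1.ae_eq (coe_toL2 hf)).of_le hf.1 (Eventually.of_forall fun x => ?_)
    simp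
  have hm : MemLp (fun x => f x * g x) 2 volume := by
    have := MemLp.mul' (r := 2) hg hft
    exact this
  refine ⟨hm, ?_⟩
  have e1 : (toL2 (fun x => f x * g x) : E → ℂ) =ᵐ[volume] fun x => toL2 f x * toL2 g x := by
    filter_upwards [coe_toL2 hf, coe_toL2 hg, coe_toL2 hm] with x h1 h2 h3
    rw [h1, h2, h3]; push_cast; rfl
  have hint : Integrable (toL2 (fun x => f x * g x) : E → ℂ) volume :=
    ((Lp.memLp (toL2 f)).integrable_mul (Lp.memLp (toL2 g))).congr e1.symm
  filter_upwards [fourier_coe_ae_eq _ hint] with ξ hξ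
  rw [hat, hξ, Real.fourier_congr_ae e1, fourier_mul_eq_convolution]
  rfl

/-- The sum of the moduli of the Fourier transforms of finitely many functions. -/
noncomputable def hatMag {κ : Type*} [Fintype κ] (v : κ → E → ℝ) (ξ : E) : ℝ≥0∞ :=
  ∑ l, ‖hat (v l) ξ‖ₑ

theorem measurable_hatMag {κ : Type*} [Fintype κ] (v : κ → E → ℝ) : Measurable (hatMag v) :=
  Finset.measurable_fun_sum _ fun _ _ => (measurable_coe _).enorm

theorem enorm_hat_le_hatMag {κ : Type*} [Fintype κ] (v : κ → E → ℝ) (l : κ) (ξ : E) :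
    ‖hat (v l) ξ‖ₑ ≤ hatMag v ξ :=
  Finset.single_le_sum (f := fun l => ‖hat (v l) ξ‖ₑ) (fun _ _ => zero_le) (Finset.mem_univ l)

/-- The Fourier kernel of the operator `v·∇`. -/
noncomputable def advKernel (v : Fin 3 → E → ℝ) (ξ η : E) : ℂ :=
  ∑ l, hat (v l) (ξ - η) * (2 * Real.pi * Complex.I * (η l : ℂ))

theorem abs_apply_le_norm (η : E) (l : Fin 3) : |η l| ≤ ‖η‖ := by
  simpa using PiLp.norm_apply_le η l

theorem enorm_two_pi_I_mul (r : ℝ) : ‖(2 * Real.pi * Complex.I * (r : ℂ) : ℂ)‖ₑ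
    = ENNReal.ofReal (2 * Real.pi) * ‖r‖ₑ := by
  rw [← ofReal_norm, ← ofReal_norm, ← ENNReal.ofReal_mul (by positivity)]
  congr 1
  simp [abs_of_pos Real.pi_pos]

theorem enorm_sum_mul_le (v : Fin 3 → E → ℝ) (ζ η : E) :
    ‖∑ l, hat (v l) ζ * (2 * Real.pi * Complex.I * (η l : ℂ))‖ₑ
      ≤ ENNReal.ofReal (2 * Real.pi) * (hatMag v ζ * ‖η‖ₑ) := by
  refine (enorm_sum_le _ _).trans ?_
  rw [hatMag, Finset.sum_mul, Finset.mul_sum]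
  refine Finset.sum_le_sum fun l _ => ?_
  rw [enorm_mul, enorm_two_pi_I_mul, mul_left_comm]
  gcongr
  exact enorm_le_iff_norm_le.2 (by simpa using abs_apply_le_norm η l)

theorem enorm_advKernel_le (v : Fin 3 → E → ℝ) (ξ η : E) :
    ‖advKernel v ξ η‖ₑ ≤ ENNReal.ofReal (2 * Real.pi) * (hatMag v (ξ - η) * ‖η‖ₑ) :=
  enorm_sum_mul_le v _ _

/-- A divergence-free field of square integrable functions with integrable Fourier transforms. -/
structure DivFree (v : Fin 3 → E → ℝ) : Prop where
  memLp : ∀ l, MemLp (v l) 2 volume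
  integrable_hat : ∀ l, Integrable (hat (v l) : E → ℂ) volume
  div : ∀ᵐ ζ : E, ∑ l, (ζ l : ℂ) * hat (v l) ζ = 0

/-- `df` is the weak gradient of `f`, both being square integrable. -/
structure HasGrad (f : E → ℝ) (df : Fin 3 → E → ℝ) : Prop where
  memLp : MemLp f 2 volume
  memLp_grad : ∀ l, MemLp (df l) 2 volume
  hat_grad : ∀ l, ∀ᵐ η, hat (df l) η = 2 * Real.pi * Complex.I * (η l : ℂ) * hat f η

theorem ae_sub_left {P : E → Prop} (h : ∀ᵐ ζ, P ζ) (ξ : E) : ∀ᵐ η, P (ξ - η) :=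
  (Measure.measurePreserving_sub_left volume ξ).quasiMeasurePreserving.ae h

/-- For a divergence-free field the derivative may be moved in front of the product. -/
theorem DivFree.advKernel_eq {v : Fin 3 → E → ℝ} (hv : DivFree v) (ξ : E) : ∀ᵐ η,
    advKernel v ξ η = ∑ l, hat (v l) (ξ - η) * (2 * Real.pi * Complex.I * (ξ l : ℂ)) := by
  filter_upwards [ae_sub_left hv.div ξ] with η hη
  rw [← sub_eq_zero, advKernel, ← Finset.sum_sub_distrib]
  calc _ = -(2 * Real.pi * Complex.I) * ∑ l, ((ξ - η) l : ℂ) * hat (v l) (ξ - η) := by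
        rw [Finset.mul_sum]
        refine Finset.sum_congr rfl fun l _ => ?_
        simp only [PiLp.sub_apply]
        push_cast
        ring
    _ = 0 := by rw [hη, mul_zero]

theorem DivFree.enorm_advKernel_le {v : Fin 3 → E → ℝ} (hv : DivFree v) (ξ : E) : ∀ᵐ η,
    ‖advKernel v ξ η‖ₑ ≤ ENNReal.ofReal (2 * Real.pi) * (hatMag v (ξ - η) * ‖ξ‖ₑ) := by
  filter_upwards [hv.advKernel_eq ξ] with η hη
  rw [hη]
  exact enorm_sum_mul_le v _ _

/-- The kernel of `v·∇` is anti-Hermitian. -/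
theorem DivFree.advKernel_swap {v : Fin 3 → E → ℝ} (hv : DivFree v) (ξ : E) : ∀ᵐ η,
    advKernel v η ξ = - conj (advKernel v ξ η) := by
  have h1 : ∀ᵐ η, ∀ l, hat (v l) (-(ξ - η)) = conj (hat (v l) (ξ - η)) :=
    ae_all_iff.2 fun l => ae_sub_left (hat_sub_conj (v l)) ξ
  filter_upwards [hv.advKernel_eq ξ, h1] with η h2 h3
  rw [h2, map_sum, ← Finset.sum_neg_distrib, advKernel]
  refine Finset.sum_congr rfl fun l _ => ?_
  rw [← neg_sub ξ η, h3]
  simp only [map_mul, Complex.conj_I, Complex.conj_ofReal, map_ofNat]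
  ring

section advection

variable {v : Fin 3 → E → ℝ} {f : E → ℝ} {df : Fin 3 → E → ℝ}

theorem DivFree.memLp_adv (hv : DivFree v) (hf : HasGrad f df) :
    MemLp (fun x => ∑ l, v l x * df l x) 2 volume :=
  memLp_finsetSum _ fun l _ => (hat_mul (hv.memLp l) (hf.memLp_grad l) (hv.integrable_hat l)).1

/-- The Fourier transform of `v·∇f`. -/
theorem DivFree.hat_adv (hv : DivFree v) (hf : HasGrad f df) :
    ∀ᵐ ξ, hat (fun x => ∑ l, v l x * df l x) ξ = ∫ η, advKernel v ξ η * hat f η := by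
  have h1 := fun l => hat_mul (hv.memLp l) (hf.memLp_grad l) (hv.integrable_hat l)
  have h2 : ∀ᵐ ξ, ∀ l, hat (fun x => v l x * df l x) ξ
      = ∫ η, hat (v l) (ξ - η) * hat (df l) η := ae_all_iff.2 fun l => (h1 l).2
  rw [hat_sum Finset.univ fun l _ => (h1 l).1]
  filter_upwards [h2, Lp.coeFn_finsetSum Finset.univ fun l => hat (fun x => v l x * df l x)]
    with ξ h3 h4
  rw [h4, Finset.sum_apply]
  simp only [h3]
  rw [← integral_finsetSum]
  · refine integral_congr_ae ?_
    filter_upwards [ae_all_iff.2 hf.hat_grad] with η hη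
    rw [advKernel, Finset.sum_mul]
    refine Finset.sum_congr rfl fun l _ => ?_
    rw [hη]; ring
  · intro l _
    have := (Lp.memLp (hat (v l)) (μ := volume)).comp_measurePreserving
      (Measure.measurePreserving_sub_left volume ξ)
    exact this.integrable_mul (Lp.memLp (hat (df l)))

/-- The Fourier transform of `v·∇f = div (f v)`, with the derivative in front of the product. -/
theorem DivFree.enorm_hat_adv_le (hv : DivFree v) (hf : HasGrad f df) :
    ∀ᵐ ξ, ‖hat (fun x => ∑ l, v l x * df l x) ξ‖ₑ
      ≤ ENNReal.ofReal (2 * Real.pi) * ∫⁻ η, hatMag v (ξ - η) * ‖hat f η‖ₑ * ‖ξ‖ₑ := by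
  filter_upwards [hv.hat_adv hf] with ξ hξ
  rw [hξ, ← lintegral_const_mul']
  · refine (enorm_integral_le_lintegral_enorm _).trans (lintegral_mono_ae ?_)
    filter_upwards [hv.enorm_advKernel_le ξ] with η hη
    rw [enorm_mul]
    refine (mul_le_mul_left hη _).trans (le_of_eq ?_)
    ring
  · exact ENNReal.ofReal_ne_top

/-- The Fourier transform of `v·∇f`, with the derivative on `f`. -/
theorem DivFree.enorm_hat_adv_le' (hv : DivFree v) (hf : HasGrad f df) :
    ∀ᵐ ξ, ‖hat (fun x => ∑ l, v l x * df l x) ξ‖ₑ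
      ≤ ENNReal.ofReal (2 * Real.pi) * ∫⁻ η, hatMag v (ξ - η) * (‖η‖ₑ * ‖hat f η‖ₑ) := by
  filter_upwards [hv.hat_adv hf] with ξ hξ
  rw [hξ, ← lintegral_const_mul']
  · refine (enorm_integral_le_lintegral_enorm _).trans (lintegral_mono fun η => ?_)
    beta_reduce
    rw [enorm_mul]
    refine (mul_le_mul_left (Oldroyd.enorm_advKernel_le v ξ η) _).trans (le_of_eq ?_)
    ring
  · exact ENNReal.ofReal_ne_top

/-- The real part of the weighted `L²` inner product `⟨σ f, σ g⟩`. -/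
noncomputable def pair (σ : E → ℝ) (f g : E → ℂ) : ℝ := ∫ ξ, σ ξ ^ 2 * (conj (f ξ) * g ξ).re

/-- The modulus of a real weight, with values in `[0, ∞]`. -/
noncomputable def ew (σ : E → ℝ) (ξ : E) : ℝ≥0∞ := ‖σ ξ‖ₑ

theorem enorm_pair_le (σ : E → ℝ) (f g : E → ℂ) :
    ‖pair σ f g‖ₑ ≤ ∫⁻ ξ, ew σ ξ ^ 2 * (‖f ξ‖ₑ * ‖g ξ‖ₑ) := by
  refine (enorm_integral_le_lintegral_enorm _).trans (lintegral_mono fun ξ => ?_)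
  rw [enorm_mul, ew, enorm_pow]
  gcongr
  rw [← ofReal_norm, ← ofReal_norm, ← ofReal_norm, ← ENNReal.ofReal_mul (norm_nonneg _)]
  refine ENNReal.ofReal_le_ofReal ((Complex.abs_re_le_norm _).trans ?_)
  rw [norm_mul, RCLike.norm_conj]

/-- The pairing with `v·∇f`, the derivative being moved to the other function `h` by means of
`div v = 0`. -/
theorem DivFree.enorm_pair_adv_le (hv : DivFree v) (hf : HasGrad f df) (σ : E → ℝ) (h : E → ℂ) :
    ‖pair σ h (hat (fun x => ∑ l, v l x * df l x))‖ₑ ≤ ENNReal.ofReal (2 * Real.pi) *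
      tri (hatMag v) (fun ξ => ‖hat f ξ‖ₑ) (fun ξ => ew σ ξ ^ 2 * (‖ξ‖ₑ * ‖h ξ‖ₑ)) := by
  refine (enorm_pair_le _ _ _).trans ?_
  unfold tri
  rw [← lintegral_const_mul' _ _ ENNReal.ofReal_ne_top]
  refine lintegral_mono_ae ?_
  filter_upwards [hv.enorm_hat_adv_le hf] with ξ hξ
  have mv := measurable_hatMag v
  have mf := (measurable_coe (hat f)).enorm
  rw [lintegral_mul_const _ (by fun_prop)] at hξ ⊢
  refine (mul_le_mul_right (mul_le_mul_right hξ _) _).trans (le_of_eq ?_)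
  ring

/-- The pairing with `v·∇f`, the derivative being left on `f`. -/
theorem DivFree.enorm_pair_adv_le' (hv : DivFree v) (hf : HasGrad f df) (σ : E → ℝ) (h : E → ℂ) :
    ‖pair σ h (hat (fun x => ∑ l, v l x * df l x))‖ₑ ≤ ENNReal.ofReal (2 * Real.pi) *
      tri (hatMag v) (fun ξ => ‖ξ‖ₑ * ‖hat f ξ‖ₑ) (fun ξ => ew σ ξ ^ 2 * ‖h ξ‖ₑ) := by
  refine (enorm_pair_le _ _ _).trans ?_
  unfold tri
  rw [← lintegral_const_mul' _ _ ENNReal.ofReal_ne_top]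
  refine lintegral_mono_ae ?_
  filter_upwards [hv.enorm_hat_adv_le' hf] with ξ hξ
  have mv := measurable_hatMag v
  have mf := (measurable_coe (hat f)).enorm
  rw [lintegral_mul_const _ (by fun_prop)]
  refine (mul_le_mul_right (mul_le_mul_right hξ _) _).trans (le_of_eq ?_)
  ring

end advection

/-! ### Cancellation in the transport term -/

section advection

variable {v : Fin 3 → E → ℝ} {f : E → ℝ} {df : Fin 3 → E → ℝ}

theorem lintegral_enorm_sq_lt_top (h : L2C) : ∫⁻ ξ, ‖h ξ‖ₑ ^ 2 < ⊤ := by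
  rw [← enorm_sq_eq_lintegral]
  exact ENNReal.pow_lt_top enorm_lt_top

theorem le_ofReal_toReal {x : ℝ≥0∞} (h : x < ⊤) : x ≤ ENNReal.ofReal x.toReal :=
  (ENNReal.ofReal_toReal h.ne).ge

theorem tri_lt_top {f g h : E → ℝ≥0∞} (mf : Measurable f) (mg : Measurable g)
    (mh : Measurable h) (hf : ∫⁻ ξ, f ξ < ⊤) (hg : ∫⁻ ξ, g ξ ^ 2 < ⊤) (hh : ∫⁻ ξ, h ξ ^ 2 < ⊤) :
    tri f g h < ⊤ :=
  (tri_le_of_left mf mg mh ENNReal.toReal_nonneg (le_ofReal_toReal hf) (le_ofReal_toReal hg)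
    (le_ofReal_toReal hh)).trans_lt ENNReal.ofReal_lt_top

theorem DivFree.lintegral_hatMag_lt_top (hv : DivFree v) : ∫⁻ ξ, hatMag v ξ < ⊤ := by
  unfold hatMag
  rw [lintegral_finsetSum _ fun l _ => (measurable_coe _).enorm]
  exact ENNReal.sum_lt_top.2 fun l _ => (hv.integrable_hat l).2

theorem HasGrad.lintegral_lt_top (hf : HasGrad f df) :
    ∫⁻ ξ, (‖ξ‖ₑ * ‖hat f ξ‖ₑ) ^ 2 < ⊤ := by
  have h2 : ∀ ξ : E, ‖ξ‖ₑ ^ 2 = ∑ l, ‖ξ l‖ₑ ^ 2 := fun ξ => by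
    rw [← ofReal_norm, ← ENNReal.ofReal_pow (norm_nonneg _), EuclideanSpace.real_norm_sq_eq,
      ENNReal.ofReal_sum_of_nonneg fun l _ => sq_nonneg _]
    refine Finset.sum_congr rfl fun l _ => ?_
    rw [← ofReal_norm, ← ENNReal.ofReal_pow (norm_nonneg _), Real.norm_eq_abs, sq_abs]
  have h3 : ∫⁻ ξ, ∑ l, ‖hat (df l) ξ‖ₑ ^ 2 < ⊤ := by
    rw [lintegral_finsetSum _ fun l _ => (measurable_coe _).enorm.pow_const 2]
    exact ENNReal.sum_lt_top.2 fun l _ => lintegral_enorm_sq_lt_top _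
  refine lt_of_le_of_lt (lintegral_mono_ae ?_) h3
  filter_upwards [ae_all_iff.2 hf.hat_grad] with ξ hξ
  simp only [hξ]
  rw [mul_pow, h2, Finset.sum_mul]
  refine Finset.sum_le_sum fun l _ => ?_
  rw [enorm_mul, enorm_two_pi_I_mul, ← mul_pow]
  gcongr
  refine le_mul_of_one_le_left zero_le ?_
  rw [ENNReal.one_le_ofReal]
  linarith [Real.pi_gt_three]

/-- In `⟨σ f, σ v·∇f⟩` with `div v = 0` only the commutator of the weight with `v·∇`
contributes. -/
theorem DivFree.enorm_pair_self_adv_le (hv : DivFree v) (hf : HasGrad f df) {σ : E → ℝ} {M : ℝ}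
    (hσ : Measurable σ) (hσM : ∀ ξ, ‖σ ξ‖ ≤ M) :
    ‖pair σ (hat f) (hat (fun x => ∑ l, v l x * df l x))‖ₑ ≤ ENNReal.ofReal (2 * Real.pi) *
      ∫⁻ ξ, ∫⁻ η, ‖σ ξ - σ η‖ₑ * ‖η‖ₑ * hatMag v (ξ - η) * ‖hat f η‖ₑ * (ew σ ξ * ‖hat f ξ‖ₑ) := by
  set g : E → ℂ := (hat f : E → ℂ) with hg
  have mg : Measurable g := measurable_coe _
  have mv : ∀ l, Measurable (hat (v l) : E → ℂ) := fun l => measurable_coe _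
  have mV := measurable_hatMag v
  let K : E → E → ℂ := fun ξ η => advKernel v ξ η * g η * conj (g ξ)
  have mK : Measurable (Function.uncurry K) := by
    have m1 : Measurable (Function.uncurry (advKernel v)) := by
      unfold advKernel
      refine Finset.measurable_fun_sum _ fun l _ => ?_
      have : Measurable fun p : E × E => p.2 l := by fun_prop
      have m2 := (mv l).comp (measurable_fst.sub measurable_snd : Measurable fun p : E × E => p.1 - p.2)
      exact m2.mul ((measurable_const.mul (Complex.measurable_ofReal.comp this)))
    exact (m1.mul (mg.comp measurable_snd)).mul
      (Complex.continuous_conj.measurable.comp (mg.comp measurable_fst))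
  have bK : ∀ ξ η, ‖K ξ η‖ₑ ≤ ENNReal.ofReal (2 * Real.pi) *
      (hatMag v (ξ - η) * (‖η‖ₑ * ‖g η‖ₑ) * ‖g ξ‖ₑ) := fun ξ η => by
    simp only [K]
    rw [enorm_mul, enorm_mul, RCLike.enorm_conj]
    refine (mul_le_mul_left (mul_le_mul_left (Oldroyd.enorm_advKernel_le v ξ η) _) _).trans
      (le_of_eq ?_)
    ring
  have iK : ∀ w : E × E → ℝ, Measurable w → (∃ B, ∀ p, ‖w p‖ ≤ B) →
      Integrable (fun p : E × E => (w p : ℂ) * K p.1 p.2) (volume.prod volume) := by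
    intro w mw ⟨B, hB⟩
    have hKi : Integrable (fun p : E × E => K p.1 p.2) (volume.prod volume) := by
      refine ⟨mK.aestronglyMeasurable, ?_⟩
      rw [hasFiniteIntegral_iff_enorm, lintegral_prod (fun p : E × E => ‖K p.1 p.2‖ₑ)
        mK.enorm.aemeasurable]
      refine lt_of_le_of_lt (lintegral_mono fun ξ => lintegral_mono fun η => bK ξ η) ?_
      have := tri_lt_top mV (g := fun η => ‖η‖ₑ * ‖g η‖ₑ) (h := fun ξ => ‖g ξ‖ₑ) (by fun_prop)
        (by fun_prop) hv.lintegral_hatMag_lt_top hf.lintegral_lt_top (lintegral_enorm_sq_lt_top _)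
      unfold tri at this
      simp only [lintegral_const_mul' _ _ ENNReal.ofReal_ne_top]
      exact ENNReal.mul_lt_top ENNReal.ofReal_lt_top this
    refine hKi.bdd_mul (c := B) (Complex.measurable_ofReal.comp mw).aestronglyMeasurable
      (Eventually.of_forall fun p => ?_)
    simpa using hB p
  have bσ : ∀ ξ, |σ ξ| ≤ M := hσM
  have hM : 0 ≤ M := (abs_nonneg _).trans (bσ 0)
  -- The part with the symmetric weight `σ ξ * σ η` is purely imaginary, by `advKernel_swap`.
  have i1 := iK (fun p => σ p.1 * σ p.2) (by fun_prop) ⟨M * M, fun p => by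
    rw [norm_mul]; exact mul_le_mul (hσM _) (hσM _) (norm_nonneg _) hM⟩
  have i2 := iK (fun p => σ p.1 * (σ p.1 - σ p.2)) (by fun_prop) ⟨M * (M + M), fun p => by
    rw [norm_mul]
    exact mul_le_mul (hσM _) ((norm_sub_le _ _).trans (add_le_add (hσM _) (hσM _)))
      (norm_nonneg _) hM⟩
  set S : ℂ := ∫ ξ, ∫ η, ((σ ξ * σ η : ℝ) : ℂ) * K ξ η with hS
  have hSre : S.re = 0 := by
    have e : S = - conj S := by
      calc S = ∫ η, ∫ ξ, ((σ ξ * σ η : ℝ) : ℂ) * K ξ η := integral_integral_swap i1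
        _ = ∫ ξ, ∫ η, - conj (((σ ξ * σ η : ℝ) : ℂ) * K ξ η) := by
            refine integral_congr_ae (Eventually.of_forall fun ξ => integral_congr_ae ?_)
            filter_upwards [hv.advKernel_swap ξ] with η hη
            simp only [K]
            rw [hη, map_mul, map_mul, map_mul, Complex.conj_conj, Complex.conj_ofReal]
            push_cast
            ring
        _ = - conj S := by
            rw [hS, ← integral_conj, ← integral_neg]
            refine integral_congr_ae (Eventually.of_forall fun ξ => ?_)
            beta_reduce
            rw [integral_neg, integral_conj]
    have := congrArg Complex.re e
    rw [Complex.neg_re, Complex.conj_re] at this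
    linarith
  have hpair : pair σ g (hat (fun x => ∑ l, v l x * df l x))
      = (∫ ξ, ∫ η, ((σ ξ * (σ ξ - σ η) : ℝ) : ℂ) * K ξ η).re := by
    have e1 : ∀ᵐ ξ, ((σ ξ ^ 2 : ℝ) : ℂ) * (conj (g ξ) * hat (fun x => ∑ l, v l x * df l x) ξ)
        = (∫ η, ((σ ξ * σ η : ℝ) : ℂ) * K ξ η) + ∫ η, ((σ ξ * (σ ξ - σ η) : ℝ) : ℂ) * K ξ η := by
      filter_upwards [hv.hat_adv hf, i1.prod_right_ae, i2.prod_right_ae] with ξ hξ j1 j2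
      rw [hξ, ← integral_add j1 j2, ← integral_const_mul, ← integral_const_mul]
      refine integral_congr_ae (Eventually.of_forall fun η => ?_)
      simp only [K]
      push_cast
      ring
    have j1 := i1.integral_prod_left
    have j2 := i2.integral_prod_left
    calc pair σ g (hat (fun x => ∑ l, v l x * df l x))
        = ∫ ξ, (((σ ξ ^ 2 : ℝ) : ℂ) * (conj (g ξ) * hat (fun x => ∑ l, v l x * df l x) ξ)).re := by
          unfold pair
          refine integral_congr_ae (Eventually.of_forall fun ξ => ?_)
          simp only [Complex.re_ofReal_mul]
      _ = ∫ ξ, ((∫ η, ((σ ξ * σ η : ℝ) : ℂ) * K ξ η)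
            + ∫ η, ((σ ξ * (σ ξ - σ η) : ℝ) : ℂ) * K ξ η).re := by
          refine integral_congr_ae ?_
          filter_upwards [e1] with ξ hξ
          rw [hξ]
      _ = (∫ ξ, ((∫ η, ((σ ξ * σ η : ℝ) : ℂ) * K ξ η)
            + ∫ η, ((σ ξ * (σ ξ - σ η) : ℝ) : ℂ) * K ξ η)).re := by
          have := integral_re (𝕜 := ℂ) (j1.add j2)
          exact this
      _ = _ := by
          rw [integral_add j1 j2, Complex.add_re]
          change S.re + _ = _
          rw [hSre, zero_add]
  rw [hpair]
  calc ‖(∫ ξ, ∫ η, ((σ ξ * (σ ξ - σ η) : ℝ) : ℂ) * K ξ η).re‖ₑ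
      ≤ ‖∫ ξ, ∫ η, ((σ ξ * (σ ξ - σ η) : ℝ) : ℂ) * K ξ η‖ₑ :=
        enorm_le_iff_norm_le.2 (Complex.abs_re_le_norm _)
    _ ≤ ∫⁻ ξ, ∫⁻ η, ‖((σ ξ * (σ ξ - σ η) : ℝ) : ℂ) * K ξ η‖ₑ :=
        (enorm_integral_le_lintegral_enorm _).trans
          (lintegral_mono fun ξ => enorm_integral_le_lintegral_enorm _)
    _ ≤ ∫⁻ ξ, ∫⁻ η, ENNReal.ofReal (2 * Real.pi) *
          (‖σ ξ - σ η‖ₑ * ‖η‖ₑ * hatMag v (ξ - η) * ‖g η‖ₑ * (ew σ ξ * ‖g ξ‖ₑ)) := by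
        refine lintegral_mono fun ξ => lintegral_mono fun η => ?_
        beta_reduce
        have : ‖((σ ξ * (σ ξ - σ η) : ℝ) : ℂ)‖ₑ = ew σ ξ * ‖σ ξ - σ η‖ₑ := by
          rw [ew, ← enorm_mul, ← ofReal_norm, ← ofReal_norm, Complex.norm_real]
        rw [enorm_mul, this]
        refine (mul_le_mul_right (bK ξ η) _).trans (le_of_eq ?_)
        ring
    _ = _ := by simp only [lintegral_const_mul' _ _ ENNReal.ofReal_ne_top]

end advection

/-! ### Weighted products along curves, and Sobolev norms -/

theorem integrable_pair {σ : E → ℝ} {M : ℝ} (hσ : Measurable σ) (hσM : ∀ ξ, ‖σ ξ‖ ≤ M)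
    (f g : L2C) : Integrable (fun ξ => σ ξ ^ 2 * (conj (f ξ) * g ξ).re) volume := by
  have h1 : Integrable (fun ξ => conj (f ξ) * g ξ) volume :=
    MemLp.integrable_mul (p := 2) (q := 2) (Lp.memLp f).star (Lp.memLp g)
  refine h1.re.bdd_mul (c := M ^ 2) (hσ.pow_const 2).aestronglyMeasurable (Eventually.of_forall fun ξ => ?_)
  rw [norm_pow]
  exact pow_le_pow_left₀ (norm_nonneg _) (hσM ξ) 2

theorem abs_pair_le {σ : E → ℝ} {M : ℝ} (hσM : ∀ ξ, ‖σ ξ‖ ≤ M)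
    (f g : L2C) : |pair σ f g| ≤ M ^ 2 * ‖f‖ * ‖g‖ := by
  have hM : 0 ≤ M := (norm_nonneg _).trans (hσM 0)
  have h1 : ‖pair σ f g‖ₑ ≤ ENNReal.ofReal (M ^ 2) * ∫⁻ ξ, ‖f ξ‖ₑ * ‖g ξ‖ₑ := by
    refine (enorm_pair_le σ f g).trans ?_
    rw [← lintegral_const_mul' _ _ ENNReal.ofReal_ne_top]
    refine lintegral_mono fun ξ => ?_
    beta_reduce
    gcongr
    rw [ew, ← ofReal_norm, ← ENNReal.ofReal_pow (norm_nonneg _)]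
    exact ENNReal.ofReal_le_ofReal (pow_le_pow_left₀ (norm_nonneg _) (hσM ξ) 2)
  have e : ∀ f : L2C, ∫⁻ ξ, ‖f ξ‖ₑ ^ 2 ≤ ENNReal.ofReal (‖f‖ ^ 2) := fun f => by
    rw [← enorm_sq_eq_lintegral, ENNReal.ofReal_pow (norm_nonneg _), ofReal_norm]
  have h2 := lintegral_mul_le_sqrt (measurable_coe f).enorm.aemeasurable
    (measurable_coe g).enorm.aemeasurable (e f) (e g)
  rw [Real.sqrt_sq (norm_nonneg _), Real.sqrt_sq (norm_nonneg _)] at h2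
  have h3 := h1.trans (mul_le_mul_right h2 _)
  rw [← ENNReal.ofReal_mul (by positivity), ← ofReal_norm,
    ENNReal.ofReal_le_ofReal_iff (by positivity)] at h3
  rw [mul_assoc]
  exact h3

/-- `pair σ` as a bounded real bilinear form on `L²`. -/
noncomputable def pairL {σ : E → ℝ} {M : ℝ} (hσ : Measurable σ) (hσM : ∀ ξ, ‖σ ξ‖ ≤ M) :
    L2C →L[ℝ] L2C →L[ℝ] ℝ :=
  LinearMap.mkContinuous₂ (LinearMap.mk₂ ℝ (fun f g : L2C => pair σ f g)
    (fun f f' g => by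
      unfold pair
      rw [← integral_add (integrable_pair hσ hσM f g) (integrable_pair hσ hσM f' g)]
      refine integral_congr_ae ?_
      filter_upwards [Lp.coeFn_add f f'] with ξ h
      rw [h, Pi.add_apply, map_add, add_mul, Complex.add_re]; ring)
    (fun c f g => by
      unfold pair
      rw [smul_eq_mul, ← integral_const_mul]
      refine integral_congr_ae ?_
      filter_upwards [Lp.coeFn_smul c f] with ξ h
      rw [h, Pi.smul_apply, Complex.real_smul, map_mul, Complex.conj_ofReal, mul_assoc,
        Complex.re_ofReal_mul]; ring)
    (fun f g g' => by
      unfold pair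
      rw [← integral_add (integrable_pair hσ hσM f g) (integrable_pair hσ hσM f g')]
      refine integral_congr_ae ?_
      filter_upwards [Lp.coeFn_add g g'] with ξ h
      rw [h, Pi.add_apply, mul_add, Complex.add_re]; ring)
    (fun c f g => by
      unfold pair
      rw [smul_eq_mul, ← integral_const_mul]
      refine integral_congr_ae ?_
      filter_upwards [Lp.coeFn_smul c g] with ξ h
      rw [h, Pi.smul_apply, Complex.real_smul, mul_left_comm, Complex.re_ofReal_mul]; ring))
    (M ^ 2) (fun f g => abs_pair_le hσM f g)

theorem pairL_apply {σ : E → ℝ} {M : ℝ} (hσ : Measurable σ) (hσM : ∀ ξ, ‖σ ξ‖ ≤ M) (f g : L2C) :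
    pairL hσ hσM f g = pair σ f g := rfl

theorem pair_comm (σ : E → ℝ) (f g : E → ℂ) : pair σ f g = pair σ g f := by
  unfold pair
  refine integral_congr_ae (Eventually.of_forall fun ξ => ?_)
  simp only [Complex.mul_re, Complex.conj_re, Complex.conj_im]
  ring

theorem pair_self (σ : E → ℝ) (f : E → ℂ) : pair σ f f = ∫ ξ, σ ξ ^ 2 * ‖f ξ‖ ^ 2 := by
  unfold pair
  refine integral_congr_ae (Eventually.of_forall fun ξ => ?_)
  beta_reduce
  rw [← Complex.normSq_eq_conj_mul_self, Complex.ofReal_re, Complex.normSq_eq_norm_sq]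

theorem pair_self_nonneg (σ : E → ℝ) (f : E → ℂ) : 0 ≤ pair σ f f := by
  rw [pair_self]; exact integral_nonneg fun ξ => by positivity

theorem hasDerivAt_pair {σ : E → ℝ} {M : ℝ} (hσ : Measurable σ) (hσM : ∀ ξ, ‖σ ξ‖ ≤ M)
    {h : ℝ → L2C} {h' : L2C} {t : ℝ} (hh : HasDerivAt h h' t) :
    HasDerivAt (fun s => pair σ (h s) (h s)) (2 * pair σ (h t) h') t := by
  have h1 : HasDerivAt (fun s => pairL hσ hσM (h s)) (pairL hσ hσM h') t :=
    (pairL hσ hσM).hasFDerivAt.comp_hasDerivAt t hh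
  have h2 := h1.clm_apply hh
  simp only [pairL_apply] at h2
  convert! h2 using 1
  rw [pair_comm σ h']
  ring

theorem continuousWithinAt_pair {σ : E → ℝ} {M : ℝ} (hσ : Measurable σ) (hσM : ∀ ξ, ‖σ ξ‖ ≤ M)
    {h : ℝ → L2C} {t : ℝ} {S : Set ℝ} (hh : ContinuousWithinAt h S t) :
    ContinuousWithinAt (fun s => pair σ (h s) (h s)) S t := by
  have h1 : ContinuousWithinAt (fun s => pairL hσ hσM (h s)) S t :=
    (pairL hσ hσM).continuous.continuousAt.comp_continuousWithinAt hh
  exact h1.clm_apply hh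

/-- A measurable `L²` derivative of a curve in `L²` belongs to `L²`. -/
theorem memLp_of_hasL2DerivAt {f : ℝ → E → ℝ} {g : E → ℝ} {t : ℝ} (h : HasL2DerivAt f g t)
    (hf : ∀ᶠ s in 𝓝 t, MemLp (f s) 2 volume) (hg : AEStronglyMeasurable g volume) :
    MemLp g 2 volume := by
  have h1 := h.eventually (gt_mem_nhds ENNReal.zero_lt_top)
  obtain ⟨s, hs, hfs⟩ := (h1.and (hf.filter_mono nhdsWithin_le_nhds)).exists
  have hq : MemLp (fun x => (s - t)⁻¹ * (f s x - f t x)) 2 volume :=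
    (hfs.sub hf.self_of_nhds).const_mul _
  have hd : MemLp (fun x => (s - t)⁻¹ * (f s x - f t x) - g x) 2 volume := ⟨hq.1.sub hg, hs⟩
  refine (hq.sub hd).ae_eq (Eventually.of_forall fun x => ?_)
  simp

/-- Differentiability in `L²` passes to the Fourier transforms. -/
theorem hasDerivAt_hat {f : ℝ → E → ℝ} {g : E → ℝ} {t : ℝ} (h : HasL2DerivAt f g t)
    (hf : ∀ᶠ s in 𝓝 t, MemLp (f s) 2 volume) (hg : MemLp g 2 volume) :
    HasDerivAt (fun s => hat (f s)) (hat g) t := by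
  rw [hasDerivAt_iff_tendsto_slope, tendsto_iff_edist_tendsto_0]
  refine Tendsto.congr' ?_ h
  filter_upwards [hf.filter_mono nhdsWithin_le_nhds] with s hs
  have hft := hf.self_of_nhds
  have hd : MemLp (fun x => (s - t)⁻¹ * (f s x - f t x)) 2 volume := (hs.sub hft).const_mul _
  have e : (s - t)⁻¹ • (hat (f s) - hat (f t)) = hat (fun x => (s - t)⁻¹ * (f s x - f t x)) := by
    rw [hat_smul (f := fun x => f s x - f t x) _ (hs.sub hft), hat_sub hs hft]
    rfl
  rw [slope_def_module, edist_eq_enorm_sub, e, ← hat_sub hd hg]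
  exact (enorm_hat (f := fun x => (s - t)⁻¹ * (f s x - f t x) - g x) (hd.sub hg)).symm

theorem gradNormSq_le_sobolevNorm_sq {ι : Type} [Fintype ι] {m k : ℕ} (hk : k ≤ m)
    (w : E → ι → ℝ) : gradNormSq k w ≤ sobolevNorm m w ^ 2 := by
  have : sobolevNorm m w ^ 2 = ∑ k ∈ Finset.range (m + 1), gradNormSq k w := by
    rw [sobolevNorm, ← ENNReal.rpow_natCast, ← ENNReal.rpow_mul]
    norm_num
  rw [this]
  exact Finset.single_le_sum (f := fun k => gradNormSq k w) (fun _ _ => zero_le)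
    (Finset.mem_range.2 (Nat.lt_succ_of_le hk))

theorem memLp_of_sobolevNorm {ι : Type} [Fintype ι] {m : ℕ} {w : E → ι → ℝ}
    (h : sobolevNorm m w < ⊤) (a : ι) : MemLp (fun x => w x a) 2 volume :=
  memLp_of_gradNormSq_zero ((gradNormSq_le_sobolevNorm_sq (Nat.zero_le m) w).trans_lt
    (ENNReal.pow_lt_top h)) a

theorem lintegral_pow_hat_le {ι : Type} [Fintype ι] {m k : ℕ} (hk : k ≤ m) {w : E → ι → ℝ}
    (h : sobolevNorm m w < ⊤) :
    ∑ a, ∫⁻ ξ, ENNReal.ofReal (‖ξ‖ ^ (2 * k)) * ‖hat (fun x => w x a) ξ‖ₑ ^ 2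
      ≤ sobolevNorm m w ^ 2 := by
  refine le_trans ?_ (gradNormSq_le_sobolevNorm_sq hk w)
  rw [gradNormSq_eq k fun a => memLp_of_sobolevNorm h a]
  refine Finset.sum_le_sum fun a _ => lintegral_mono fun ξ => ?_
  beta_reduce
  gcongr
  exact le_mul_of_one_le_left (norm_nonneg _) (by linarith [Real.pi_gt_three])

theorem enorm_symb_sq_le {k : ℕ} (I : Fin k → Fin 3) (ξ : E) :
    ‖symb I ξ‖ₑ ^ 2 ≤ ENNReal.ofReal ((2 * Real.pi) ^ (2 * k)) * ENNReal.ofReal (‖ξ‖ ^ (2 * k)) := by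
  rw [← ENNReal.ofReal_mul (by positivity), ← mul_pow, ← sum_enorm_symb_sq]
  exact Finset.single_le_sum (f := fun I => ‖symb I ξ‖ₑ ^ 2) (fun _ _ => zero_le)
    (Finset.mem_univ I)

theorem lintegral_symb_lt_top {ι : Type} [Fintype ι] {m k : ℕ} (hk : k ≤ m) {w : E → ι → ℝ}
    (h : sobolevNorm m w < ⊤) (I : Fin k → Fin 3) (a : ι) :
    ∫⁻ ξ, ‖symb I ξ‖ₑ ^ 2 * ‖hat (fun x => w x a) ξ‖ₑ ^ 2 < ⊤ := by
  have h1 : ∫⁻ ξ, ENNReal.ofReal (‖ξ‖ ^ (2 * k)) * ‖hat (fun x => w x a) ξ‖ₑ ^ 2 < ⊤ :=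
    lt_of_le_of_lt (Finset.single_le_sum (f := fun a => ∫⁻ ξ, ENNReal.ofReal (‖ξ‖ ^ (2 * k)) *
      ‖hat (fun x => w x a) ξ‖ₑ ^ 2) (fun _ _ => zero_le) (Finset.mem_univ a))
      ((lintegral_pow_hat_le hk h).trans_lt (ENNReal.pow_lt_top h))
  have h2 := ENNReal.mul_lt_top (ENNReal.ofReal_lt_top (r := (2 * Real.pi) ^ (2 * k))) h1
  rw [← lintegral_const_mul' _ _ ENNReal.ofReal_ne_top] at h2
  refine lt_of_le_of_lt (lintegral_mono fun ξ => ?_) h2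
  beta_reduce
  rw [← mul_assoc]
  gcongr
  exact enorm_symb_sq_le I ξ

/-! ### Fields in `H^m`, `m ≥ 3`, and the pressure -/

/-- `∫ (1 + |ξ|)⁻⁴ dξ` over `ℝ³`. -/
noncomputable def weightConst : ℝ := ∫ ξ : E, (1 + ‖ξ‖) ^ (-(4 : ℝ))

theorem lintegral_weight : ∫⁻ ξ : E, ENNReal.ofReal ((1 + ‖ξ‖) ^ (-(2 : ℝ))) ^ 2
    = ENNReal.ofReal weightConst := by
  rw [weightConst, ofReal_integral_eq_lintegral_ofReal
    (integrable_one_add_norm (by simp; norm_num)) (Eventually.of_forall fun ξ => by positivity)]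
  refine lintegral_congr fun ξ => ?_
  rw [← ENNReal.ofReal_pow (by positivity), ← Real.rpow_natCast, ← Real.rpow_mul (by positivity)]
  norm_num

theorem one_add_pow_six_le {m : ℕ} (hm : 3 ≤ m) {x : ℝ} (hx : 0 ≤ x) :
    (1 + x) ^ 6 ≤ 64 * (1 + x ^ (2 * m)) := by
  have h : x ^ 6 ≤ 1 + x ^ (2 * m) := by
    rcases le_total x 1 with h | h
    · have := pow_le_one₀ (n := 6) hx h
      have := pow_nonneg hx (2 * m)
      linarith
    · have := pow_le_pow_right₀ h (show 6 ≤ 2 * m by omega)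
      linarith
  have := pow_add_le zero_le_one hx 6
  rcases le_total x 1 with h1 | h1
  · calc (1 + x) ^ 6 ≤ (1 + 1) ^ 6 := by gcongr
      _ ≤ _ := by have := pow_nonneg hx (2 * m); norm_num; linarith
  · have h2 := pow_le_pow_right₀ h1 (show 6 ≤ 2 * m by omega)
    calc (1 + x) ^ 6 ≤ (x + x) ^ 6 := by gcongr
      _ = 64 * x ^ 6 := by ring
      _ ≤ _ := by linarith

/-- Functions in `H^m(ℝ³)`, `m ≥ 3`, have a Fourier transform which is integrable against
`1 + |ξ|`. -/
theorem lintegral_hat_le {m : ℕ} (hm : 3 ≤ m) (h : L2C) {X : ℝ}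
    (hX : (∫⁻ ξ, ‖h ξ‖ₑ ^ 2) + ∫⁻ ξ, ENNReal.ofReal (‖ξ‖ ^ (2 * m)) * ‖h ξ‖ₑ ^ 2 ≤ ENNReal.ofReal X) :
    ∫⁻ ξ, (1 + ‖ξ‖ₑ) * ‖h ξ‖ₑ ≤ ENNReal.ofReal (√weightConst * √(64 * X)) := by
  have mh := (measurable_coe h).enorm
  have e1 : ∀ ξ : E, (1 + ‖ξ‖ₑ) = ENNReal.ofReal (1 + ‖ξ‖) := fun ξ => by
    rw [ENNReal.ofReal_add zero_le_one (norm_nonneg _), ENNReal.ofReal_one, ofReal_norm]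
  have e2 : ∀ ξ : E, (1 + ‖ξ‖ₑ) * ‖h ξ‖ₑ = ENNReal.ofReal ((1 + ‖ξ‖) ^ (-(2 : ℝ))) *
      (ENNReal.ofReal ((1 + ‖ξ‖) ^ 3) * ‖h ξ‖ₑ) := fun ξ => by
    rw [← mul_assoc, ← ENNReal.ofReal_mul (by positivity), e1]
    congr 2
    rw [← Real.rpow_natCast, ← Real.rpow_add (by positivity)]
    norm_num
  simp only [e2]
  have m1 : Measurable fun ξ : E => ENNReal.ofReal ((1 + ‖ξ‖) ^ (-(2 : ℝ))) := by fun_prop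
  refine lintegral_mul_le_sqrt m1.aemeasurable (by fun_prop) lintegral_weight.le ?_
  calc ∫⁻ ξ, (ENNReal.ofReal ((1 + ‖ξ‖) ^ 3) * ‖h ξ‖ₑ) ^ 2
      ≤ ∫⁻ ξ, ENNReal.ofReal 64 * (‖h ξ‖ₑ ^ 2 + ENNReal.ofReal (‖ξ‖ ^ (2 * m)) * ‖h ξ‖ₑ ^ 2) := by
        refine lintegral_mono fun ξ => ?_
        beta_reduce
        have e3 : ‖h ξ‖ₑ ^ 2 + ENNReal.ofReal (‖ξ‖ ^ (2 * m)) * ‖h ξ‖ₑ ^ 2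
            = ENNReal.ofReal (1 + ‖ξ‖ ^ (2 * m)) * ‖h ξ‖ₑ ^ 2 := by
          rw [ENNReal.ofReal_add zero_le_one (by positivity), ENNReal.ofReal_one]; ring
        rw [mul_pow, ← ENNReal.ofReal_pow (by positivity), ← pow_mul, e3, ← mul_assoc,
          ← ENNReal.ofReal_mul (by norm_num)]
        gcongr
        exact one_add_pow_six_le hm (norm_nonneg _)
    _ ≤ _ := by
        rw [lintegral_const_mul' _ _ ENNReal.ofReal_ne_top, lintegral_add_left (by fun_prop),
          ENNReal.ofReal_mul (by norm_num)]
        gcongr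

theorem integrable_hat_of_sobolev {ι : Type} [Fintype ι] {m : ℕ} (hm : 3 ≤ m) {w : E → ι → ℝ}
    (h : sobolevNorm m w < ⊤) (a : ι) : Integrable (hat (fun x => w x a) : E → ℂ) volume := by
  have h1 : ∀ k ≤ m, ∫⁻ ξ, ENNReal.ofReal (‖ξ‖ ^ (2 * k)) * ‖hat (fun x => w x a) ξ‖ₑ ^ 2 < ⊤ :=
    fun k hk => lt_of_le_of_lt (Finset.single_le_sum (f := fun a => ∫⁻ ξ,
      ENNReal.ofReal (‖ξ‖ ^ (2 * k)) * ‖hat (fun x => w x a) ξ‖ₑ ^ 2) (fun _ _ => zero_le)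
      (Finset.mem_univ a)) ((lintegral_pow_hat_le hk h).trans_lt (ENNReal.pow_lt_top h))
  have h2 := lintegral_hat_le hm _ (le_ofReal_toReal
    (ENNReal.add_lt_top.2 ⟨lintegral_enorm_sq_lt_top (hat fun x => w x a), h1 m le_rfl⟩))
  refine ⟨(Lp.memLp _).1, lt_of_le_of_lt (lintegral_mono fun ξ => ?_)
    (h2.trans_lt ENNReal.ofReal_lt_top)⟩
  exact le_mul_of_one_le_left zero_le le_self_add

theorem symb_one (l : Fin 3) (ξ : E) :
    symb ![l] ξ = 2 * Real.pi * Complex.I * (ξ l : ℂ) := by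
  simp [symb]

theorem symb_two (l : Fin 3) (ξ : E) :
    symb ![l, l] ξ = -((4 * Real.pi ^ 2 * ξ l ^ 2 : ℝ) : ℂ) := by
  simp only [symb, Fin.prod_univ_two, Matrix.cons_val_zero, Matrix.cons_val_one]
  have := Complex.I_mul_I
  push_cast
  linear_combination (4 * (Real.pi : ℂ) ^ 2 * (ξ l : ℂ) ^ 2) * this

theorem hasGrad_of_sobolev {ι : Type} [Fintype ι] {m : ℕ} (hm : 1 ≤ m) {w : E → ι → ℝ}
    (h : sobolevNorm m w < ⊤) (a : ι) :
    HasGrad (fun x => w x a) (fun l => weakDeriv ![l] (fun x => w x a)) := by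
  have h0 := memLp_of_sobolevNorm h a
  have h1 := fun l : Fin 3 => weakDeriv_spec h0 (lintegral_symb_lt_top hm h ![l] a)
  refine ⟨h0, fun l => (h1 l).1, fun l => ?_⟩
  filter_upwards [(h1 l).2] with ξ hξ
  rw [hξ, symb_one]

/-- Fields in `H^m`, `m ≥ 3`, whose weak divergence vanishes. -/
theorem divFree_of_sobolev {m : ℕ} (hm : 3 ≤ m) {ι : Type} [Fintype ι] {w : E → ι → ℝ}
    (h : sobolevNorm m w < ⊤) (a : Fin 3 → ι)
    (hd : ∀ᵐ x, ∑ l : Fin 3, weakDeriv ![l] (fun y => w y (a l)) x = 0) :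
    DivFree (fun l x => w x (a l)) := by
  have h1 := fun l => hasGrad_of_sobolev (by omega) h (a l)
  refine ⟨fun l => memLp_of_sobolevNorm h _, fun l => integrable_hat_of_sobolev hm h _, ?_⟩
  have h2 : hat (fun x => ∑ l : Fin 3, weakDeriv ![l] (fun y => w y (a l)) x) = 0 := by
    rw [← hat_zero]
    exact hat_congr (memLp_finsetSum _ fun l _ => (h1 l).memLp_grad l) hd
  rw [hat_sum _ fun l _ => (h1 l).memLp_grad l] at h2
  have h3 : ∀ᵐ ξ, ∀ l, hat (weakDeriv ![l] (fun y => w y (a l))) ξ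
      = 2 * Real.pi * Complex.I * (ξ l : ℂ) * hat (fun y => w y (a l)) ξ :=
    ae_all_iff.2 fun l => (h1 l).hat_grad l
  have h4 := Lp.coeFn_finsetSum (p := 2) (μ := (volume : Measure E)) Finset.univ
    fun l : Fin 3 => hat (weakDeriv ![l] (fun y => w y (a l)))
  rw [h2] at h4
  filter_upwards [h3, h4, Lp.coeFn_zero ℂ 2 (volume : Measure E)] with ξ j1 j2 j3
  rw [j3, Finset.sum_apply] at j2
  simp only [j1, mul_assoc, ← Finset.mul_sum, Pi.zero_apply] at j2
  have hpi : (Real.pi : ℂ) ≠ 0 := by exact_mod_cast Real.pi_ne_zero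
  simpa [hpi] using j2.symm

/-- The velocity components at time `t`. -/
def vel (u : ℝ → E → Fin 3 → ℝ) (t : ℝ) : Fin 3 → E → ℝ := fun k x => u t x k

/-- The entries of the deformation tensor at time `t`. -/
def deform (F : ℝ → E → Matrix (Fin 3) (Fin 3) ℝ) (t : ℝ) : Fin 3 × Fin 3 → E → ℝ :=
  fun a x => F t x a.1 a.2

/-- The advection term `v·∇f`. -/
noncomputable def adv (v : Fin 3 → E → ℝ) (f : E → ℝ) : E → ℝ :=
  fun x => ∑ l, v l x * weakDeriv ![l] f x

/-- The columns of a family indexed by pairs. -/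
def col (w : Fin 3 × Fin 3 → E → ℝ) (j : Fin 3) : Fin 3 → E → ℝ := fun l => w (l, j)

/-- A curl-free square integrable field is orthogonal to divergence-free fields, also after
applying a Fourier multiplier. -/
theorem sum_pair_gradient_eq_zero {v : Fin 3 → E → ℝ} (hv : DivFree v) {p : E → ℝ}
    {G : Fin 3 → E → ℝ} (hp : ∀ k, IsWeakDeriv ![k] p (G k)) (hG : ∀ k, MemLp (G k) 2 volume)
    {σ : E → ℝ} {M : ℝ} (hσ : Measurable σ) (hσM : ∀ ξ, ‖σ ξ‖ ≤ M) :
    ∑ k, pair σ (hat (v k)) (hat (G k)) = 0 := by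
  have hcurl : ∀ k l : Fin 3, ∀ᵐ ξ : E, (ξ l : ℂ) * hat (G k) ξ = (ξ k : ℂ) * hat (G l) ξ := by
    intro k l
    have h := symb_mul_hat_of_test ![l] ![k] (hG k) (hG l) 1 (by
      intro φ h1 h2
      have hd : ∀ k : Fin 3, ∀ ψ : E → ℝ, ∀ x, iteratedFDeriv ℝ 1 ψ x (dirs ![k])
          = fderiv ℝ ψ x (EuclideanSpace.single k (1 : ℝ)) := fun k ψ x => by
        rw [iteratedFDeriv_one_apply]; simp [dirs]
      have hs : ∀ l : Fin 3, ContDiff ℝ ∞ fun x => fderiv ℝ φ x (EuclideanSpace.single l (1 : ℝ)) :=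
        fun l => (h1.fderiv_right (m := ∞) (by simp)).clm_apply contDiff_const
      have hc : ∀ l : Fin 3, HasCompactSupport
          fun x => fderiv ℝ φ x (EuclideanSpace.single l (1 : ℝ)) :=
        fun l => h2.fderiv_apply ℝ _
      have hk := fun k l => (hp k).2.2 _ (hs l) (hc l)
      have hk' : ∀ k l : Fin 3, ∫ x, G k x * iteratedFDeriv ℝ 1 φ x (dirs ![l])
          = - ∫ x, p x * fderiv ℝ (fun x => fderiv ℝ φ x (EuclideanSpace.single l (1 : ℝ))) x
            (EuclideanSpace.single k (1 : ℝ)) := fun k l => by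
        have e := hk k l
        simp only [hd]
        have : ∀ x, iteratedFDeriv ℝ 1 (fun x => fderiv ℝ φ x (EuclideanSpace.single l (1 : ℝ))) x
            (fun r => EuclideanSpace.single ((![k] : Fin 1 → Fin 3) r) (1 : ℝ))
            = fderiv ℝ (fun x => fderiv ℝ φ x (EuclideanSpace.single l (1 : ℝ))) x
              (EuclideanSpace.single k (1 : ℝ)) := fun x => hd k _ x
        simp only [this, pow_one] at e
        rw [e]; ring
      rw [one_mul, hk', hk']
      congr 1
      refine integral_congr_ae (Eventually.of_forall fun x => ?_)
      beta_reduce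
      congr 1
      have hdiff : DifferentiableAt ℝ (fderiv ℝ φ) x :=
        (h1.fderiv_right (m := ∞) (by simp)).differentiable (by simp) x
      have hsymm : IsSymmSndFDerivAt ℝ φ x :=
        h1.contDiffAt.isSymmSndFDerivAt (by
          rw [minSmoothness_of_isRCLikeNormedField]
          exact WithTop.coe_le_coe.2 (le_top : (2 : ℕ∞) ≤ ⊤))
      rw [fderiv_clm_apply hdiff (by fun_prop), fderiv_clm_apply hdiff (by fun_prop)]
      simpa using! hsymm _ _)
    filter_upwards [h] with ξ hξ
    rw [symb_one, symb_one] at hξ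
    have hpi : (2 * Real.pi * Complex.I : ℂ) ≠ 0 := by simp [Real.pi_ne_zero]
    refine mul_left_cancel₀ (neg_ne_zero.2 hpi) ?_
    simp only [pow_one, Complex.ofReal_one] at hξ
    linear_combination hξ
  have hc : ∀ᵐ ξ : E, ∀ k l, (ξ l : ℂ) * hat (G k) ξ = (ξ k : ℂ) * hat (G l) ξ :=
    ae_all_iff.2 fun k => ae_all_iff.2 fun l => hcurl k l
  have hne : ∀ᵐ ξ : E, ξ ≠ 0 := by simp [ae_iff, measure_singleton]
  unfold pair
  rw [← integral_finsetSum _ fun k _ => integrable_pair hσ hσM _ _]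
  rw [← integral_zero E ℝ]
  refine integral_congr_ae ?_
  filter_upwards [hc, hv.div, hne] with ξ h1 h2 h3
  rw [← Finset.mul_sum, ← Complex.re_sum]
  have h4 : ((‖ξ‖ ^ 2 : ℝ) : ℂ) * ∑ k, conj (hat (v k) ξ) * hat (G k) ξ = 0 := by
    rw [EuclideanSpace.real_norm_sq_eq]
    push_cast
    rw [Finset.sum_mul]
    have h5 : conj (∑ l, (ξ l : ℂ) * hat (v l) ξ) = 0 := by rw [h2, map_zero]
    simp only [map_sum, map_mul, Complex.conj_ofReal] at h5
    refine Finset.sum_eq_zero fun l _ => ?_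
    calc (ξ l : ℂ) ^ 2 * ∑ k, conj (hat (v k) ξ) * hat (G k) ξ
        = ∑ k, (ξ l : ℂ) * (conj (hat (v k) ξ) * ((ξ l : ℂ) * hat (G k) ξ)) := by
          rw [Finset.mul_sum]; exact Finset.sum_congr rfl fun k _ => by ring
      _ = ∑ k, ((ξ l : ℂ) * hat (G l) ξ) * ((ξ k : ℂ) * conj (hat (v k) ξ)) :=
          Finset.sum_congr rfl fun k _ => by rw [h1 k l]; ring
      _ = 0 := by rw [← Finset.mul_sum, h5, mul_zero]
  have h6 : ((‖ξ‖ ^ 2 : ℝ) : ℂ) ≠ 0 := by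
    have := norm_ne_zero_iff.2 h3
    exact_mod_cast pow_ne_zero 2 this
  rw [(mul_eq_zero.1 h4).resolve_left h6]
  simp

/-! ### Evolution of the weighted energies -/

/-- Continuity in time of the Fourier transforms of a curve in `C([0, ∞); H^m)`. -/
theorem ContinuousInSobolev.continuousWithinAt_hat {ι : Type} [Fintype ι] {m : ℕ}
    {w : ℝ → E → ι → ℝ} (h : ContinuousInSobolev m w) {t : ℝ} (ht : 0 ≤ t) (a : ι) :
    ContinuousWithinAt (fun s => hat (fun x => w s x a)) (Set.Ici 0) t := by
  rw [ContinuousWithinAt, tendsto_iff_edist_tendsto_0]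
  have h2 := (h t ht).2
  refine tendsto_of_tendsto_of_tendsto_of_le_of_le' tendsto_const_nhds h2
    (Eventually.of_forall fun _ => zero_le) ?_
  filter_upwards [h2.eventually (gt_mem_nhds ENNReal.zero_lt_top), self_mem_nhdsWithin]
    with s hs hs0
  have m1 := memLp_of_sobolevNorm (h t ht).1 a
  have m2 := memLp_of_sobolevNorm (h s hs0).1 a
  have h3 : ‖hat (fun x => w s x a) - hat (fun x => w t x a)‖ₑ ^ 2
      ≤ sobolevNorm m (fun x => w s x - w t x) ^ 2 := by
    rw [← hat_sub m2 m1, enorm_sq_eq_lintegral]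
    refine le_trans ?_ (lintegral_pow_hat_le (Nat.zero_le m) hs)
    simp only [mul_zero, pow_zero, ENNReal.ofReal_one, one_mul]
    exact Finset.single_le_sum
      (f := fun a => ∫⁻ ξ, ‖hat (fun x => (w s x - w t x) a) ξ‖ₑ ^ 2) (fun _ _ => zero_le)
      (Finset.mem_univ a)
  rw [edist_eq_enorm_sub]
  exact (ENNReal.pow_le_pow_left_iff two_ne_zero).1 h3

namespace IsGlobalSolution

variable {m : ℕ} {μ ν : ℝ} {u : ℝ → E → Fin 3 → ℝ} {F : ℝ → E → Matrix (Fin 3) (Fin 3) ℝ}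

theorem divFree_vel (h : IsGlobalSolution m μ ν u F) (hm : 3 ≤ m) {t : ℝ} (ht : 0 ≤ t) :
    DivFree (vel u t) :=
  divFree_of_sobolev hm (h.velocity_mem t ht).1 id (h.velocity_div t ht)

theorem divFree_col (h : IsGlobalSolution m μ ν u F) (hm : 3 ≤ m) {t : ℝ} (ht : 0 ≤ t)
    (j : Fin 3) : DivFree (col (deform F t) j) :=
  divFree_of_sobolev hm (h.deformation_mem t ht).1 (fun l => (l, j)) (h.deformation_div t ht j)

theorem hasGrad_vel (h : IsGlobalSolution m μ ν u F) (hm : 3 ≤ m) {t : ℝ} (ht : 0 ≤ t)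
    (k : Fin 3) : HasGrad (vel u t k) (fun l => weakDeriv ![l] (vel u t k)) :=
  hasGrad_of_sobolev (by omega) (h.velocity_mem t ht).1 k

theorem hasGrad_deform (h : IsGlobalSolution m μ ν u F) (hm : 3 ≤ m) {t : ℝ} (ht : 0 ≤ t)
    (a : Fin 3 × Fin 3) : HasGrad (deform F t a) (fun l => weakDeriv ![l] (deform F t a)) :=
  hasGrad_of_sobolev (by omega) (h.deformation_mem t ht).1 a

theorem eventually_memLp_vel (h : IsGlobalSolution m μ ν u F) {t : ℝ} (ht : 0 < t) (k : Fin 3) :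
    ∀ᶠ s in 𝓝 t, MemLp (vel u s k) 2 volume := by
  filter_upwards [lt_mem_nhds ht] with s hs
  exact memLp_of_sobolevNorm (h.velocity_mem s hs.le).1 k

theorem eventually_memLp_deform (h : IsGlobalSolution m μ ν u F) {t : ℝ} (ht : 0 < t)
    (a : Fin 3 × Fin 3) : ∀ᶠ s in 𝓝 t, MemLp (deform F s a) 2 volume := by
  filter_upwards [lt_mem_nhds ht] with s hs
  exact memLp_of_sobolevNorm (h.deformation_mem s hs.le).1 a

theorem continuousWithinAt_vel (h : IsGlobalSolution m μ ν u F) {t : ℝ} (ht : 0 ≤ t)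
    (k : Fin 3) : ContinuousWithinAt (fun s => hat (vel u s k)) (Set.Ici 0) t :=
  h.velocity_mem.continuousWithinAt_hat ht k

theorem continuousWithinAt_deform (h : IsGlobalSolution m μ ν u F) {t : ℝ} (ht : 0 ≤ t)
    (a : Fin 3 × Fin 3) : ContinuousWithinAt (fun s => hat (deform F s a)) (Set.Ici 0) t :=
  h.deformation_mem.continuousWithinAt_hat ht a

end IsGlobalSolution

/-- The weighted energy `∑ₐ ‖σ ŵₐ‖²`. With `σ = wt k R` and `R → ∞` it becomes `‖∇^k w‖²` up to the
factor `(2π)^(2k)` due to the normalisation of the Fourier transform. -/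
noncomputable def energy {κ : Type} [Fintype κ] (σ : E → ℝ) (w : κ → E → ℝ) : ℝ :=
  ∑ a, pair σ (hat (w a)) (hat (w a))

/-- The weight `σ(ξ) |ξ|`: if `σ` is the weight of an energy, then `gw σ` is that of its dissipation. -/
noncomputable def gw (σ : E → ℝ) : E → ℝ := fun ξ => σ ξ * ‖ξ‖

theorem sum_pair_laplacian {f : E → ℝ} {lap : Fin 3 → E → ℝ} {σ : E → ℝ} {M : ℝ}
    (hσ : Measurable σ) (hσM : ∀ ξ, ‖σ ξ‖ ≤ M)
    (h : ∀ l, ∀ᵐ ξ, hat (lap l) ξ = symb ![l, l] ξ * hat f ξ) :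
    ∑ l, pair σ (hat f) (hat (lap l)) = -(4 * Real.pi ^ 2) * pair (gw σ) (hat f) (hat f) := by
  rw [pair_self]
  unfold pair
  rw [← integral_finsetSum _ fun k _ => integrable_pair hσ hσM _ _, ← integral_const_mul]
  refine integral_congr_ae ?_
  filter_upwards [ae_all_iff.2 h] with ξ hξ
  simp only [hξ, symb_two, gw]
  have e : ∀ l : Fin 3, (conj (hat f ξ) * (-((4 * Real.pi ^ 2 * ξ l ^ 2 : ℝ) : ℂ) * hat f ξ)).re
      = -(4 * Real.pi ^ 2) * ξ l ^ 2 * ‖hat f ξ‖ ^ 2 := fun l => by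
    rw [show conj (hat f ξ) * (-((4 * Real.pi ^ 2 * ξ l ^ 2 : ℝ) : ℂ) * hat f ξ)
      = ((-(4 * Real.pi ^ 2 * ξ l ^ 2) : ℝ) : ℂ) * (conj (hat f ξ) * hat f ξ) by push_cast; ring,
      Complex.re_ofReal_mul, ← Complex.normSq_eq_conj_mul_self, Complex.ofReal_re,
      Complex.normSq_eq_norm_sq]
    ring
  simp only [e]
  rw [← Finset.mul_sum, ← Finset.sum_mul, ← Finset.mul_sum, ← EuclideanSpace.real_norm_sq_eq]
  ring

theorem pair_smul_right (σ : E → ℝ) (f : E → ℂ) (c : ℝ) (g : L2C) :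
    pair σ f ((c : ℂ) • g : L2C) = c * pair σ f g := by
  unfold pair
  rw [← integral_const_mul]
  refine integral_congr_ae ?_
  filter_upwards [Lp.coeFn_smul (c : ℂ) g] with ξ h
  rw [h, Pi.smul_apply, smul_eq_mul, mul_left_comm, Complex.re_ofReal_mul]
  ring

namespace IsGlobalSolution

variable {m : ℕ} {μ ν : ℝ} {u : ℝ → E → Fin 3 → ℝ} {F : ℝ → E → Matrix (Fin 3) (Fin 3) ℝ}

/-- The evolution of the weighted kinetic energy; the pressure does not contribute. -/
theorem hasDerivAt_energy_vel (h : IsGlobalSolution m μ ν u F) (hm : 3 ≤ m) {t : ℝ} (ht : 0 < t)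
    {σ : E → ℝ} {M : ℝ} (hσ : Measurable σ) (hσM : ∀ ξ, ‖σ ξ‖ ≤ M) :
    HasDerivAt (fun s => energy σ (vel u s))
      (-(8 * Real.pi ^ 2 * μ) * energy (gw σ) (vel u t)
        - 2 * ∑ k, pair σ (hat (vel u t k)) (hat (adv (vel u t) (vel u t k)))
        + 2 * ∑ k, ∑ i, pair σ (hat (vel u t k))
          (hat (adv (col (deform F t) i) (deform F t (k, i))))) t := by
  obtain ⟨p, hp⟩ := h.momentum
  have hw := fun k => (hp t ht k).1
  have hd := fun k => (hp t ht k).2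
  have hG := fun k => isWeakDeriv_weakDeriv (hw k)
  have hsob := (h.velocity_mem t ht.le).1
  have hL : ∀ k l : Fin 3, MemLp (weakDeriv ![l, l] (vel u t k)) 2 volume ∧
      ∀ᵐ ξ, hat (weakDeriv ![l, l] (vel u t k)) ξ = symb ![l, l] ξ * hat (vel u t k) ξ :=
    fun k l => weakDeriv_spec (memLp_of_sobolevNorm hsob k)
      (lintegral_symb_lt_top (show 2 ≤ m by omega) hsob ![l, l] k)
  have hA : ∀ k, MemLp (adv (vel u t) (vel u t k)) 2 volume := fun k =>
    (h.divFree_vel hm ht.le).memLp_adv (h.hasGrad_vel hm ht.le k)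
  have hB : ∀ k i, MemLp (adv (col (deform F t) i) (deform F t (k, i))) 2 volume := fun k i =>
    (h.divFree_col hm ht.le i).memLp_adv (h.hasGrad_deform hm ht.le (k, i))
  have hLs : ∀ k : Fin 3, MemLp (fun x => ∑ l : Fin 3, weakDeriv ![l, l] (vel u t k) x) 2 volume :=
    fun k => memLp_finsetSum _ fun l _ => (hL k l).1
  have hBs : ∀ k : Fin 3, MemLp (fun x => ∑ i : Fin 3,
      adv (col (deform F t) i) (deform F t (k, i)) x) 2 volume :=
    fun k => memLp_finsetSum _ fun i _ => hB k i
  let g : Fin 3 → E → ℝ := fun k x =>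
    μ * (∑ l : Fin 3, weakDeriv ![l, l] (vel u t k) x) - adv (vel u t) (vel u t k) x
      - weakDeriv ![k] (p t) x + ∑ i : Fin 3, adv (col (deform F t) i) (deform F t (k, i)) x
  have hd' : ∀ k, HasL2DerivAt (fun s => vel u s k) (g k) t := hd
  have hg : ∀ k, MemLp (g k) 2 volume := fun k =>
    memLp_of_hasL2DerivAt (hd' k) (h.eventually_memLp_vel ht k)
      (((((hLs k).const_mul μ).sub (hA k)).1.sub (hG k).2.1.aestronglyMeasurable).add (hBs k).1)
  have hGm : ∀ k, MemLp (weakDeriv ![k] (p t)) 2 volume := fun k => by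
    refine (((((hLs k).const_mul μ).sub (hA k)).add (hBs k)).sub (hg k)).ae_eq
      (Eventually.of_forall fun x => ?_)
    simp only [g, Pi.add_apply, Pi.sub_apply]
    ring
  have hhat : ∀ k, hat (g k) = (μ : ℂ) • (∑ l : Fin 3, hat (weakDeriv ![l, l] (vel u t k)))
      - hat (adv (vel u t) (vel u t k)) - hat (weakDeriv ![k] (p t))
      + ∑ i, hat (adv (col (deform F t) i) (deform F t (k, i))) := fun k => by
    have e1 := hat_add (((((hLs k).const_mul μ).sub (hA k)).sub (hGm k))) (hBs k)
    have e2 := hat_sub (((hLs k).const_mul μ).sub (hA k)) (hGm k)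
    have e3 := hat_sub ((hLs k).const_mul μ) (hA k)
    have e4 := hat_smul μ (hLs k)
    have e5 := hat_sum Finset.univ fun l (_ : l ∈ Finset.univ) => (hL k l).1
    have e6 := hat_sum Finset.univ fun i (_ : i ∈ Finset.univ) => hB k i
    calc hat (g k) = _ := e1
      _ = _ := by
        rw [← e5, ← e4, ← e6]
        congr 1
        exact e2.trans (by congr 1)
  have key : ∀ k, HasDerivAt (fun s => pair σ (hat (vel u s k)) (hat (vel u s k)))
      (2 * pair σ (hat (vel u t k)) (hat (g k))) t := fun k =>
    hasDerivAt_pair hσ hσM (hasDerivAt_hat (hd' k) (h.eventually_memLp_vel ht k) (hg k))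
  have key2 := HasDerivAt.fun_sum (u := Finset.univ) fun k _ => key k
  unfold energy
  convert! key2 using 1
  have hpk : ∀ k, pair σ (hat (vel u t k)) (hat (g k))
      = μ * (-(4 * Real.pi ^ 2) * pair (gw σ) (hat (vel u t k)) (hat (vel u t k)))
        - pair σ (hat (vel u t k)) (hat (adv (vel u t) (vel u t k)))
        - pair σ (hat (vel u t k)) (hat (weakDeriv ![k] (p t)))
        + ∑ i, pair σ (hat (vel u t k))
          (hat (adv (col (deform F t) i) (deform F t (k, i)))) := fun k => by
    rw [← sum_pair_laplacian hσ hσM fun l => (hL k l).2]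
    have hsum : pair σ (hat (vel u t k)) (∑ l : Fin 3, hat (weakDeriv ![l, l] (vel u t k)) : L2C)
        = ∑ l : Fin 3, pair σ (hat (vel u t k)) (hat (weakDeriv ![l, l] (vel u t k))) :=
      map_sum (pairL hσ hσM (hat (vel u t k))) _ _
    have := congrArg (pairL hσ hσM (hat (vel u t k))) (hhat k)
    simp only [map_add, map_sub, map_sum, pairL_apply, pair_smul_right] at this
    rw [this, ← hsum]
  have hz := sum_pair_gradient_eq_zero (h.divFree_vel hm ht.le) hG hGm hσ hσM
  simp only [hpk]
  simp only [← Finset.mul_sum, Finset.sum_add_distrib, Finset.sum_sub_distrib, hz]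
  ring

/-- The evolution of the weighted elastic energy. -/
theorem hasDerivAt_energy_deform (h : IsGlobalSolution m μ ν u F) (hm : 3 ≤ m) {t : ℝ}
    (ht : 0 < t) {σ : E → ℝ} {M : ℝ} (hσ : Measurable σ) (hσM : ∀ ξ, ‖σ ξ‖ ≤ M) :
    HasDerivAt (fun s => energy σ (deform F s))
      (-(2 * ν) * energy σ (deform F t)
        - 2 * ∑ a, pair σ (hat (deform F t a)) (hat (adv (vel u t) (deform F t a)))
        + 2 * ∑ a, pair σ (hat (deform F t a))
          (hat (adv (col (deform F t) a.2) (vel u t a.1)))) t := by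
  have hd := fun a : Fin 3 × Fin 3 => h.transport t ht a.1 a.2
  have hF := fun a => (h.hasGrad_deform hm ht.le a).memLp
  have hA : ∀ a, MemLp (adv (vel u t) (deform F t a)) 2 volume := fun a =>
    (h.divFree_vel hm ht.le).memLp_adv (h.hasGrad_deform hm ht.le a)
  have hB : ∀ a : Fin 3 × Fin 3, MemLp (adv (col (deform F t) a.2) (vel u t a.1)) 2 volume :=
    fun a => (h.divFree_col hm ht.le a.2).memLp_adv (h.hasGrad_vel hm ht.le a.1)
  let g : Fin 3 × Fin 3 → E → ℝ := fun a x =>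
    -(ν * deform F t a x) - adv (vel u t) (deform F t a) x
      + adv (col (deform F t) a.2) (vel u t a.1) x
  have hd' : ∀ a, HasL2DerivAt (fun s => deform F s a) (g a) t := hd
  have hg : ∀ a, MemLp (g a) 2 volume := fun a =>
    ((((hF a).const_mul ν).neg).sub (hA a)).add (hB a)
  have hhat : ∀ a, hat (g a) = -((ν : ℂ) • hat (deform F t a))
      - hat (adv (vel u t) (deform F t a)) + hat (adv (col (deform F t) a.2) (vel u t a.1)) :=
    fun a => by
    have e1 := hat_add ((((hF a).const_mul ν).neg).sub (hA a)) (hB a)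
    have e2 := hat_sub ((hF a).const_mul ν).neg (hA a)
    have e3 := hat_neg ((hF a).const_mul ν)
    have e4 := hat_smul ν (hF a)
    rw [← e4, ← e3]
    exact e1.trans (congrArg (· + _) e2)
  have key : ∀ a, HasDerivAt (fun s => pair σ (hat (deform F s a)) (hat (deform F s a)))
      (2 * pair σ (hat (deform F t a)) (hat (g a))) t := fun a =>
    hasDerivAt_pair hσ hσM (hasDerivAt_hat (hd' a) (h.eventually_memLp_deform ht a) (hg a))
  have key2 := HasDerivAt.fun_sum (u := Finset.univ) fun a _ => key a
  unfold energy
  convert! key2 using 1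
  have hpk : ∀ a, pair σ (hat (deform F t a)) (hat (g a))
      = -(ν * pair σ (hat (deform F t a)) (hat (deform F t a)))
        - pair σ (hat (deform F t a)) (hat (adv (vel u t) (deform F t a)))
        + pair σ (hat (deform F t a)) (hat (adv (col (deform F t) a.2) (vel u t a.1))) :=
    fun a => by
    have := congrArg (pairL hσ hσM (hat (deform F t a))) (hhat a)
    simp only [map_add, map_sub, map_neg, pairL_apply, pair_smul_right] at this
    exact this
  simp only [hpk]
  simp only [← Finset.mul_sum, Finset.sum_add_distrib, Finset.sum_sub_distrib,
    Finset.sum_neg_distrib]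
  ring

end IsGlobalSolution

/-! ### Trilinear estimates of the nonlinear terms -/

theorem measurable_ew {σ : E → ℝ} (hσ : Measurable σ) : Measurable (ew σ) := hσ.enorm

theorem ew_of_nonneg {σ : E → ℝ} {ξ : E} (h : 0 ≤ σ ξ) : ew σ ξ = ENNReal.ofReal (σ ξ) :=
  Real.enorm_of_nonneg h

theorem norm_wt_le (k : ℕ) {R : ℝ} (hR : 0 ≤ R) (ξ : E) : ‖wt k R ξ‖ ≤ R ^ k := by
  rw [Real.norm_of_nonneg (wt_nonneg k hR ξ)]; exact wt_le k hR ξ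

theorem sqrt_nine_mul (x : ℝ) : √(9 * x) = 3 * √x := by
  rw [Real.sqrt_mul (by norm_num), show (9 : ℝ) = 3 ^ 2 by norm_num, Real.sqrt_sq (by norm_num)]

theorem measurable_gw {σ : E → ℝ} (hσ : Measurable σ) : Measurable (gw σ) :=
  hσ.mul measurable_norm

theorem ew_gw (σ : E → ℝ) (ξ : E) : ew (gw σ) ξ = ew σ ξ * ‖ξ‖ₑ := by
  rw [ew, gw, enorm_mul, ew, enorm_norm]

/-- A weighted energy in `[0, ∞]` agrees with its real counterpart when it is finite. -/
theorem ofReal_pair_self {σ : E → ℝ} (hσ : Measurable σ) (h : L2C)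
    (hfin : ∫⁻ ξ, (ew σ ξ * ‖h ξ‖ₑ) ^ 2 < ⊤) :
    ENNReal.ofReal (pair σ h h) = ∫⁻ ξ, (ew σ ξ * ‖h ξ‖ₑ) ^ 2 := by
  have e : ∀ ξ, (ew σ ξ * ‖h ξ‖ₑ) ^ 2 = ENNReal.ofReal (σ ξ ^ 2 * ‖h ξ‖ ^ 2) := fun ξ => by
    rw [ew, ← enorm_norm (h ξ), ← enorm_mul, ← enorm_pow, mul_pow,
      Real.enorm_of_nonneg (by positivity)]
  simp only [e] at hfin ⊢
  have mh := (measurable_coe h).norm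
  rw [pair_self, ofReal_integral_eq_lintegral_ofReal _ (Eventually.of_forall fun ξ => by positivity)]
  refine ⟨by fun_prop, ?_⟩
  rw [hasFiniteIntegral_iff_ofReal (Eventually.of_forall fun ξ => by positivity)]
  exact hfin

theorem lintegral_ew_lt_top {σ : E → ℝ} {M : ℝ} (hσM : ∀ ξ, ‖σ ξ‖ ≤ M) {g : E → ℝ≥0∞}
    (hg : ∫⁻ ξ, g ξ ^ 2 < ⊤) : ∫⁻ ξ, (ew σ ξ * g ξ) ^ 2 < ⊤ := by
  have h2 := ENNReal.mul_lt_top (ENNReal.ofReal_lt_top (r := M ^ 2)) hg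
  rw [← lintegral_const_mul' _ _ ENNReal.ofReal_ne_top] at h2
  refine lt_of_le_of_lt (lintegral_mono fun ξ => ?_) h2
  beta_reduce
  rw [mul_pow, ew, ← ofReal_norm, ← ENNReal.ofReal_pow (norm_nonneg _)]
  gcongr
  exact hσM ξ

theorem hatMag_sq_le {κ : Type} [Fintype κ] (w : κ → E → ℝ) (ξ : E) :
    hatMag w ξ ^ 2 ≤ Fintype.card κ * ∑ a, ‖hat (w a) ξ‖ₑ ^ 2 := by
  have e1 : hatMag w ξ = ENNReal.ofReal (∑ a, ‖hat (w a) ξ‖) := by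
    rw [ENNReal.ofReal_sum_of_nonneg fun _ _ => norm_nonneg _]
    exact Finset.sum_congr rfl fun a _ => (ofReal_norm _).symm
  have e2 : ∑ a, ‖hat (w a) ξ‖ₑ ^ 2 = ENNReal.ofReal (∑ a, ‖hat (w a) ξ‖ ^ 2) := by
    rw [ENNReal.ofReal_sum_of_nonneg fun _ _ => by positivity]
    refine Finset.sum_congr rfl fun a _ => ?_
    rw [ENNReal.ofReal_pow (norm_nonneg _), ofReal_norm]
  rw [e1, e2, ← ENNReal.ofReal_pow (Finset.sum_nonneg fun _ _ => norm_nonneg _),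
    ← ENNReal.ofReal_natCast, ← ENNReal.ofReal_mul (Nat.cast_nonneg _)]
  exact ENNReal.ofReal_le_ofReal sq_sum_le_card_mul_sum_sq

theorem energy_nonneg {κ : Type} [Fintype κ] (σ : E → ℝ) (w : κ → E → ℝ) : 0 ≤ energy σ w :=
  Finset.sum_nonneg fun _ _ => pair_self_nonneg _ _

theorem ofReal_energy {κ : Type} [Fintype κ] {σ : E → ℝ} (hσ : Measurable σ) (w : κ → E → ℝ)
    (hfin : ∀ a, ∫⁻ ξ, (ew σ ξ * ‖hat (w a) ξ‖ₑ) ^ 2 < ⊤) :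
    ENNReal.ofReal (energy σ w) = ∑ a, ∫⁻ ξ, (ew σ ξ * ‖hat (w a) ξ‖ₑ) ^ 2 := by
  rw [energy, ENNReal.ofReal_sum_of_nonneg fun _ _ => pair_self_nonneg _ _]
  exact Finset.sum_congr rfl fun a _ => ofReal_pair_self hσ _ (hfin a)

theorem lintegral_hatMag_sq_le {κ : Type} [Fintype κ] (hκ : Fintype.card κ ≤ 9) {σ : E → ℝ}
    (hσ : Measurable σ) (w : κ → E → ℝ)
    (hfin : ∀ a, ∫⁻ ξ, (ew σ ξ * ‖hat (w a) ξ‖ₑ) ^ 2 < ⊤) :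
    ∫⁻ ξ, (ew σ ξ * hatMag w ξ) ^ 2 ≤ ENNReal.ofReal (9 * energy σ w) := by
  have mσ := measurable_ew hσ
  have mh : ∀ a ∈ Finset.univ, Measurable fun ξ => (ew σ ξ * ‖hat (w a) ξ‖ₑ) ^ 2 := fun a _ => by
    have := (measurable_coe (hat (w a))).enorm
    fun_prop
  rw [ENNReal.ofReal_mul (by norm_num), ofReal_energy hσ w hfin, ← lintegral_finsetSum _ mh,
    ← lintegral_const_mul' _ _ ENNReal.ofReal_ne_top]
  refine lintegral_mono fun ξ => ?_
  beta_reduce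
  calc (ew σ ξ * hatMag w ξ) ^ 2 = ew σ ξ ^ 2 * hatMag w ξ ^ 2 := mul_pow _ _ _
    _ ≤ ew σ ξ ^ 2 * (Fintype.card κ * ∑ a, ‖hat (w a) ξ‖ₑ ^ 2) := by
        gcongr; exact hatMag_sq_le w ξ
    _ = (Fintype.card κ : ℝ≥0∞) * ∑ a, (ew σ ξ * ‖hat (w a) ξ‖ₑ) ^ 2 := by
        simp only [mul_pow, ← Finset.mul_sum]; ring
    _ ≤ _ := by
        gcongr
        rw [show ENNReal.ofReal 9 = ((9 : ℕ) : ℝ≥0∞) by norm_num]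
        exact_mod_cast hκ

theorem lintegral_hatMag_sq_le_of_bounded {κ : Type} [Fintype κ] (hκ : Fintype.card κ ≤ 9)
    {σ : E → ℝ} {M : ℝ} (hσ : Measurable σ) (hσM : ∀ ξ, ‖σ ξ‖ ≤ M) (w : κ → E → ℝ) :
    ∫⁻ ξ, (ew σ ξ * hatMag w ξ) ^ 2 ≤ ENNReal.ofReal (9 * energy σ w) :=
  lintegral_hatMag_sq_le hκ hσ w fun _ => lintegral_ew_lt_top hσM (lintegral_enorm_sq_lt_top _)

/-- Distributing a subadditive weight over a trilinear form. -/
theorem tri_wt_le (k : ℕ) {R : ℝ} (hR : 0 ≤ R) {f g h : E → ℝ≥0∞} (mf : Measurable f)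
    (mg : Measurable g) (mh : Measurable h) :
    tri f g (fun ξ => ew (wt k R) ξ ^ 2 * h ξ) ≤ ENNReal.ofReal (2 ^ k) *
      (tri f (fun ξ => ew (wt k R) ξ * g ξ) (fun ξ => ew (wt k R) ξ * h ξ)
        + tri (fun ξ => ew (wt k R) ξ * f ξ) g (fun ξ => ew (wt k R) ξ * h ξ)) := by
  have mσ := measurable_ew (continuous_wt k R).measurable
  unfold tri
  rw [← lintegral_add_left (by fun_prop), ← lintegral_const_mul' _ _ ENNReal.ofReal_ne_top]
  refine lintegral_mono fun ξ => ?_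
  beta_reduce
  rw [← lintegral_add_left (by fun_prop), ← lintegral_const_mul' _ _ ENNReal.ofReal_ne_top]
  refine lintegral_mono fun η => ?_
  beta_reduce
  have hw : ew (wt k R) ξ ≤ ENNReal.ofReal (2 ^ k) * (ew (wt k R) η + ew (wt k R) (ξ - η)) := by
    rw [ew_of_nonneg (wt_nonneg k hR _), ew_of_nonneg (wt_nonneg k hR _),
      ew_of_nonneg (wt_nonneg k hR _), ← ENNReal.ofReal_add (wt_nonneg k hR _) (wt_nonneg k hR _),
      ← ENNReal.ofReal_mul (by positivity)]
    exact ENNReal.ofReal_le_ofReal (wt_subadditive k hR ξ η)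
  calc f (ξ - η) * g η * (ew (wt k R) ξ ^ 2 * h ξ)
      = (f (ξ - η) * g η * (ew (wt k R) ξ * h ξ)) * ew (wt k R) ξ := by ring
    _ ≤ (f (ξ - η) * g η * (ew (wt k R) ξ * h ξ)) *
          (ENNReal.ofReal (2 ^ k) * (ew (wt k R) η + ew (wt k R) (ξ - η))) := by gcongr
    _ = _ := by ring

/-- The commutator form is bounded by two trilinear forms. -/
theorem lintegral_commutator_le (k : ℕ) {R : ℝ} (hR : 0 ≤ R) {f g h : E → ℝ≥0∞}
    (mf : Measurable f) (mg : Measurable g) (mh : Measurable h) :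
    ∫⁻ ξ, ∫⁻ η, ‖wt k R ξ - wt k R η‖ₑ * ‖η‖ₑ * f (ξ - η) * g η * (ew (wt k R) ξ * h ξ)
      ≤ ENNReal.ofReal ((k + 4) * 2 ^ k) *
      (tri (fun ξ => ‖ξ‖ₑ * f ξ) (fun ξ => ew (wt k R) ξ * g ξ) (fun ξ => ew (wt k R) ξ * h ξ)
        + tri (fun ξ => ew (gw (wt k R)) ξ * f ξ) g (fun ξ => ew (wt k R) ξ * h ξ)) := by
  have mσ := measurable_ew (continuous_wt k R).measurable
  simp only [ew_gw]
  unfold tri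
  rw [← lintegral_add_left (by fun_prop), ← lintegral_const_mul' _ _ ENNReal.ofReal_ne_top]
  refine lintegral_mono fun ξ => ?_
  beta_reduce
  rw [← lintegral_add_left (by fun_prop), ← lintegral_const_mul' _ _ ENNReal.ofReal_ne_top]
  refine lintegral_mono fun η => ?_
  beta_reduce
  have hw : ‖wt k R ξ - wt k R η‖ₑ * ‖η‖ₑ ≤ ENNReal.ofReal ((k + 4) * 2 ^ k) *
      (‖ξ - η‖ₑ * (ew (wt k R) η + ew (wt k R) (ξ - η))) := by
    rw [ew_of_nonneg (wt_nonneg k hR _), ew_of_nonneg (wt_nonneg k hR _),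
      ← ENNReal.ofReal_add (wt_nonneg k hR _) (wt_nonneg k hR _), ← ofReal_norm (ξ - η),
      ← ENNReal.ofReal_mul (norm_nonneg _), ← ENNReal.ofReal_mul (by positivity), ← ofReal_norm,
      ← ofReal_norm, ← ENNReal.ofReal_mul (norm_nonneg _)]
    exact ENNReal.ofReal_le_ofReal (abs_wt_sub_wt_mul_le k hR ξ η)
  calc _ = (‖wt k R ξ - wt k R η‖ₑ * ‖η‖ₑ) * (f (ξ - η) * g η * (ew (wt k R) ξ * h ξ)) := by ring
    _ ≤ _ := mul_le_mul_left hw _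
    _ = _ := by ring

/-- The regularity of the velocity `w` and the deformation `W` at a fixed time that the estimates
of the nonlinear terms use, with `n` a bound for their norms in the Wiener algebra. -/
structure Slice (w : Fin 3 → E → ℝ) (W : Fin 3 × Fin 3 → E → ℝ) (n : ℝ) : Prop where
  nonneg : 0 ≤ n
  divFree : DivFree w
  divFree_col : ∀ j, DivFree (col W j)
  hasGrad : ∀ k, HasGrad (w k) (fun l => weakDeriv ![l] (w k))
  hasGrad_deform : ∀ a, HasGrad (W a) (fun l => weakDeriv ![l] (W a))
  lintegral_vel : ∫⁻ ξ, (1 + ‖ξ‖ₑ) * hatMag w ξ ≤ ENNReal.ofReal n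
  lintegral_deform : ∫⁻ ξ, hatMag W ξ ≤ ENNReal.ofReal n

theorem hatMag_col_le (W : Fin 3 × Fin 3 → E → ℝ) (j : Fin 3) (ξ : E) :
    hatMag (col W j) ξ ≤ hatMag W ξ := by
  unfold hatMag col
  rw [Fintype.sum_prod_type_right]
  exact Finset.single_le_sum (f := fun j => ∑ l, ‖hat (W (l, j)) ξ‖ₑ) (fun _ _ => zero_le)
    (Finset.mem_univ j)

/-- A bound for a sum of pairings from a bound of each of them. -/
theorem abs_sum_le_of_enorm_le {κ : Type} [Fintype κ] {f : κ → ℝ} {B : ℝ} (hB : 0 ≤ B)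
    (h : ∀ a, ‖f a‖ₑ ≤ ENNReal.ofReal B) : |∑ a, f a| ≤ Fintype.card κ * B := by
  have h1 : ∀ a, |f a| ≤ B := fun a => by
    have := h a
    rwa [← ofReal_norm, ENNReal.ofReal_le_ofReal_iff hB] at this
  refine (Finset.abs_sum_le_sum_abs _ _).trans ?_
  calc _ ≤ ∑ _a : κ, B := Finset.sum_le_sum fun a _ => h1 a
    _ = _ := by simp

namespace Slice

variable {w : Fin 3 → E → ℝ} {W : Fin 3 × Fin 3 → E → ℝ} {n : ℝ}

theorem lintegral_vel_one (h : Slice w W n) : ∫⁻ ξ, hatMag w ξ ≤ ENNReal.ofReal n :=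
  (lintegral_mono fun _ => le_mul_of_one_le_left zero_le le_self_add).trans h.lintegral_vel

theorem lintegral_vel_grad (h : Slice w W n) : ∫⁻ ξ, ‖ξ‖ₑ * hatMag w ξ ≤ ENNReal.ofReal n :=
  (lintegral_mono fun _ => mul_le_mul_left le_add_self _).trans h.lintegral_vel

theorem lintegral_gw_vel_lt_top (h : Slice w W n) {σ : E → ℝ} {M : ℝ}
    (hσM : ∀ ξ, ‖σ ξ‖ ≤ M) (k : Fin 3) : ∫⁻ ξ, (ew (gw σ) ξ * ‖hat (w k) ξ‖ₑ) ^ 2 < ⊤ := by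
  simp only [ew_gw, mul_assoc]
  exact lintegral_ew_lt_top hσM (h.hasGrad k).lintegral_lt_top

theorem lintegral_gw_vel_sq (h : Slice w W n) {σ : E → ℝ} {M : ℝ} (hσ : Measurable σ)
    (hσM : ∀ ξ, ‖σ ξ‖ ≤ M) :
    ∫⁻ ξ, (ew (gw σ) ξ * hatMag w ξ) ^ 2 ≤ ENNReal.ofReal (9 * energy (gw σ) w) :=
  lintegral_hatMag_sq_le (by simp) (measurable_gw hσ) w (h.lintegral_gw_vel_lt_top hσM)

/-- The nonlinear terms of the momentum equation, in terms of trilinear forms. -/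
theorem enorm_pair_vel_le (h : Slice w W n) (σ : E → ℝ) (k : Fin 3) :
    ‖pair σ (hat (w k)) (hat (adv w (w k)))‖ₑ ≤ ENNReal.ofReal (2 * Real.pi) *
      tri (hatMag w) (hatMag w) (fun ξ => ew σ ξ ^ 2 * (‖ξ‖ₑ * hatMag w ξ)) := by
  refine (h.divFree.enorm_pair_adv_le (h.hasGrad k) σ _).trans ?_
  gcongr
  refine tri_mono (fun _ => le_rfl) (enorm_hat_le_hatMag w k) fun ξ => ?_
  gcongr
  exact enorm_hat_le_hatMag w k ξ

theorem enorm_pair_stress_le (h : Slice w W n) (σ : E → ℝ) (k i : Fin 3) :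
    ‖pair σ (hat (w k)) (hat (adv (col W i) (W (k, i))))‖ₑ ≤ ENNReal.ofReal (2 * Real.pi) *
      tri (hatMag W) (hatMag W) (fun ξ => ew σ ξ ^ 2 * (‖ξ‖ₑ * hatMag w ξ)) := by
  refine ((h.divFree_col i).enorm_pair_adv_le (h.hasGrad_deform (k, i)) σ _).trans ?_
  gcongr
  refine tri_mono (hatMag_col_le W i) (enorm_hat_le_hatMag W (k, i)) fun ξ => ?_
  gcongr
  exact enorm_hat_le_hatMag w k ξ

theorem enorm_pair_stretch_le (h : Slice w W n) (σ : E → ℝ) (a : Fin 3 × Fin 3) :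
    ‖pair σ (hat (W a)) (hat (adv (col W a.2) (w a.1)))‖ₑ ≤ ENNReal.ofReal (2 * Real.pi) *
      tri (hatMag W) (fun ξ => ‖ξ‖ₑ * hatMag w ξ) (fun ξ => ew σ ξ ^ 2 * hatMag W ξ) := by
  refine ((h.divFree_col a.2).enorm_pair_adv_le' (h.hasGrad a.1) σ _).trans ?_
  gcongr
  refine tri_mono (hatMag_col_le W a.2) (fun ξ => ?_) fun ξ => ?_ <;> gcongr
  · exact enorm_hat_le_hatMag w _ ξ
  · exact enorm_hat_le_hatMag W _ ξ

theorem enorm_pair_transport_le (h : Slice w W n) {σ : E → ℝ} {M : ℝ} (hσ : Measurable σ)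
    (hσM : ∀ ξ, ‖σ ξ‖ ≤ M) (a : Fin 3 × Fin 3) :
    ‖pair σ (hat (W a)) (hat (adv w (W a)))‖ₑ ≤ ENNReal.ofReal (2 * Real.pi) *
      ∫⁻ ξ, ∫⁻ η, ‖σ ξ - σ η‖ₑ * ‖η‖ₑ * hatMag w (ξ - η) * hatMag W η * (ew σ ξ * hatMag W ξ) := by
  refine (h.divFree.enorm_pair_self_adv_le (h.hasGrad_deform a) hσ hσM).trans ?_
  gcongr <;> exact enorm_hat_le_hatMag W _ _

variable {R : ℝ}

/-- The transport of the velocity by itself: the derivative falls on the third factor and is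
absorbed in the dissipation. -/
theorem tri_vel_le (h : Slice w W n) (k : ℕ) (hR : 0 ≤ R) :
    tri (hatMag w) (hatMag w) (fun ξ => ew (wt k R) ξ ^ 2 * (‖ξ‖ₑ * hatMag w ξ))
      ≤ ENNReal.ofReal (18 * 2 ^ k * (n * (√(energy (wt k R) w) * √(energy (gw (wt k R)) w)))) := by
  have mσ := (continuous_wt k R).measurable
  have mA := measurable_hatMag w
  have me := measurable_ew mσ
  have b1 := lintegral_hatMag_sq_le_of_bounded (by simp) mσ (norm_wt_le k hR) w
  have b2 := h.lintegral_gw_vel_sq mσ (norm_wt_le k hR)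
  simp only [ew_gw, mul_assoc] at b2
  have t1 := tri_le_of_left mA (me.mul mA) (by fun_prop) h.nonneg h.lintegral_vel_one b1 b2
  have t2 := tri_le_of_right (me.mul mA) mA (by fun_prop) h.nonneg b1 h.lintegral_vel_one b2
  refine (tri_wt_le k hR mA mA (by fun_prop)).trans ((mul_le_mul_right (add_le_add t1 t2) _).trans ?_)
  have hn := h.nonneg
  rw [← ENNReal.ofReal_add (by positivity) (by positivity), ← ENNReal.ofReal_mul (by positivity),
    sqrt_nine_mul, sqrt_nine_mul]
  exact ENNReal.ofReal_le_ofReal (le_of_eq (by ring))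

/-- The elastic stress: the derivative falls on the velocity in the third factor, and only the
velocity is dissipated. -/
theorem tri_stress_le (h : Slice w W n) (k : ℕ) (hR : 0 ≤ R) :
    tri (hatMag W) (hatMag W) (fun ξ => ew (wt k R) ξ ^ 2 * (‖ξ‖ₑ * hatMag w ξ))
      ≤ ENNReal.ofReal (18 * 2 ^ k * (n * (√(energy (wt k R) W) * √(energy (gw (wt k R)) w)))) := by
  have mσ := (continuous_wt k R).measurable
  have mA := measurable_hatMag w
  have mB := measurable_hatMag W
  have me := measurable_ew mσ
  have b1 := lintegral_hatMag_sq_le_of_bounded (by simp) mσ (norm_wt_le k hR) W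
  have b2 := h.lintegral_gw_vel_sq mσ (norm_wt_le k hR)
  simp only [ew_gw, mul_assoc] at b2
  have t1 := tri_le_of_left mB (me.mul mB) (by fun_prop) h.nonneg h.lintegral_deform b1 b2
  have t2 := tri_le_of_right (me.mul mB) mB (by fun_prop) h.nonneg b1 h.lintegral_deform b2
  refine (tri_wt_le k hR mB mB (by fun_prop)).trans ((mul_le_mul_right (add_le_add t1 t2) _).trans ?_)
  have hn := h.nonneg
  rw [← ENNReal.ofReal_add (by positivity) (by positivity), ← ENNReal.ofReal_mul (by positivity),
    sqrt_nine_mul, sqrt_nine_mul]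
  exact ENNReal.ofReal_le_ofReal (le_of_eq (by ring))

/-- The stretching term: the derivative falls on the velocity in the second factor. -/
theorem tri_stretch_le (h : Slice w W n) (k : ℕ) (hR : 0 ≤ R) :
    tri (hatMag W) (fun ξ => ‖ξ‖ₑ * hatMag w ξ) (fun ξ => ew (wt k R) ξ ^ 2 * hatMag W ξ)
      ≤ ENNReal.ofReal (9 * 2 ^ k * (n * (√(energy (wt k R) W) *
        (√(energy (wt k R) W) + √(energy (gw (wt k R)) w))))) := by
  have mσ := (continuous_wt k R).measurable
  have mA := measurable_hatMag w
  have mB := measurable_hatMag W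
  have me := measurable_ew mσ
  have b1 := lintegral_hatMag_sq_le_of_bounded (by simp) mσ (norm_wt_le k hR) W
  have b2 := h.lintegral_gw_vel_sq mσ (norm_wt_le k hR)
  simp only [ew_gw, mul_assoc] at b2
  have t1 := tri_le_of_left (h := fun ξ => ew (wt k R) ξ * hatMag W ξ) mB
    (g := fun ξ => ew (wt k R) ξ * (‖ξ‖ₑ * hatMag w ξ)) (by fun_prop) (by fun_prop) h.nonneg
    h.lintegral_deform b2 b1
  have t2 := tri_le_of_right (f := fun ξ => ew (wt k R) ξ * hatMag W ξ)
    (h := fun ξ => ew (wt k R) ξ * hatMag W ξ) (g := fun ξ => ‖ξ‖ₑ * hatMag w ξ)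
    (by fun_prop) (by fun_prop) (by fun_prop) h.nonneg b1 h.lintegral_vel_grad b1
  refine (tri_wt_le k hR mB (by fun_prop) mB).trans ((mul_le_mul_right (add_le_add t1 t2) _).trans ?_)
  have hn := h.nonneg
  rw [← ENNReal.ofReal_add (by positivity) (by positivity), ← ENNReal.ofReal_mul (by positivity),
    sqrt_nine_mul, sqrt_nine_mul]
  exact ENNReal.ofReal_le_ofReal (le_of_eq (by ring))

/-- The transport of the deformation. No derivative of the deformation is dissipated, and it is the
commutator estimate that removes the one which occurs. -/
theorem commutator_le (h : Slice w W n) (k : ℕ) (hR : 0 ≤ R) :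
    ∫⁻ ξ, ∫⁻ η, ‖wt k R ξ - wt k R η‖ₑ * ‖η‖ₑ * hatMag w (ξ - η) * hatMag W η *
        (ew (wt k R) ξ * hatMag W ξ)
      ≤ ENNReal.ofReal (9 * ((k + 4) * 2 ^ k) * (n * (√(energy (wt k R) W) *
        (√(energy (wt k R) W) + √(energy (gw (wt k R)) w))))) := by
  have mσ := (continuous_wt k R).measurable
  have mA := measurable_hatMag w
  have mB := measurable_hatMag W
  have me := measurable_ew mσ
  have mg := measurable_ew (measurable_gw mσ)
  have b1 := lintegral_hatMag_sq_le_of_bounded (by simp) mσ (norm_wt_le k hR) W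
  have b2 := h.lintegral_gw_vel_sq mσ (norm_wt_le k hR)
  have t1 := tri_le_of_left (f := fun ξ => ‖ξ‖ₑ * hatMag w ξ)
    (g := fun ξ => ew (wt k R) ξ * hatMag W ξ) (h := fun ξ => ew (wt k R) ξ * hatMag W ξ)
    (by fun_prop) (by fun_prop) (by fun_prop) h.nonneg h.lintegral_vel_grad b1 b1
  have t2 := tri_le_of_right (f := fun ξ => ew (gw (wt k R)) ξ * hatMag w ξ)
    (h := fun ξ => ew (wt k R) ξ * hatMag W ξ) (g := hatMag W)
    (by fun_prop) mB (by fun_prop) h.nonneg b2 h.lintegral_deform b1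
  refine (lintegral_commutator_le k hR mA mB mB).trans
    ((mul_le_mul_right (add_le_add t1 t2) _).trans ?_)
  have hn := h.nonneg
  rw [← ENNReal.ofReal_add (by positivity) (by positivity), ← ENNReal.ofReal_mul (by positivity),
    sqrt_nine_mul, sqrt_nine_mul]
  exact ENNReal.ofReal_le_ofReal (le_of_eq (by ring))

end Slice

/-! ### Bounds of the nonlinear terms by the dissipation -/

theorem integrableOn_norm_rpow_neg_two :
    IntegrableOn (fun ξ : E => (‖ξ‖ ^ 2)⁻¹) (Metric.ball 0 1) volume := by
  rw [integrableOn_fun_norm_addHaar volume (f := fun y : ℝ => (y ^ 2)⁻¹)]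
  refine IntegrableOn.congr_fun (f := fun _ => (1 : ℝ)) (by simp) (fun y hy => ?_) measurableSet_Ioo
  have : y ≠ 0 := hy.1.ne'
  simp [this]

/-- The integral of `|ξ|⁻²` over the unit ball of `ℝ³`. -/
noncomputable def ballConst : ℝ := ∫ ξ in Metric.ball (0 : E) 1, (‖ξ‖ ^ 2)⁻¹

/-- The weight `|ξ|⁻¹` cut off to the unit ball. -/
noncomputable def ballWeight (ξ : E) : ℝ≥0∞ :=
  (Metric.ball (0 : E) 1).indicator (fun ξ => ENNReal.ofReal ‖ξ‖⁻¹) ξ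

theorem measurable_ballWeight : Measurable ballWeight := by
  unfold ballWeight
  exact Measurable.indicator (by fun_prop) Metric.isOpen_ball.measurableSet

theorem lintegral_ballWeight_sq : ∫⁻ ξ, ballWeight ξ ^ 2 ≤ ENNReal.ofReal ballConst := by
  rw [ballConst, ofReal_integral_eq_lintegral_ofReal integrableOn_norm_rpow_neg_two
    (Eventually.of_forall fun ξ => by positivity),
    ← lintegral_indicator Metric.isOpen_ball.measurableSet]
  refine lintegral_mono fun ξ => ?_
  unfold ballWeight
  by_cases h : ξ ∈ Metric.ball (0 : E) 1
  · simp only [Set.indicator_of_mem h]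
    rw [← ENNReal.ofReal_pow (by positivity), inv_pow]
  · simp [Set.indicator_of_notMem h]

/-- The low frequencies of a function are controlled in `L¹` by its gradient in `L²`. -/
theorem lintegral_ball_le {f : E → ℝ≥0∞} (mf : Measurable f) {x : ℝ}
    (hf : ∫⁻ ξ, (‖ξ‖ₑ * f ξ) ^ 2 ≤ ENNReal.ofReal x) :
    ∫⁻ ξ, (Metric.ball (0 : E) 1).indicator f ξ ≤ ENNReal.ofReal (√ballConst * √x) := by
  refine le_trans (le_of_eq (lintegral_congr_ae ?_)) (lintegral_mul_le_sqrt
    (g := ballWeight) (h := fun ξ => ‖ξ‖ₑ * f ξ) measurable_ballWeight.aemeasurable (by fun_prop)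
    lintegral_ballWeight_sq hf)
  filter_upwards [Measure.ae_ne volume (0 : E)] with ξ h0
  unfold ballWeight
  by_cases h : ξ ∈ Metric.ball (0 : E) 1
  · simp only [Set.indicator_of_mem h]
    rw [← mul_assoc, ← ofReal_norm ξ, ← ENNReal.ofReal_mul (by positivity),
      inv_mul_cancel₀ (norm_ne_zero_iff.2 h0), ENNReal.ofReal_one, one_mul]
  · simp [Set.indicator_of_notMem h]

theorem tri_add_left {f₁ f₂ g h : E → ℝ≥0∞} (m₁ : Measurable f₁)
    (mg : Measurable g) (mh : Measurable h) :
    tri (fun ξ => f₁ ξ + f₂ ξ) g h = tri f₁ g h + tri f₂ g h := by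
  unfold tri
  rw [← lintegral_add_left (by fun_prop)]
  refine lintegral_congr fun ξ => ?_
  rw [← lintegral_add_left (by fun_prop)]
  exact lintegral_congr fun η => by ring

theorem abs_sum_le_of_enorm_le_mul {κ : Type} [Fintype κ] {f : κ → ℝ} {T : ℝ≥0∞} {V : ℝ}
    (hV : 0 ≤ V) (h : ∀ a, ‖f a‖ₑ ≤ ENNReal.ofReal (2 * Real.pi) * T)
    (hT : T ≤ ENNReal.ofReal V) : |∑ a, f a| ≤ Fintype.card κ * (2 * Real.pi * V) := by
  have := Real.pi_pos
  refine abs_sum_le_of_enorm_le (by positivity) fun a => (h a).trans ?_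
  rw [ENNReal.ofReal_mul (p := 2 * Real.pi) (by positivity)]
  exact mul_le_mul_right hT _

/-- A constant for the nonlinear terms with the weights `wt k R`. -/
noncomputable def nlConst (k : ℕ) : ℝ := 1000 * Real.pi * ((k + 4) * 2 ^ k)

theorem nlConst_pos (k : ℕ) : 0 < nlConst k := by
  have := Real.pi_pos
  unfold nlConst; positivity

/-- The contribution of the nonlinear terms to the derivative of the weighted energy. -/
noncomputable def nonlinear (σ : E → ℝ) (w : Fin 3 → E → ℝ) (W : Fin 3 × Fin 3 → E → ℝ) : ℝ :=
  -2 * ∑ k, pair σ (hat (w k)) (hat (adv w (w k)))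
    + 2 * ∑ k, ∑ i, pair σ (hat (w k)) (hat (adv (col W i) (W (k, i))))
    - 2 * ∑ a, pair σ (hat (W a)) (hat (adv w (W a)))
    + 2 * ∑ a, pair σ (hat (W a)) (hat (adv (col W a.2) (w a.1)))

namespace Slice

variable {w : Fin 3 → E → ℝ} {W : Fin 3 × Fin 3 → E → ℝ} {n : ℝ}

/-- Without weight, the transport of the velocity by itself is controlled by the dissipation
alone: the low frequencies of the transporting field are estimated by its gradient. -/
theorem tri_vel_zero_le (h : Slice w W n) (R : ℝ) :
    tri (hatMag w) (hatMag w) (fun ξ => ew (wt 0 R) ξ ^ 2 * (‖ξ‖ₑ * hatMag w ξ))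
      ≤ ENNReal.ofReal ((27 * √ballConst * √(energy (wt 0 R) w) + 9 * n)
          * energy (gw (wt 0 R)) w) := by
  have mA := measurable_hatMag w
  have mσ := (continuous_wt 0 R).measurable
  have hn := h.nonneg
  have he : ∀ ξ, ew (wt 0 R) ξ = 1 := fun ξ => by simp [ew, wt_zero]
  have hσM : ∀ ξ, ‖wt 0 R ξ‖ ≤ 1 := fun ξ => by simp [wt_zero]
  have b1 := lintegral_hatMag_sq_le_of_bounded (by simp) mσ hσM w
  have b2 := h.lintegral_gw_vel_sq mσ hσM
  simp only [ew_gw, he, one_mul] at b1 b2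
  simp only [he, one_pow, one_mul]
  have mB : MeasurableSet (Metric.ball (0 : E) 1) := Metric.isOpen_ball.measurableSet
  have split : hatMag w = fun ξ => (Metric.ball (0 : E) 1).indicator (hatMag w) ξ
      + (Metric.ball (0 : E) 1)ᶜ.indicator (hatMag w) ξ := by
    funext ξ
    exact (congrFun (Set.indicator_self_add_compl (Metric.ball (0 : E) 1) (hatMag w)) ξ).symm
  have m1 := mA.indicator mB
  have m2 := mA.indicator mB.compl
  have b3 : ∫⁻ ξ, (Metric.ball (0 : E) 1)ᶜ.indicator (hatMag w) ξ ^ 2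
      ≤ ENNReal.ofReal (9 * energy (gw (wt 0 R)) w) := by
    refine (lintegral_mono fun ξ => ?_).trans b2
    by_cases hξ : ξ ∈ (Metric.ball (0 : E) 1)ᶜ
    · rw [Set.indicator_of_mem hξ]
      gcongr
      refine le_mul_of_one_le_left zero_le ?_
      rw [← ofReal_norm, ENNReal.one_le_ofReal]
      simpa using hξ
    · simp [Set.indicator_of_notMem hξ]
  have t1 := tri_le_of_left m1 mA (by fun_prop) (by positivity) (lintegral_ball_le mA b2) b1 b2
  have t2 := tri_le_of_right m2 mA (by fun_prop) hn b3 h.lintegral_vel_one b2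
  calc _ = tri (fun ξ => (Metric.ball (0 : E) 1).indicator (hatMag w) ξ
      + (Metric.ball (0 : E) 1)ᶜ.indicator (hatMag w) ξ) (hatMag w)
        (fun ξ => ‖ξ‖ₑ * hatMag w ξ) := by rw [← split]
    _ ≤ _ := by
        rw [tri_add_left m1 mA (by fun_prop)]
        refine (add_le_add t1 t2).trans ?_
        rw [← ENNReal.ofReal_add (by positivity) (by positivity), sqrt_nine_mul, sqrt_nine_mul]
        refine ENNReal.ofReal_le_ofReal (le_of_eq ?_)
        have := Real.mul_self_sqrt (energy_nonneg (gw (wt 0 R)) w)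
        linear_combination (27 * √ballConst * √(energy (wt 0 R) w) + 9 * n) * this

theorem abs_nonlinear_le_of_tri (h : Slice w W n) (k : ℕ) {R : ℝ} (hR : 0 ≤ R) {V : ℝ}
    (hV0 : 0 ≤ V)
    (hV : tri (hatMag w) (hatMag w) (fun ξ => ew (wt k R) ξ ^ 2 * (‖ξ‖ₑ * hatMag w ξ))
      ≤ ENNReal.ofReal V) :
    |nonlinear (wt k R) w W| ≤ 12 * Real.pi * V + nlConst k * n *
      (2 * (√(energy (wt k R) W) * √(energy (gw (wt k R)) w)) + energy (wt k R) W) := by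
  have hn := h.nonneg
  have hpi := Real.pi_pos
  have hk : (0 : ℝ) ≤ k := Nat.cast_nonneg k
  have hY0 := energy_nonneg (wt k R) W
  have mσ := (continuous_wt k R).measurable
  have c1 := abs_sum_le_of_enorm_le_mul hV0 (h.enorm_pair_vel_le (wt k R)) hV
  have c2 := abs_sum_le_of_enorm_le_mul (by positivity)
    (fun a : Fin 3 × Fin 3 => h.enorm_pair_stress_le (wt k R) a.1 a.2) (h.tri_stress_le k hR)
  have c3 := abs_sum_le_of_enorm_le_mul (by positivity)
    (h.enorm_pair_transport_le mσ (norm_wt_le k hR)) (h.commutator_le k hR)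
  have c4 := abs_sum_le_of_enorm_le_mul (by positivity)
    (h.enorm_pair_stretch_le (wt k R)) (h.tri_stretch_le k hR)
  rw [Fintype.sum_prod_type] at c2
  unfold nonlinear nlConst
  rw [mul_add √(energy (wt k R) W), Real.mul_self_sqrt hY0] at c3 c4
  simp only [Fintype.card_fin, Fintype.card_prod, Nat.cast_mul, Nat.cast_ofNat] at c1 c2 c3 c4
  have hS0 : 0 ≤ √(energy (wt k R) W) * √(energy (gw (wt k R)) w) := by positivity
  generalize √(energy (wt k R) W) * √(energy (gw (wt k R)) w) = S at *
  generalize energy (wt k R) W = Y at *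
  generalize ∑ k_1, pair (wt k R) (hat (w k_1)) (hat (adv w (w k_1))) = s1 at *
  generalize ∑ x, ∑ y, pair (wt k R) (hat (w x)) (hat (adv (col W y) (W (x, y)))) = s2 at *
  generalize ∑ a, pair (wt k R) (hat (W a)) (hat (adv w (W a))) = s3 at *
  generalize ∑ a, pair (wt k R) (hat (W a)) (hat (adv (col W a.2) (w a.1))) = s4 at *
  have p1 : 0 ≤ Real.pi * 2 ^ k * n * S := by positivity
  have p2 : 0 ≤ Real.pi * 2 ^ k * n * Y := by positivity
  have p3 : 0 ≤ k * (Real.pi * 2 ^ k * n * S) := by positivity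
  have p4 : 0 ≤ k * (Real.pi * 2 ^ k * n * Y) := by positivity
  have t : |-2 * s1 + 2 * s2 - 2 * s3 + 2 * s4| ≤ 2 * |s1| + 2 * |s2| + 2 * |s3| + 2 * |s4| := by
    have := neg_abs_le s1; have := le_abs_self s1; have := neg_abs_le s2; have := le_abs_self s2
    have := neg_abs_le s3; have := le_abs_self s3; have := neg_abs_le s4; have := le_abs_self s4
    exact abs_le.2 ⟨by linarith, by linarith⟩
  linarith

/-- The nonlinear terms with the weight of order `k`: every product contains either a dissipated
factor or two damped ones. -/
theorem abs_nonlinear_le (h : Slice w W n) (k : ℕ) {R : ℝ} (hR : 0 ≤ R) :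
    |nonlinear (wt k R) w W| ≤ nlConst k * n *
      (√(energy (wt k R) w) * √(energy (gw (wt k R)) w)
        + 2 * (√(energy (wt k R) W) * √(energy (gw (wt k R)) w)) + energy (wt k R) W) := by
  have hn := h.nonneg
  have hpi := Real.pi_pos
  refine (h.abs_nonlinear_le_of_tri k hR (by positivity) (h.tri_vel_le k hR)).trans ?_
  have p1 : 0 ≤ Real.pi * 2 ^ k * n * (√(energy (wt k R) w) * √(energy (gw (wt k R)) w)) := by
    positivity
  have p2 : 0 ≤ k * (Real.pi * 2 ^ k * n * (√(energy (wt k R) w) * √(energy (gw (wt k R)) w))) := by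
    positivity
  unfold nlConst
  nlinarith

/-- The unweighted nonlinear terms are controlled by the dissipation alone. -/
theorem abs_nonlinear_zero_le (h : Slice w W n) {R : ℝ} (hR : 0 ≤ R) :
    |nonlinear (wt 0 R) w W| ≤ (2 * nlConst 0 * n + 1020 * √ballConst * √(energy (wt 0 R) w)) *
      (energy (gw (wt 0 R)) w + energy (wt 0 R) W) := by
  have hn := h.nonneg
  have hpi := Real.pi_pos
  have hD := energy_nonneg (gw (wt 0 R)) w
  have hY := energy_nonneg (wt 0 R) W
  refine (h.abs_nonlinear_le_of_tri 0 hR (by positivity) (h.tri_vel_zero_le R)).trans ?_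
  have hs : 2 * (√(energy (wt 0 R) W) * √(energy (gw (wt 0 R)) w))
      ≤ energy (wt 0 R) W + energy (gw (wt 0 R)) w := by
    have := two_mul_le_add_sq √(energy (wt 0 R) W) √(energy (gw (wt 0 R)) w)
    rw [Real.sq_sqrt hY, Real.sq_sqrt hD] at this
    linarith
  have hc := nlConst_pos 0
  have h2 := mul_le_mul_of_nonneg_left hs (mul_nonneg hc.le hn)
  set Q := √ballConst * √(energy (wt 0 R) w) with hQ
  have hQ0 : 0 ≤ Q := by positivity
  have e1 : 12 * Real.pi * ((27 * √ballConst * √(energy (wt 0 R) w) + 9 * n) *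
      energy (gw (wt 0 R)) w) = 324 * (Real.pi * (Q * energy (gw (wt 0 R)) w))
        + 108 * (Real.pi * n * energy (gw (wt 0 R)) w) := by rw [hQ]; ring
  have hpi4 : Real.pi ≤ 3.1416 := Real.pi_lt_d4.le
  have h3 : Real.pi * (Q * energy (gw (wt 0 R)) w) ≤ 3.1416 * (Q * energy (gw (wt 0 R)) w) := by
    gcongr
  have h4 : 0 ≤ Real.pi * n * energy (gw (wt 0 R)) w := by positivity
  have h5 : 0 ≤ Q * energy (wt 0 R) W := by positivity
  have h6 : 0 ≤ Q * energy (gw (wt 0 R)) w := by positivity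
  have h7 : nlConst 0 = 4000 * Real.pi := by unfold nlConst; norm_num; ring
  have h8 : 0 ≤ Real.pi * n * energy (wt 0 R) W := by positivity
  rw [e1]
  calc _ ≤ 1020 * (Q * (energy (gw (wt 0 R)) w + energy (wt 0 R) W))
        + 2 * nlConst 0 * n * (energy (gw (wt 0 R)) w + energy (wt 0 R) W) := by
        rw [h7] at h2 ⊢
        linarith
    _ = _ := by rw [hQ]; ring

end Slice

/-! ### Weighted energies along solutions -/

section energyBounds

variable {κ : Type} [Fintype κ]

theorem energy_congr {σ : E → ℝ} {w w' : κ → E → ℝ} (h : ∀ a, hat (w a) = hat (w' a)) :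
    energy σ w = energy σ w' := by simp only [energy, h]

theorem energy_wt_le {k : ℕ} {R : ℝ} (hR : 0 ≤ R) (w : κ → E → ℝ) {S : ℝ} (hS : 0 ≤ S)
    (h : ∑ a, ∫⁻ ξ, ENNReal.ofReal (‖ξ‖ ^ (2 * k)) * ‖hat (w a) ξ‖ₑ ^ 2 ≤ ENNReal.ofReal S) :
    energy (wt k R) w ≤ S := by
  rw [← ENNReal.ofReal_le_ofReal_iff hS, ofReal_energy (continuous_wt k R).measurable w fun a =>
    lintegral_ew_lt_top (norm_wt_le k hR) (lintegral_enorm_sq_lt_top _)]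
  refine le_trans (Finset.sum_le_sum fun a _ => lintegral_mono fun ξ => ?_) h
  beta_reduce
  rw [mul_pow, ew_of_nonneg (wt_nonneg k hR ξ), ← ENNReal.ofReal_pow (wt_nonneg k hR ξ),
    mul_comm 2 k, pow_mul]
  gcongr
  · exact wt_nonneg k hR ξ
  · exact wt_le_norm k hR ξ

/-- Removing the truncation of the weight by monotone convergence. -/
theorem sum_lintegral_le_of_energy_le {k : ℕ} {w : κ → E → ℝ} {X : ℝ}
    (h : ∀ R, 0 ≤ R → energy (wt k R) w ≤ X) :
    ∑ a, ∫⁻ ξ, ENNReal.ofReal (‖ξ‖ ^ (2 * k)) * ‖hat (w a) ξ‖ₑ ^ 2 ≤ ENNReal.ofReal X := by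
  have mono : ∀ ξ : E, Monotone fun n : ℕ => wt k n ξ := fun ξ i j hij => by
    have : (i : ℝ) ≤ j := by exact_mod_cast hij
    exact pow_le_pow_left₀ (le_min (norm_nonneg _) (Nat.cast_nonneg i))
      (min_le_min_left _ this) k
  have key : ∀ a, Tendsto (fun n : ℕ => ∫⁻ ξ, (ew (wt k n) ξ * ‖hat (w a) ξ‖ₑ) ^ 2) atTop
      (𝓝 (∫⁻ ξ, ENNReal.ofReal (‖ξ‖ ^ (2 * k)) * ‖hat (w a) ξ‖ₑ ^ 2)) := by
    intro a
    refine lintegral_tendsto_of_tendsto_of_monotone (fun n => ?_)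
      (Eventually.of_forall fun ξ i j hij => ?_) (Eventually.of_forall fun ξ => ?_)
    · have := measurable_ew (continuous_wt k n).measurable
      have := (measurable_coe (hat (w a))).enorm
      fun_prop
    · dsimp only
      rw [ew_of_nonneg (wt_nonneg k (Nat.cast_nonneg i) ξ),
        ew_of_nonneg (wt_nonneg k (Nat.cast_nonneg j) ξ)]
      gcongr
      exact mono ξ hij
    · refine tendsto_const_nhds.congr' ?_
      obtain ⟨N, hN⟩ := exists_nat_ge ‖ξ‖
      filter_upwards [eventually_ge_atTop N] with n hn
      have : ‖ξ‖ ≤ n := hN.trans (by exact_mod_cast hn)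
      rw [ew_of_nonneg (wt_nonneg k (Nat.cast_nonneg n) ξ), wt, min_eq_left this, mul_pow,
        ← ENNReal.ofReal_pow (by positivity), ← pow_mul, mul_comm 2 k]
  refine le_of_tendsto (tendsto_finsetSum _ fun a _ => key a) (Eventually.of_forall fun n => ?_)
  rw [← ofReal_energy (continuous_wt k n).measurable w fun a =>
    lintegral_ew_lt_top (norm_wt_le k (Nat.cast_nonneg n)) (lintegral_enorm_sq_lt_top _)]
  exact ENNReal.ofReal_le_ofReal (h n (Nat.cast_nonneg n))

theorem energy_add_le {σ : E → ℝ} {M : ℝ} (hσ : Measurable σ) (hM : ∀ ξ, ‖σ ξ‖ ≤ M)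
    {w v d : κ → E → ℝ} (h : ∀ a, hat (w a) = hat (v a) + hat (d a)) :
    energy σ w ≤ 2 * energy σ v + 2 * energy σ d := by
  unfold energy
  rw [Finset.mul_sum, Finset.mul_sum, ← Finset.sum_add_distrib]
  refine Finset.sum_le_sum fun a _ => ?_
  rw [h a]
  have hi := fun f : L2C => integrable_pair hσ hM f f
  have e : ∀ (f : L2C) (ξ : E), (conj (f ξ) * f ξ).re = ‖f ξ‖ ^ 2 := fun f ξ => by
    rw [← Complex.normSq_eq_conj_mul_self, Complex.ofReal_re, Complex.normSq_eq_norm_sq]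
  simp only [e] at hi
  rw [pair_self, pair_self, pair_self, ← integral_const_mul, ← integral_const_mul,
    ← integral_add ((hi _).const_mul 2) ((hi _).const_mul 2)]
  refine integral_mono_of_nonneg (Eventually.of_forall fun ξ => by positivity)
    (((hi _).const_mul 2).add ((hi _).const_mul 2)) ?_
  filter_upwards [Lp.coeFn_add (hat (v a)) (hat (d a))] with ξ hξ
  rw [hξ, Pi.add_apply]
  have h1 := norm_add_le (hat (v a) ξ) (hat (d a) ξ)
  have h2 := pow_le_pow_left₀ (norm_nonneg _) h1 2
  have h3 : (‖hat (v a) ξ‖ + ‖hat (d a) ξ‖) ^ 2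
      ≤ 2 * ‖hat (v a) ξ‖ ^ 2 + 2 * ‖hat (d a) ξ‖ ^ 2 := by
    nlinarith [sq_nonneg (‖hat (v a) ξ‖ - ‖hat (d a) ξ‖)]
  nlinarith [mul_le_mul_of_nonneg_left (h2.trans h3) (sq_nonneg (σ ξ))]

theorem energy_wt_le_sobolevNorm {ι : Type} [Fintype ι] {k m : ℕ} (hk : k ≤ m) {w : E → ι → ℝ}
    {S : ℝ} (hS : 0 ≤ S) (h : sobolevNorm m w ≤ ENNReal.ofReal S) {R : ℝ} (hR : 0 ≤ R) :
    energy (wt k R) (fun a x => w x a) ≤ S ^ 2 := by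
  refine energy_wt_le hR _ (by positivity) ((lintegral_pow_hat_le hk
    (h.trans_lt ENNReal.ofReal_lt_top)).trans ?_)
  rw [ENNReal.ofReal_pow hS]
  gcongr

/-- The energies of orders `0` and `m ≥ 3` control the norm in the Wiener algebra, with one derivative. -/
theorem lintegral_hatMag_le {m : ℕ} (hm : 3 ≤ m) {w : κ → E → ℝ} {X : ℝ}
    (h : ∀ R, 0 ≤ R → energy (wt 0 R) w + energy (wt m R) w ≤ X) :
    ∫⁻ ξ, (1 + ‖ξ‖ₑ) * hatMag w ξ
      ≤ ENNReal.ofReal (Fintype.card κ * (√weightConst * √(128 * X))) := by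
  have h0 := sum_lintegral_le_of_energy_le (k := 0) (w := w) (X := X) fun R hR => by
    have := h R hR; have := energy_nonneg (wt m R) w; linarith
  have h1 := sum_lintegral_le_of_energy_le (k := m) (w := w) (X := X) fun R hR => by
    have := h R hR; have := energy_nonneg (wt 0 R) w; linarith
  have hX : 0 ≤ X := by
    have := h 0 le_rfl; have := energy_nonneg (wt 0 0) w; have := energy_nonneg (wt m 0) w
    linarith
  have key : ∀ a, ∫⁻ ξ, (1 + ‖ξ‖ₑ) * ‖hat (w a) ξ‖ₑ
      ≤ ENNReal.ofReal (√weightConst * √(64 * (2 * X))) := fun a => by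
    refine lintegral_hat_le hm _ ?_
    rw [two_mul X, ENNReal.ofReal_add hX hX]
    refine add_le_add (le_trans ?_ h0) (le_trans ?_ h1)
    · simpa using Finset.single_le_sum (f := fun a => ∫⁻ ξ, ‖hat (w a) ξ‖ₑ ^ 2)
        (fun _ _ => zero_le) (Finset.mem_univ a)
    · exact Finset.single_le_sum (f := fun a => ∫⁻ ξ, ENNReal.ofReal (‖ξ‖ ^ (2 * m)) *
        ‖hat (w a) ξ‖ₑ ^ 2) (fun _ _ => zero_le) (Finset.mem_univ a)
  unfold hatMag
  simp only [Finset.mul_sum]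
  rw [lintegral_finsetSum _ fun a _ => by
    have := (measurable_coe (hat (w a))).enorm
    fun_prop]
  refine (Finset.sum_le_sum fun a _ => key a).trans ?_
  rw [Finset.sum_const, nsmul_eq_mul, ENNReal.ofReal_mul (Nat.cast_nonneg _), ENNReal.ofReal_natCast,
    Finset.card_univ]
  refine le_of_eq ?_
  congr 4
  ring

end energyBounds

/-- The weighted energy of order `k` of the velocity and the deformation, with weight `wt k R`. For
`k = 0` the weight is `1`, whatever `R`. -/
noncomputable def total (k : ℕ) (R : ℝ) (u : ℝ → E → Fin 3 → ℝ)
    (F : ℝ → E → Matrix (Fin 3) (Fin 3) ℝ) (t : ℝ) : ℝ :=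
  energy (wt k R) (vel u t) + energy (wt k R) (deform F t)

/-- The constant in the bound of the Wiener algebra norms by Sobolev norms. -/
noncomputable def embConst : ℝ := 1 + 9 * (√weightConst * √128)

theorem embConst_pos : 0 < embConst := by unfold embConst; positivity

namespace IsGlobalSolution

variable {m : ℕ} {μ ν : ℝ} {u : ℝ → E → Fin 3 → ℝ} {F : ℝ → E → Matrix (Fin 3) (Fin 3) ℝ}

theorem memLp_vel (h : IsGlobalSolution m μ ν u F) {t : ℝ} (ht : 0 ≤ t) (k : Fin 3) :
    MemLp (vel u t k) 2 volume :=
  memLp_of_sobolevNorm (h.velocity_mem t ht).1 k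

theorem memLp_deform (h : IsGlobalSolution m μ ν u F) {t : ℝ} (ht : 0 ≤ t) (a : Fin 3 × Fin 3) :
    MemLp (deform F t a) 2 volume :=
  memLp_of_sobolevNorm (h.deformation_mem t ht).1 a

/-- The fixed-time estimates apply along a global solution, with the Wiener norms controlled by the
energy of order `m`. -/
theorem slice (h : IsGlobalSolution m μ ν u F) (hm : 3 ≤ m) {t : ℝ} (ht : 0 ≤ t) {X : ℝ}
    (hX : ∀ R, 0 ≤ R → total 0 R u F t + total m R u F t ≤ X) :
    Slice (vel u t) (deform F t) (embConst * √X) := by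
  have e1 : √weightConst * √(128 * X) = √weightConst * √128 * √X := by
    rw [Real.sqrt_mul (by norm_num), mul_assoc]
  have hX0 := Real.sqrt_nonneg X
  have hw : 0 ≤ √weightConst * √128 * √X := by positivity
  refine ⟨mul_nonneg embConst_pos.le hX0, h.divFree_vel hm ht, h.divFree_col hm ht,
    h.hasGrad_vel hm ht, h.hasGrad_deform hm ht, ?_, ?_⟩
  · refine (lintegral_hatMag_le hm (X := X) fun R hR => ?_).trans (ENNReal.ofReal_le_ofReal ?_)
    · have := hX R hR
      have := energy_nonneg (wt 0 R) (deform F t); have := energy_nonneg (wt m R) (deform F t)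
      unfold total at *
      linarith
    · rw [e1, embConst]
      simp only [Fintype.card_fin, Nat.cast_ofNat]
      linarith
  · refine (lintegral_mono fun ξ => le_mul_of_one_le_left zero_le le_self_add).trans
      ((lintegral_hatMag_le hm (X := X) fun R hR => ?_).trans (ENNReal.ofReal_le_ofReal ?_))
    · have := hX R hR
      have := energy_nonneg (wt 0 R) (vel u t); have := energy_nonneg (wt m R) (vel u t)
      unfold total at *
      linarith
    · rw [e1, embConst]
      simp only [Fintype.card_fin, Fintype.card_prod, Nat.cast_mul, Nat.cast_ofNat]
      linarith

theorem hasDerivAt_total (h : IsGlobalSolution m μ ν u F) (hm : 3 ≤ m) {t : ℝ} (ht : 0 < t)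
    (k : ℕ) {R : ℝ} (hR : 0 ≤ R) :
    HasDerivAt (total k R u F) (-(8 * Real.pi ^ 2 * μ) * energy (gw (wt k R)) (vel u t)
      - 2 * ν * energy (wt k R) (deform F t)
      + nonlinear (wt k R) (vel u t) (deform F t)) t := by
  have mσ := (continuous_wt k R).measurable
  refine ((h.hasDerivAt_energy_vel hm ht mσ (norm_wt_le k hR)).add
    (h.hasDerivAt_energy_deform hm ht mσ (norm_wt_le k hR))).congr_deriv ?_
  unfold nonlinear
  ring

theorem continuousOn_energy_vel (h : IsGlobalSolution m μ ν u F) {σ : E → ℝ} {M : ℝ}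
    (hσ : Measurable σ) (hM : ∀ ξ, ‖σ ξ‖ ≤ M) :
    ContinuousOn (fun t => energy σ (vel u t)) (Set.Ici 0) := fun _ ht =>
  tendsto_finsetSum _ fun k _ => continuousWithinAt_pair hσ hM (h.continuousWithinAt_vel ht k)

theorem continuousOn_total (h : IsGlobalSolution m μ ν u F) (k : ℕ) {R : ℝ} (hR : 0 ≤ R) :
    ContinuousOn (total k R u F) (Set.Ici 0) := fun _ ht =>
  (h.continuousOn_energy_vel (continuous_wt k R).measurable (norm_wt_le k hR) _ ht).add
    (tendsto_finsetSum _ fun a _ => continuousWithinAt_pair (continuous_wt k R).measurable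
      (norm_wt_le k hR) (h.continuousWithinAt_deform ht a))

/-- Continuity of the weighted energies in time, uniformly in the truncation of the weight. -/
theorem eventually_total_le (h : IsGlobalSolution m μ ν u F) {t : ℝ} (ht : 0 ≤ t) {ε : ℝ}
    (hε : 0 < ε) : ∀ᶠ s in 𝓝[Set.Ici 0] t, ∀ k ≤ m, ∀ R, 0 ≤ R →
      total k R u F s ≤ 2 * total k R u F t + ε := by
  have hη : 0 < √(ε / 4) := Real.sqrt_pos.2 (by positivity)
  have hη2 : √(ε / 4) ^ 2 = ε / 4 := Real.sq_sqrt (by positivity)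
  have hE := ENNReal.ofReal_pos.2 hη
  filter_upwards [(h.velocity_mem t ht).2.eventually (gt_mem_nhds hE),
    (h.deformation_mem t ht).2.eventually (gt_mem_nhds hE), self_mem_nhdsWithin] with s h1 h2 hs
  intro k hk R hR
  have mσ := (continuous_wt k R).measurable
  have a1 := energy_wt_le_sobolevNorm hk hη.le h1.le hR
  have a2 := energy_wt_le_sobolevNorm hk hη.le h2.le hR
  have b1 := energy_add_le mσ (norm_wt_le k hR) (w := vel u s) (v := vel u t)
    (d := fun a x => u s x a - u t x a) fun a => by
      rw [← add_sub_cancel (hat (vel u t a)) (hat (vel u s a)),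
        ← hat_sub (h.memLp_vel hs a) (h.memLp_vel ht a)]
      rfl
  have b2 := energy_add_le mσ (norm_wt_le k hR) (w := deform F s) (v := deform F t)
    (d := fun a x => entries (F s) x a - entries (F t) x a) fun a => by
      rw [← add_sub_cancel (hat (deform F t a)) (hat (deform F s a)),
        ← hat_sub (h.memLp_deform hs a) (h.memLp_deform ht a)]
      rfl
  rw [hη2] at a1 a2
  unfold total
  have c1 : energy (wt k R) (fun a x => (fun x => u s x - u t x) x a) = energy (wt k R)
    (fun a x => u s x a - u t x a) := rfl
  have c2 : energy (wt k R) (fun a x => (fun x => entries (F s) x - entries (F t) x) x a)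
    = energy (wt k R) (fun a x => entries (F s) x a - entries (F t) x a) := rfl
  rw [c1] at a1
  rw [c2] at a2
  linarith

end IsGlobalSolution

/-! ### Small data stay small -/

/-- Comparison of energies with pointwise comparable weights. -/
theorem energy_le_add {κ : Type} [Fintype κ] {w : κ → E → ℝ} {σ σ₁ σ₂ : E → ℝ}
    (hσ : Measurable σ) (hσ₁ : Measurable σ₁) (hσ₂ : Measurable σ₂)
    (h₁ : ∀ a, ∫⁻ ξ, (ew σ₁ ξ * ‖hat (w a) ξ‖ₑ) ^ 2 < ⊤)
    (h₂ : ∀ a, ∫⁻ ξ, (ew σ₂ ξ * ‖hat (w a) ξ‖ₑ) ^ 2 < ⊤) {a b : ℝ} (ha : 0 ≤ a) (hb : 0 ≤ b)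
    (h : ∀ ξ, σ ξ ^ 2 ≤ a * σ₁ ξ ^ 2 + b * σ₂ ξ ^ 2) :
    energy σ w ≤ a * energy σ₁ w + b * energy σ₂ w := by
  have e : ∀ (σ : E → ℝ) (ξ : E) (z : ℂ), (ew σ ξ * ‖z‖ₑ) ^ 2
      = ENNReal.ofReal (σ ξ ^ 2) * ‖z‖ₑ ^ 2 := fun σ ξ z => by
    rw [mul_pow, ew, ← enorm_pow, Real.enorm_of_nonneg (sq_nonneg _)]
  have m₁ := measurable_ew hσ₁
  have key : ∀ c, ∫⁻ ξ, (ew σ ξ * ‖hat (w c) ξ‖ₑ) ^ 2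
      ≤ (ENNReal.ofReal a * ∫⁻ ξ, (ew σ₁ ξ * ‖hat (w c) ξ‖ₑ) ^ 2)
        + ENNReal.ofReal b * ∫⁻ ξ, (ew σ₂ ξ * ‖hat (w c) ξ‖ₑ) ^ 2 := fun c => by
    have mc := (measurable_coe (hat (w c))).enorm
    rw [← lintegral_const_mul' _ _ ENNReal.ofReal_ne_top,
      ← lintegral_const_mul' _ _ ENNReal.ofReal_ne_top, ← lintegral_add_left (by fun_prop)]
    refine lintegral_mono fun ξ => ?_
    beta_reduce
    rw [e, e, e, ← mul_assoc, ← mul_assoc, ← add_mul, ← ENNReal.ofReal_mul ha,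
      ← ENNReal.ofReal_mul hb, ← ENNReal.ofReal_add (by positivity) (by positivity)]
    gcongr
    exact h ξ
  have hfin : ∀ c, ∫⁻ ξ, (ew σ ξ * ‖hat (w c) ξ‖ₑ) ^ 2 < ⊤ := fun c => (key c).trans_lt
    (ENNReal.add_lt_top.2 ⟨ENNReal.mul_lt_top ENNReal.ofReal_lt_top (h₁ c),
      ENNReal.mul_lt_top ENNReal.ofReal_lt_top (h₂ c)⟩)
  have n₁ := energy_nonneg σ₁ w
  have n₂ := energy_nonneg σ₂ w
  rw [← ENNReal.ofReal_le_ofReal_iff (by positivity), ENNReal.ofReal_add (by positivity)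
    (by positivity), ENNReal.ofReal_mul ha, ENNReal.ofReal_mul hb, ofReal_energy hσ w hfin,
    ofReal_energy hσ₁ w h₁, ofReal_energy hσ₂ w h₂, Finset.mul_sum, Finset.mul_sum,
    ← Finset.sum_add_distrib]
  exact Finset.sum_le_sum fun c _ => key c

/-- The rate at which the linear part of the system dissipates energy. -/
noncomputable def dampConst (μ ν : ℝ) : ℝ := min (8 * Real.pi ^ 2 * μ) (2 * ν)

theorem dampConst_pos {μ ν : ℝ} (hμ : 0 < μ) (hν : 0 < ν) : 0 < dampConst μ ν :=
  lt_min (by have := Real.pi_pos; positivity) (by positivity)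

/-- A constant for the nonlinear terms in the energy balance of order `m`. -/
noncomputable def balanceConst (m : ℕ) : ℝ :=
  2 * nlConst 0 * embConst + 1020 * √ballConst + 2 * nlConst m * embConst

theorem balanceConst_pos (m : ℕ) : 0 < balanceConst m := by
  have := nlConst_pos 0
  have := nlConst_pos m
  have := embConst_pos
  unfold balanceConst
  positivity

theorem two_mul_sqrt_mul_sqrt_le {x y : ℝ} (hx : 0 ≤ x) (hy : 0 ≤ y) :
    2 * (√x * √y) ≤ x + y := by
  have := two_mul_le_add_sq √x √y
  rw [Real.sq_sqrt hx, Real.sq_sqrt hy] at this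
  linarith

/-- For `m ≥ 1` the energy of order `m` is controlled by the dissipation of orders `0` and `m`. -/
theorem Slice.energy_le_dissip {w : Fin 3 → E → ℝ} {W : Fin 3 × Fin 3 → E → ℝ} {n : ℝ}
    (h : Slice w W n) {m : ℕ} (hm : 1 ≤ m) {R : ℝ} (hR : 0 ≤ R) :
    energy (wt m R) w ≤ energy (gw (wt 0 R)) w + energy (gw (wt m R)) w := by
  have m0 := (continuous_wt 0 R).measurable
  have m1 := (continuous_wt m R).measurable
  have := energy_le_add m1 (measurable_gw m0) (measurable_gw m1)
    (h.lintegral_gw_vel_lt_top (norm_wt_le 0 hR)) (h.lintegral_gw_vel_lt_top (norm_wt_le m hR))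
    zero_le_one zero_le_one (fun ξ => ?_)
  · linarith
  · unfold gw
    rw [wt_zero, one_mul, one_mul, one_mul]
    rcases le_total ‖ξ‖ 1 with h1 | h1
    · have h2 : wt m R ξ ≤ ‖ξ‖ := (wt_le_norm m hR ξ).trans (by
        simpa using pow_le_pow_of_le_one (norm_nonneg ξ) h1 hm)
      have h3 := pow_le_pow_left₀ (wt_nonneg m hR ξ) h2 2
      have := sq_nonneg (wt m R ξ * ‖ξ‖)
      linarith
    · have h2 : wt m R ξ ≤ wt m R ξ * ‖ξ‖ := le_mul_of_one_le_right (wt_nonneg m hR ξ) h1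
      have h3 := pow_le_pow_left₀ (wt_nonneg m hR ξ) h2 2
      have := sq_nonneg ‖ξ‖
      linarith

namespace IsGlobalSolution

variable {m : ℕ} {μ ν : ℝ} {u : ℝ → E → Fin 3 → ℝ} {F : ℝ → E → Matrix (Fin 3) (Fin 3) ℝ}

/-- The energy balance of order `m` as long as the energy is small: the nonlinear terms are
absorbed by the dissipation and the damping. -/
theorem exists_hasDerivAt_le (h : IsGlobalSolution m μ ν u F) (hm : 3 ≤ m) {t : ℝ} (ht : 0 < t)
    {X : ℝ} (hX : ∀ R, 0 ≤ R → total 0 R u F t + total m R u F t ≤ X)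
    (hs : balanceConst m * √X ≤ dampConst μ ν / 2) {R : ℝ} (hR : 0 ≤ R) :
    ∃ V, HasDerivAt (fun s => total 0 R u F s + total m R u F s) V t ∧
      V ≤ -(dampConst μ ν / 2) * (energy (gw (wt 0 R)) (vel u t) + energy (gw (wt m R)) (vel u t)
        + energy (wt 0 R) (deform F t) + energy (wt m R) (deform F t)) := by
  have hs0 := h.slice hm ht.le hX
  refine ⟨_, (h.hasDerivAt_total hm ht 0 hR).add (h.hasDerivAt_total hm ht m hR), ?_⟩
  have n0 := (abs_le.1 (hs0.abs_nonlinear_zero_le hR)).2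
  have nm := (abs_le.1 (hs0.abs_nonlinear_le m hR)).2
  have hXm := hs0.energy_le_dissip (show 1 ≤ m by omega) hR
  have p1 := energy_nonneg (wt m R) (vel u t)
  have p2 := energy_nonneg (gw (wt m R)) (vel u t)
  have p3 := energy_nonneg (gw (wt 0 R)) (vel u t)
  have p4 := energy_nonneg (wt m R) (deform F t)
  have p5 := energy_nonneg (wt 0 R) (deform F t)
  have q1 := two_mul_sqrt_mul_sqrt_le p1 p2
  have q2 := two_mul_sqrt_mul_sqrt_le p4 p2
  have hx : √(energy (wt 0 R) (vel u t)) ≤ √X := by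
    refine Real.sqrt_le_sqrt ((?_ : _ ≤ _).trans (hX R hR))
    unfold total
    linarith
  have c0 := nlConst_pos 0
  have cm := nlConst_pos m
  have ce := embConst_pos
  have cb := Real.sqrt_nonneg ballConst
  have hX0 := Real.sqrt_nonneg X
  have hd1 : dampConst μ ν ≤ 8 * Real.pi ^ 2 * μ := min_le_left _ _
  have hd2 : dampConst μ ν ≤ 2 * ν := min_le_right _ _
  set D0 := energy (gw (wt 0 R)) (vel u t)
  set Dm := energy (gw (wt m R)) (vel u t)
  set Y0 := energy (wt 0 R) (deform F t)
  set Ym := energy (wt m R) (deform F t)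
  set S := D0 + Dm + Y0 + Ym with hS
  have n0' : nonlinear (wt 0 R) (vel u t) (deform F t)
      ≤ (2 * nlConst 0 * embConst + 1020 * √ballConst) * √X * S := by
    refine n0.trans ?_
    calc _ ≤ (2 * nlConst 0 * (embConst * √X) + 1020 * √ballConst * √X) * (D0 + Y0) := by gcongr
      _ = (2 * nlConst 0 * embConst + 1020 * √ballConst) * √X * (D0 + Y0) := by ring
      _ ≤ _ := by gcongr; linarith
  have nm' : nonlinear (wt m R) (vel u t) (deform F t) ≤ 2 * nlConst m * embConst * √X * S := by
    refine nm.trans ?_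
    calc _ ≤ nlConst m * (embConst * √X) * (2 * S) := by gcongr; linarith
      _ = _ := by ring
  have hb : (2 * nlConst 0 * embConst + 1020 * √ballConst) * √X * S
      + 2 * nlConst m * embConst * √X * S ≤ dampConst μ ν / 2 * S := by
    have := mul_le_mul_of_nonneg_right hs (show 0 ≤ S by positivity)
    unfold balanceConst at this
    linarith
  have r1 := mul_le_mul_of_nonneg_right hd1 (add_nonneg p3 p2)
  have r2 := mul_le_mul_of_nonneg_right hd2 (add_nonneg p5 p4)
  rw [hS] at *
  linarith

theorem continuousOn_total_add (h : IsGlobalSolution m μ ν u F) {R : ℝ} (hR : 0 ≤ R) :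
    ContinuousOn (fun s => total 0 R u F s + total m R u F s) (Set.Ici 0) :=
  (h.continuousOn_total 0 hR).add (h.continuousOn_total m hR)

/-- Small data stay small: the energy of order `m` never exceeds a bound for its initial value. This is
a continuity argument: where the energy is at most `e` it stays below `4e` for a short time, uniformly
in the truncation, and there it is nonincreasing. -/
theorem total_le (h : IsGlobalSolution m μ ν u F) (hm : 3 ≤ m) (hμ : 0 < μ) (hν : 0 < ν) {e : ℝ}
    (he : 0 < e) (hsm : balanceConst m * √(4 * e) ≤ dampConst μ ν / 2)
    (h0 : ∀ R, 0 ≤ R → total 0 R u F 0 + total m R u F 0 ≤ e) {t : ℝ} (ht : 0 ≤ t) {R : ℝ}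
    (hR : 0 ≤ R) : total 0 R u F t + total m R u F t ≤ e := by
  have hc := dampConst_pos hμ hν
  set S : Set ℝ := {s | ∀ R, 0 ≤ R → total 0 R u F s + total m R u F s ≤ e} with hS
  suffices Set.Icc 0 t ⊆ S from this ⟨ht, le_rfl⟩ R hR
  refine IsClosed.Icc_subset_of_forall_exists_gt ?_ h0 ?_
  · have : S ∩ Set.Icc 0 t = ⋂ R : Set.Ici (0 : ℝ), Set.Icc 0 t ∩
        (fun s => total 0 R u F s + total m R u F s) ⁻¹' Set.Iic e := by
      ext s
      simp only [hS, Set.mem_inter_iff, Set.mem_ofPred_eq, Set.mem_iInter, Set.mem_preimage,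
        Set.mem_Iic, Subtype.forall, Set.mem_Ici]
      exact ⟨fun h R hR => ⟨h.2, h.1 R hR⟩, fun h => ⟨fun R hR => (h R hR).2, (h 0 le_rfl).1⟩⟩
    rw [this]
    exact isClosed_iInter fun R => ((h.continuousOn_total_add R.2).mono
      Set.Icc_subset_Ici_self).preimage_isClosed_of_isClosed isClosed_Icc isClosed_Iic
  · rintro x ⟨hxS, hx⟩ y (hy : x < y)
    have hev := h.eventually_total_le hx.1 he
    rw [Metric.nhdsWithin_basis_ball.eventually_iff] at hev
    obtain ⟨η, hη, hev⟩ := hev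
    have hbd : ∀ s, x ≤ s → s < x + η → ∀ R, 0 ≤ R →
        total 0 R u F s + total m R u F s ≤ 4 * e := fun s h1 h2 R hR => by
      have hd : dist s x < η := by rw [Real.dist_eq, abs_of_nonneg (by linarith)]; linarith
      have a0 := hev ⟨hd, hx.1.trans h1⟩ 0 (Nat.zero_le m) R hR
      have am := hev ⟨hd, hx.1.trans h1⟩ m le_rfl R hR
      have := hxS R hR
      linarith
    refine ⟨min y (x + η / 2), fun R hR => ?_, lt_min hy (by linarith), min_le_left _ _⟩
    refine le_trans ?_ (hxS R hR)
    have anti : AntitoneOn (fun s => total 0 R u F s + total m R u F s)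
        (Set.Icc x (x + η / 2)) := by
      refine antitoneOn_of_deriv_nonpos (convex_Icc _ _) ((h.continuousOn_total_add hR).mono
        fun s hs => hx.1.trans hs.1) (fun s hs => ?_) fun s hs => ?_ <;>
      · rw [interior_Icc] at hs
        obtain ⟨V, hV, hV'⟩ := h.exists_hasDerivAt_le hm (hx.1.trans_lt hs.1)
          (hbd s hs.1.le (by linarith [hs.2])) hsm hR
        first
        | exact hV.differentiableAt.differentiableWithinAt
        | rw [hV.deriv]
          refine hV'.trans (mul_nonpos_of_nonpos_of_nonneg (by linarith) ?_)
          have := energy_nonneg (gw (wt 0 R)) (vel u s)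
          have := energy_nonneg (gw (wt m R)) (vel u s)
          have := energy_nonneg (wt 0 R) (deform F s)
          have := energy_nonneg (wt m R) (deform F s)
          positivity
    exact anti ⟨le_rfl, by linarith⟩ ⟨le_min hy.le (by linarith), min_le_right _ _⟩
      (le_min hy.le (by linarith))

end IsGlobalSolution

/-! ### Differential inequalities -/

/-- Growth of a nonnegative quantity whose derivative is controlled by its square root. -/
theorem sqrt_le_of_deriv_le {y y' φ φ' : ℝ → ℝ} {T : ℝ} (hT : 0 ≤ T)
    (hy : ContinuousOn y (Set.Icc 0 T)) (hy0 : ∀ t ∈ Set.Icc 0 T, 0 ≤ y t)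
    (hφ : ContinuousOn φ (Set.Icc 0 T))
    (hd : ∀ t ∈ Set.Ioo 0 T, HasDerivAt y (y' t) t)
    (hφd : ∀ t ∈ Set.Ioo 0 T, HasDerivAt φ (φ' t) t) (hφ0 : ∀ t ∈ Set.Ioo 0 T, 0 ≤ φ' t)
    (h : ∀ t ∈ Set.Ioo 0 T, y' t ≤ 2 * φ' t * √(y t)) :
    √(y T) ≤ √(y 0) + (φ T - φ 0) := by
  refine le_of_forall_pos_le_add fun ε hε => ?_
  have anti : AntitoneOn (fun t => √(y t + ε ^ 2) - φ t) (Set.Icc 0 T) := by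
    have hder : ∀ t ∈ Set.Ioo 0 T, HasDerivAt (fun t => √(y t + ε ^ 2) - φ t)
        (y' t / (2 * √(y t + ε ^ 2)) - φ' t) t := fun t ht => by
      have hp : 0 < y t + ε ^ 2 := by
        have := hy0 t (Set.Ioo_subset_Icc_self ht); positivity
      exact (((hd t ht).add_const _).sqrt hp.ne').sub (hφd t ht)
    refine antitoneOn_of_deriv_nonpos (convex_Icc _ _)
      (((hy.add continuousOn_const).sqrt).sub hφ) (fun t ht => ?_) fun t ht => ?_
    all_goals rw [interior_Icc] at ht
    · exact (hder t ht).differentiableAt.differentiableWithinAt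
    · rw [(hder t ht).deriv, sub_nonpos]
      have h0 := hy0 t (Set.Ioo_subset_Icc_self ht)
      have hp : 0 < √(y t + ε ^ 2) := Real.sqrt_pos.2 (by positivity)
      rw [div_le_iff₀ (by positivity)]
      refine (h t ht).trans ?_
      have : √(y t) ≤ √(y t + ε ^ 2) := Real.sqrt_le_sqrt (by nlinarith)
      nlinarith [mul_le_mul_of_nonneg_left this (hφ0 t ht)]
  have h1 := anti ⟨le_rfl, hT⟩ ⟨hT, le_rfl⟩ hT
  have h2 : √(y T) ≤ √(y T + ε ^ 2) := Real.sqrt_le_sqrt (by nlinarith)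
  have h3 : √(y 0 + ε ^ 2) ≤ √(y 0) + ε := by
    refine Real.sqrt_le_iff.2 ⟨by positivity, ?_⟩
    have := Real.sq_sqrt (hy0 0 ⟨le_rfl, hT⟩)
    nlinarith [mul_nonneg (Real.sqrt_nonneg (y 0)) hε.le]
  dsimp only at h1
  linarith

/-- Polynomial decay from a differential inequality with the damping rate `(b + 1) / (1 + t)`. -/
theorem le_rpow_of_deriv_le {f f' : ℝ → ℝ} {b B T : ℝ} (hT : 0 ≤ T) (hb : 0 ≤ b) (hB : 0 ≤ B)
    (hf : ContinuousOn f (Set.Ici T)) (hf0 : 0 ≤ f T) (hd : ∀ t, T < t → HasDerivAt f (f' t) t)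
    (h : ∀ t, T < t → f' t ≤ -((b + 1) / (1 + t)) * f t + B * (1 + t) ^ (-1 - b)) {t : ℝ}
    (ht : T ≤ t) : f t ≤ ((1 + T) ^ (b + 1) * f T + B) * (1 + t) ^ (-b) := by
  have hder : ∀ s, T < s → HasDerivAt (fun s => (1 + s) ^ (b + 1) * f s - B * s)
      (((b + 1) * (1 + s) ^ b) * f s + (1 + s) ^ (b + 1) * f' s - B) s := fun s hs => by
    have h1 : HasDerivAt (fun s : ℝ => (1 + s) ^ (b + 1)) ((b + 1) * (1 + s) ^ b) s := by
      have := ((hasDerivAt_id s).const_add 1).rpow_const (p := b + 1)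
        (Or.inl (show (1 + id s : ℝ) ≠ 0 by simp; linarith))
      simpa using this
    exact ((h1.mul (hd s hs)).sub ((hasDerivAt_id s).const_mul B)).congr_deriv (by ring)
  have anti : AntitoneOn (fun s => (1 + s) ^ (b + 1) * f s - B * s) (Set.Ici T) := by
    refine antitoneOn_of_deriv_nonpos (convex_Ici _) ?_ (fun s hs => ?_) fun s hs => ?_
    · refine ContinuousOn.sub (ContinuousOn.mul ?_ hf) (by fun_prop)
      exact ContinuousOn.rpow_const (by fun_prop) fun s hs => Or.inr (by linarith)
    all_goals rw [interior_Ici] at hs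
    · exact (hder s hs).differentiableAt.differentiableWithinAt
    · rw [(hder s hs).deriv]
      have hp : 0 < 1 + s := by have : T < s := hs; linarith
      have e1 : (1 + s) ^ (b + 1) * (1 + s) ^ (-1 - b) = 1 := by
        rw [← Real.rpow_add hp, show b + 1 + (-1 - b) = 0 by ring, Real.rpow_zero]
      have e2 : (1 + s) ^ (b + 1) = (1 + s) ^ b * (1 + s) := by
        rw [Real.rpow_add hp, Real.rpow_one]
      have h1 := mul_le_mul_of_nonneg_left (h s hs) (Real.rpow_nonneg hp.le (b + 1))
      have h2 : (1 + s) ^ (b + 1) * (-((b + 1) / (1 + s)) * f s)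
          = -((b + 1) * (1 + s) ^ b * f s) := by
        rw [e2]; field_simp
      have h3 : (1 + s) ^ (b + 1) * (B * (1 + s) ^ (-1 - b)) = B := by
        rw [mul_left_comm, e1, mul_one]
      rw [mul_add, h2, h3] at h1
      linarith
  have h1 := anti (Set.self_mem_Ici) ht ht
  dsimp only at h1
  have hp : 0 < 1 + t := by linarith
  have hp1 : 1 ≤ 1 + t := by linarith
  have hA : 0 ≤ (1 + T) ^ (b + 1) * f T := mul_nonneg (Real.rpow_nonneg (by linarith) _) hf0
  have h2 : (1 + t) ^ (b + 1) * f t ≤ ((1 + T) ^ (b + 1) * f T + B) * (1 + t) := by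
    nlinarith
  have e2 : (1 + t) ^ (b + 1) = (1 + t) ^ b * (1 + t) := by
    rw [Real.rpow_add hp, Real.rpow_one]
  have h3 : (1 + t) ^ b * f t ≤ (1 + T) ^ (b + 1) * f T + B := by
    rw [e2] at h2
    refine le_of_mul_le_mul_right ?_ hp
    linarith
  rw [Real.rpow_neg hp.le, ← div_eq_mul_inv, le_div_iff₀ (Real.rpow_pos_of_pos hp b)]
  linarith

/-- Grönwall's inequality for a linear differential inequality. -/
theorem le_exp_of_deriv_le {f f' : ℝ → ℝ} {B : ℝ} (hf : ContinuousOn f (Set.Ici 0))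
    (hd : ∀ t, 0 < t → HasDerivAt f (f' t) t) (h : ∀ t, 0 < t → f' t ≤ B * f t) {t : ℝ}
    (ht : 0 ≤ t) : f t ≤ Real.exp (B * t) * f 0 := by
  have hder : ∀ s, 0 < s → HasDerivAt (fun s => Real.exp (-(B * s)) * f s)
      (Real.exp (-(B * s)) * (f' s - B * f s)) s := fun s hs => by
    have h1 : HasDerivAt (fun s : ℝ => Real.exp (-(B * s))) (Real.exp (-(B * s)) * (-B)) s := by
      have := (((hasDerivAt_id s).const_mul B).neg).exp
      simpa using this
    exact (h1.mul (hd s hs)).congr_deriv (by ring)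
  have anti : AntitoneOn (fun s => Real.exp (-(B * s)) * f s) (Set.Ici 0) := by
    refine antitoneOn_of_deriv_nonpos (convex_Ici _) (by fun_prop) (fun s hs => ?_) fun s hs => ?_
    all_goals rw [interior_Ici] at hs
    · exact (hder s hs).differentiableAt.differentiableWithinAt
    · rw [(hder s hs).deriv]
      exact mul_nonpos_of_nonneg_of_nonpos (Real.exp_pos _).le (by linarith [h s hs])
  have h1 := anti Set.self_mem_Ici ht ht
  simp only [mul_zero, neg_zero, Real.exp_zero, one_mul, Real.exp_neg] at h1
  rwa [inv_mul_le_iff₀ (Real.exp_pos _)] at h1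

/-! ### Low frequencies -/

/-- The indicator function of the frequencies below `ρ`. -/
noncomputable def lowPass (ρ : ℝ) : E → ℝ := (Metric.ball (0 : E) ρ).indicator 1

theorem measurable_lowPass (ρ : ℝ) : Measurable (lowPass ρ) :=
  measurable_one.indicator Metric.isOpen_ball.measurableSet

theorem lowPass_of_lt {ρ : ℝ} {ξ : E} (h : ‖ξ‖ < ρ) : lowPass ρ ξ = 1 :=
  Set.indicator_of_mem (by simpa using h) _

theorem lowPass_of_le {ρ : ℝ} {ξ : E} (h : ρ ≤ ‖ξ‖) : lowPass ρ ξ = 0 :=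
  Set.indicator_of_notMem (by simpa using h) _

theorem norm_lowPass_le (ρ : ℝ) (ξ : E) : ‖lowPass ρ ξ‖ ≤ 1 := by
  rcases lt_or_ge ‖ξ‖ ρ with h | h
  · simp [lowPass_of_lt h]
  · simp [lowPass_of_le h]

/-- The volume of the unit ball. -/
noncomputable def ballVolume : ℝ := (volume (Metric.ball (0 : E) 1)).toReal

theorem volume_ball {ρ : ℝ} (hρ : 0 ≤ ρ) :
    volume (Metric.ball (0 : E) ρ) = ENNReal.ofReal (ρ ^ 3 * ballVolume) := by
  rw [Measure.addHaar_ball _ _ hρ, ENNReal.ofReal_mul (by positivity), ballVolume,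
    ENNReal.ofReal_toReal measure_ball_lt_top.ne]
  simp

theorem ballVolume_nonneg : 0 ≤ ballVolume := ENNReal.toReal_nonneg

theorem lintegral_ew_lowPass {ρ : ℝ} (hρ : 0 ≤ ρ) :
    ∫⁻ ξ, ew (lowPass ρ) ξ ^ 2 = ENNReal.ofReal (ρ ^ 3 * ballVolume) := by
  rw [← volume_ball hρ, ← lintegral_indicator_one Metric.isOpen_ball.measurableSet]
  refine lintegral_congr fun ξ => ?_
  rcases lt_or_ge ‖ξ‖ ρ with h | h
  · rw [ew, lowPass_of_lt h, Set.indicator_of_mem (by simpa using h)]; simp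
  · rw [ew, lowPass_of_le h, Set.indicator_of_notMem (by simpa using h)]; simp

/-- The trilinear form with the last factor in `L¹`. -/
theorem tri_le_of_lintegral {f g h : E → ℝ≥0∞} (mf : Measurable f) (mg : Measurable g)
    {x y z : ℝ} (hf : ∫⁻ ξ, f ξ ^ 2 ≤ ENNReal.ofReal x)
    (hg : ∫⁻ ξ, g ξ ^ 2 ≤ ENNReal.ofReal y) (hh : ∫⁻ ξ, h ξ ≤ ENNReal.ofReal z) :
    tri f g h ≤ ENNReal.ofReal (√x * √y * z) := by
  rw [ENNReal.ofReal_mul (by positivity)]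
  calc tri f g h = ∫⁻ ξ, (∫⁻ η, f (ξ - η) * g η) * h ξ := by
        refine lintegral_congr fun ξ => ?_
        rw [lintegral_mul_const _ (by fun_prop)]
    _ ≤ ∫⁻ ξ, ENNReal.ofReal (√x * √y) * h ξ := by
        gcongr with ξ
        refine lintegral_mul_le_sqrt (by fun_prop) mg.aemeasurable ?_ hg
        rwa [lintegral_sub_left_eq_self (fun η => f η ^ 2) ξ]
    _ ≤ _ := by
        rw [lintegral_const_mul' _ _ ENNReal.ofReal_ne_top]
        gcongr

theorem lintegral_lowPass_le {ρ : ℝ} (hρ : 0 ≤ ρ) (w : Fin 3 → E → ℝ) :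
    ∫⁻ ξ, ew (lowPass ρ) ξ ^ 2 * (‖ξ‖ₑ * hatMag w ξ)
      ≤ ENNReal.ofReal (ρ * (√(ρ ^ 3 * ballVolume) * √(9 * energy (lowPass ρ) w))) := by
  have me := measurable_ew (measurable_lowPass ρ)
  have mA := measurable_hatMag w
  have b := lintegral_hatMag_sq_le_of_bounded (by simp) (measurable_lowPass ρ)
    (norm_lowPass_le ρ) w
  rw [ENNReal.ofReal_mul hρ]
  refine le_trans ?_ (mul_le_mul_right (lintegral_mul_le_sqrt me.aemeasurable
    (me.mul mA).aemeasurable (lintegral_ew_lowPass hρ).le b) _)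
  rw [← lintegral_const_mul' _ _ ENNReal.ofReal_ne_top]
  refine lintegral_mono fun ξ => ?_
  rcases lt_or_ge ‖ξ‖ ρ with h | h
  · have : ‖ξ‖ₑ ≤ ENNReal.ofReal ρ := by
      rw [← ofReal_norm]; exact ENNReal.ofReal_le_ofReal h.le
    calc _ = ‖ξ‖ₑ * (ew (lowPass ρ) ξ * (ew (lowPass ρ) ξ * hatMag w ξ)) := by ring
      _ ≤ _ := mul_le_mul_left this _
  · simp [ew, lowPass_of_le h]

/-- The energy splits into a dissipated part at high frequencies and a low-frequency part. -/
theorem Slice.energy_le_dissip_add_low {w : Fin 3 → E → ℝ} {W : Fin 3 × Fin 3 → E → ℝ} {n : ℝ}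
    (h : Slice w W n) (k : ℕ) {R ρ : ℝ} (hR : 0 ≤ R) (hρ : 0 < ρ) :
    ρ ^ 2 * energy (wt k R) w
      ≤ energy (gw (wt k R)) w + ρ ^ 2 * ρ ^ (2 * k) * energy (lowPass ρ) w := by
  have m1 := (continuous_wt k R).measurable
  have := energy_le_add m1 (measurable_gw m1) (measurable_lowPass ρ)
    (h.lintegral_gw_vel_lt_top (norm_wt_le k hR))
    (fun a => lintegral_ew_lt_top (norm_lowPass_le ρ) (lintegral_enorm_sq_lt_top _))
    (a := (ρ ^ 2)⁻¹) (b := ρ ^ (2 * k)) (by positivity) (by positivity) (fun ξ => ?_)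
  · calc _ ≤ ρ ^ 2 * _ := mul_le_mul_of_nonneg_left this (by positivity)
      _ = _ := by field_simp
  · unfold gw
    have h0 := wt_nonneg k hR ξ
    rcases lt_or_ge ‖ξ‖ ρ with h1 | h1
    · rw [lowPass_of_lt h1]
      have h2 : wt k R ξ ≤ ρ ^ k :=
        (wt_le_norm k hR ξ).trans (pow_le_pow_left₀ (norm_nonneg _) h1.le k)
      have h3 := pow_le_pow_left₀ h0 h2 2
      rw [← pow_mul, mul_comm k 2] at h3
      have : 0 ≤ (ρ ^ 2)⁻¹ * (wt k R ξ * ‖ξ‖) ^ 2 := by positivity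
      linarith
    · rw [lowPass_of_le h1, mul_pow, mul_left_comm]
      have h2 : 1 ≤ (ρ ^ 2)⁻¹ * ‖ξ‖ ^ 2 := by
        rw [inv_mul_eq_div, one_le_div (by positivity)]
        gcongr
      have := mul_le_mul_of_nonneg_left h2 (sq_nonneg (wt k R ξ))
      linarith

/-- A constant for the growth of the low frequencies. -/
noncomputable def lowConst : ℝ := 486 * Real.pi * √ballVolume

theorem lowConst_nonneg : 0 ≤ lowConst := by
  have := Real.pi_pos
  unfold lowConst; positivity

/-- The initial low-frequency energy of a field whose Fourier transform is bounded. -/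
theorem energy_lowPass_le {w : Fin 3 → E → ℝ} {ρ d : ℝ} (hρ : 0 ≤ ρ) (hd : 0 ≤ d)
    (h : ∀ k, ∀ᵐ ξ, ‖hat (w k) ξ‖ ≤ d) :
    energy (lowPass ρ) w ≤ 3 * (ρ ^ 3 * ballVolume * d ^ 2) := by
  have hV := ballVolume_nonneg
  rw [← ENNReal.ofReal_le_ofReal_iff (by positivity), ofReal_energy (measurable_lowPass ρ) w fun a =>
    lintegral_ew_lt_top (norm_lowPass_le ρ) (lintegral_enorm_sq_lt_top _)]
  have key : ∀ k, ∫⁻ ξ, (ew (lowPass ρ) ξ * ‖hat (w k) ξ‖ₑ) ^ 2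
      ≤ ENNReal.ofReal (ρ ^ 3 * ballVolume * d ^ 2) := fun k => by
    rw [ENNReal.ofReal_mul (by positivity), ← lintegral_ew_lowPass hρ,
      ← lintegral_mul_const' _ _ ENNReal.ofReal_ne_top]
    refine lintegral_mono_ae ?_
    filter_upwards [h k] with ξ hξ
    rw [mul_pow, ENNReal.ofReal_pow hd, ← ofReal_norm (hat (w k) ξ)]
    gcongr
  refine (Finset.sum_le_sum fun k _ => key k).trans ?_
  rw [Finset.sum_const, nsmul_eq_mul, ENNReal.ofReal_mul (p := 3) (by norm_num)]
  simp

namespace IsGlobalSolution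

variable {m : ℕ} {μ ν : ℝ} {u : ℝ → E → Fin 3 → ℝ} {F : ℝ → E → Matrix (Fin 3) (Fin 3) ℝ}

/-- The growth of the low-frequency kinetic energy. The divergence form of the nonlinearity gives
the factor `ρ`, and the volume of the ball of radius `ρ` the factor `ρ^(3/2)`. -/
theorem exists_hasDerivAt_low_le (h : IsGlobalSolution m μ ν u F) (hm : 3 ≤ m) (hμ : 0 < μ)
    {t n q : ℝ} (ht : 0 < t) (hs : Slice (vel u t) (deform F t) n) (hq : total 0 0 u F t ≤ q)
    {ρ : ℝ} (hρ : 0 ≤ ρ) :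
    ∃ V, HasDerivAt (fun s => energy (lowPass ρ) (vel u s)) V t ∧
      V ≤ 2 * (lowConst * (ρ * √(ρ ^ 3)) * q) * √(energy (lowPass ρ) (vel u t)) := by
  refine ⟨_, h.hasDerivAt_energy_vel hm ht (measurable_lowPass ρ) (norm_lowPass_le ρ), ?_⟩
  have hpi := Real.pi_pos
  have me := measurable_ew (measurable_lowPass ρ)
  have mA := measurable_hatMag (vel u t)
  have mB := measurable_hatMag (deform F t)
  have he : ∀ ξ, ew (wt 0 0) ξ = 1 := fun ξ => by simp [ew, wt_zero]
  have b1 := lintegral_hatMag_sq_le_of_bounded (by simp) (continuous_wt 0 0).measurable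
    (norm_wt_le 0 le_rfl) (vel u t)
  have b2 := lintegral_hatMag_sq_le_of_bounded (by simp) (continuous_wt 0 0).measurable
    (norm_wt_le 0 le_rfl) (deform F t)
  simp only [he, one_mul] at b1 b2
  have b3 := lintegral_lowPass_le hρ (vel u t)
  have p1 := energy_nonneg (wt 0 0) (vel u t)
  have p2 := energy_nonneg (wt 0 0) (deform F t)
  have p3 := energy_nonneg (gw (lowPass ρ)) (vel u t)
  have hV := ballVolume_nonneg
  have t1 := tri_le_of_lintegral mA mA b1 b1 b3
  have t2 := tri_le_of_lintegral mB mB b2 b2 b3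
  rw [Real.mul_self_sqrt (by positivity)] at t1 t2
  have c1 := abs_sum_le_of_enorm_le_mul (by positivity) (hs.enorm_pair_vel_le (lowPass ρ)) t1
  have c2 := abs_sum_le_of_enorm_le_mul (by positivity)
    (fun a : Fin 3 × Fin 3 => hs.enorm_pair_stress_le (lowPass ρ) a.1 a.2) t2
  rw [Fintype.sum_prod_type] at c2
  simp only [Fintype.card_fin, Fintype.card_prod, Nat.cast_mul, Nat.cast_ofNat] at c1 c2
  have c1' := (abs_le.1 c1).1
  have c2' := (abs_le.1 c2).2
  have e1 : ρ * (√(ρ ^ 3 * ballVolume) * √(9 * energy (lowPass ρ) (vel u t)))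
      = 3 * (√ballVolume * (ρ * √(ρ ^ 3)) * √(energy (lowPass ρ) (vel u t))) := by
    rw [Real.sqrt_mul (by positivity), sqrt_nine_mul]; ring
  rw [e1] at c1' c2'
  unfold lowConst
  unfold total at hq
  set L := √ballVolume * (ρ * √(ρ ^ 3)) * √(energy (lowPass ρ) (vel u t)) with hL
  have hL0 : 0 ≤ Real.pi * L := by positivity
  have e2 : 2 * (486 * Real.pi * √ballVolume * (ρ * √(ρ ^ 3)) * q)
      * √(energy (lowPass ρ) (vel u t)) = 972 * (Real.pi * L) * q := by rw [hL]; ring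
  rw [e2]
  have h1 := mul_le_mul_of_nonneg_left hq hL0
  have h2 : 0 ≤ 8 * Real.pi ^ 2 * μ * energy (gw (lowPass ρ)) (vel u t) := by positivity
  have h3 : 0 ≤ Real.pi * L * energy (wt 0 0) (vel u t) := by positivity
  linarith

end IsGlobalSolution

/-! ### Fourier splitting -/

/-- A global solution whose energy of order `m` stays below a small level `e`, and whose initial
velocity has a Fourier transform bounded by `d`. -/
structure SmallSolution (m : ℕ) (μ ν e d : ℝ) (u : ℝ → E → Fin 3 → ℝ)
    (F : ℝ → E → Matrix (Fin 3) (Fin 3) ℝ) : Prop where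
  sol : IsGlobalSolution m μ ν u F
  total_le : ∀ t, 0 ≤ t → ∀ R, 0 ≤ R → total 0 R u F t + total m R u F t ≤ e
  norm_hat_le : ∀ k, ∀ᵐ ξ, ‖hat (vel u 0 k) ξ‖ ≤ d

theorem total_nonneg (k : ℕ) (R : ℝ) (u : ℝ → E → Fin 3 → ℝ)
    (F : ℝ → E → Matrix (Fin 3) (Fin 3) ℝ) (t : ℝ) : 0 ≤ total k R u F t :=
  add_nonneg (energy_nonneg _ _) (energy_nonneg _ _)

/-- The radius of the low-frequency ball in the splitting argument. -/
noncomputable def splitRadius (κ t : ℝ) : ℝ := κ * (1 + t) ^ (-(1 / 2 : ℝ))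

theorem splitRadius_sq {κ t : ℝ} (ht : 0 ≤ t) : splitRadius κ t ^ 2 = κ ^ 2 / (1 + t) := by
  have h : 0 < 1 + t := by linarith
  rw [splitRadius, mul_pow, ← Real.rpow_natCast (_ ^ (-(1 / 2 : ℝ))), ← Real.rpow_mul h.le]
  norm_num [Real.rpow_neg_one, div_eq_mul_inv]

theorem splitRadius_pos {κ t : ℝ} (hκ : 0 < κ) (ht : 0 ≤ t) : 0 < splitRadius κ t :=
  mul_pos hκ (Real.rpow_pos_of_pos (by linarith) _)

theorem sqrt_splitRadius_cube {κ t : ℝ} (hκ : 0 < κ) (ht : 0 ≤ t) :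
    √(splitRadius κ t ^ 3) = √(κ ^ 3) * (1 + t) ^ (-(3 / 4) : ℝ) := by
  have h : 0 < 1 + t := by linarith
  rw [splitRadius, mul_pow, Real.sqrt_mul (by positivity), Real.sqrt_eq_rpow (((1 + t) ^ _) ^ 3),
    ← Real.rpow_natCast (_ ^ (-(1 / 2 : ℝ))), ← Real.rpow_mul h.le, ← Real.rpow_mul h.le]
  norm_num

namespace SmallSolution

variable {m : ℕ} {μ ν e d : ℝ}

/-- Decay of the low frequencies from a decay rate of the full energy. The initial contribution is of
order `ρ³`, as the Fourier transforms of integrable data are bounded; the square root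
of the energy grows in addition by the time integral of the full energy times `ρ^(5/2)`. -/
theorem exists_low_le (hm : 3 ≤ m) (hμ : 0 < μ) (hd : 0 ≤ d) {p Q κ : ℝ} (hp : 1 / 2 ≤ p)
    (hQ : 0 ≤ Q) (hκ : 0 < κ) : ∃ C, 0 ≤ C ∧ ∀ u F, SmallSolution m μ ν e d u F →
      (∀ t, 0 ≤ t → total 0 0 u F t ≤ Q * (1 + t) ^ (p - 1)) → ∀ t, 0 ≤ t →
        energy (lowPass (splitRadius κ t)) (vel u t) ≤ C * (1 + t) ^ (2 * p - 5 / 2) := by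
  have hV := ballVolume_nonneg
  have hL := lowConst_nonneg
  have hp0 : 0 < p := by linarith
  refine ⟨(√(κ ^ 3) * (√(3 * ballVolume * d ^ 2) + lowConst * κ * (Q / p))) ^ 2, by positivity,
    fun u F h hq T hT => ?_⟩
  have h1T : 0 < 1 + T := by linarith
  set ρ := splitRadius κ T with hρdef
  have hρ : 0 < ρ := splitRadius_pos hκ hT
  set A := lowConst * (ρ * √(ρ ^ 3)) with hA
  have hA0 : 0 ≤ A := by positivity
  choose! V hV1 hV2 using fun t (ht : 0 < t) => h.sol.exists_hasDerivAt_low_le hm hμ ht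
    (h.sol.slice hm ht.le (h.total_le t ht.le)) (hq t ht.le) hρ.le
  have hder : ∀ t, 0 ≤ t → HasDerivAt (fun t : ℝ => A * (Q / p) * (1 + t) ^ p)
      (A * (Q * (1 + t) ^ (p - 1))) t := fun t ht => by
    have h2 : HasDerivAt (fun t : ℝ => (1 + t) ^ p) (1 * p * (1 + t) ^ (p - 1)) t :=
      ((hasDerivAt_id t).const_add 1).rpow_const (Or.inl (by simp; linarith))
    refine (h2.const_mul (A * (Q / p))).congr_deriv ?_
    field_simp
  have key := sqrt_le_of_deriv_le (y := fun t => energy (lowPass ρ) (vel u t)) hT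
    ((h.sol.continuousOn_energy_vel (measurable_lowPass ρ) (norm_lowPass_le ρ)).mono
      Set.Icc_subset_Ici_self) (fun t _ => energy_nonneg _ _)
    (fun t ht => (hder t ht.1).continuousAt.continuousWithinAt) (fun t ht => hV1 t ht.1)
    (fun t ht => hder t ht.1.le)
    (fun t ht => mul_nonneg hA0 (mul_nonneg hQ (Real.rpow_nonneg (by linarith [ht.1]) _)))
    (fun t ht => (hV2 t ht.1).trans_eq (by rw [hA]))
  have h0 := energy_lowPass_le hρ.le hd h.norm_hat_le
  have h0' : √(energy (lowPass ρ) (vel u 0)) ≤ √(ρ ^ 3) * √(3 * ballVolume * d ^ 2) := by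
    rw [← Real.sqrt_mul (by positivity)]
    exact Real.sqrt_le_sqrt (h0.trans_eq (by ring))
  have e1 : √(ρ ^ 3) = √(κ ^ 3) * (1 + T) ^ (-(3 / 4) : ℝ) := sqrt_splitRadius_cube hκ hT
  have e2 : ρ * (1 + T) ^ p = κ * (1 + T) ^ (p - 1 / 2) := by
    rw [hρdef, splitRadius, mul_assoc, ← Real.rpow_add h1T]
    congr 2
    ring
  have h1 : 1 ≤ (1 + T) ^ (p - 1 / 2) := Real.one_le_rpow (by linarith) (by linarith)
  have hfin : √(energy (lowPass ρ) (vel u T)) ≤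
      √(κ ^ 3) * (√(3 * ballVolume * d ^ 2) + lowConst * κ * (Q / p)) * (1 + T) ^ (p - 5 / 4) := by
    have hdrop : A * (Q / p) * (1 + T) ^ p - A * (Q / p) * (1 + 0) ^ p
        ≤ A * (Q / p) * (1 + T) ^ p := by
      have : 0 ≤ A * (Q / p) * ((1 : ℝ) + 0) ^ p := by positivity
      linarith
    have e3 : A * (Q / p) * (1 + T) ^ p
        = √(ρ ^ 3) * (lowConst * κ * (Q / p)) * (1 + T) ^ (p - 1 / 2) := by
      rw [hA]
      linear_combination lowConst * √(ρ ^ 3) * (Q / p) * e2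
    have e4 : (1 + T) ^ (-(3 / 4) : ℝ) * (1 + T) ^ (p - 1 / 2) = (1 + T) ^ (p - 5 / 4) := by
      rw [← Real.rpow_add h1T]
      congr 1
      ring
    calc _ ≤ √(ρ ^ 3) * √(3 * ballVolume * d ^ 2)
          + √(ρ ^ 3) * (lowConst * κ * (Q / p)) * (1 + T) ^ (p - 1 / 2) := by linarith
      _ ≤ √(ρ ^ 3) * √(3 * ballVolume * d ^ 2) * (1 + T) ^ (p - 1 / 2)
          + √(ρ ^ 3) * (lowConst * κ * (Q / p)) * (1 + T) ^ (p - 1 / 2) := by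
          have := le_mul_of_one_le_right
            (show 0 ≤ √(ρ ^ 3) * √(3 * ballVolume * d ^ 2) by positivity) h1
          linarith
      _ = _ := by rw [e1, ← e4]; ring
  have h2 := pow_le_pow_left₀ (Real.sqrt_nonneg _) hfin 2
  rw [Real.sq_sqrt (energy_nonneg _ _), mul_pow _ ((1 + T) ^ _), ← Real.rpow_natCast ((1 + T) ^ _),
    ← Real.rpow_mul h1T.le] at h2
  rwa [show (p - 5 / 4) * ((2 : ℕ) : ℝ) = 2 * p - 5 / 2 by push_cast; ring] at h2

/-- One step of the Fourier splitting method: the decay exponent `1 - p` of the energy improves to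
`5/2 - 2p`. At the radius `splitRadius κ t` the dissipation of the high frequencies is a multiple of
the energy over `1 + t`, and the low frequencies are a source. -/
theorem exists_total_le (hm : 3 ≤ m) (hμ : 0 < μ) (hν : 0 < ν) (hd : 0 ≤ d)
    (hsm : balanceConst m * √e ≤ dampConst μ ν / 2) {p Q : ℝ} (hp : 1 / 2 ≤ p) (hp1 : p ≤ 1)
    (hQ : 0 ≤ Q) : ∃ C, 0 ≤ C ∧ ∀ u F, SmallSolution m μ ν e d u F →
      (∀ t, 0 ≤ t → total 0 0 u F t ≤ Q * (1 + t) ^ (p - 1)) → ∀ t, 0 ≤ t → ∀ R, 0 ≤ R →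
        total 0 R u F t + total m R u F t ≤ C * (1 + t) ^ (2 * p - 5 / 2) := by
  have hc := dampConst_pos hμ hν
  set c := dampConst μ ν
  set b := 5 / 2 - 2 * p with hb
  have hb0 : 0 ≤ b := by linarith
  -- This `κ` makes the damping rate `c / 2 * ρ ^ 2` equal to `(b + 1) / (1 + t)`.
  set κ := √(2 * (b + 1) / c) with hκdef
  have hκ : 0 < κ := Real.sqrt_pos.2 (by positivity)
  have hκ2 : κ ^ 2 = 2 * (b + 1) / c := Real.sq_sqrt (by positivity)
  obtain ⟨C, hC, hlow⟩ := exists_low_le (ν := ν) (e := e) hm hμ hd hp hQ hκ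
  refine ⟨(1 + κ ^ 2) ^ (b + 1) * |e| + 2 * (b + 1) * C, by positivity, fun u F h hq => ?_⟩
  have he : ∀ t, 0 ≤ t → ∀ R, 0 ≤ R → total 0 R u F t + total m R u F t ≤ |e| := fun t ht R hR =>
    (h.total_le t ht R hR).trans (le_abs_self e)
  intro t ht R hR
  rw [show 2 * p - 5 / 2 = -b by rw [hb]; ring]
  have h1t : 0 < 1 + t := by linarith
  -- From the time `κ ^ 2` on the radius is below `1`; before it, the bound `e` suffices.
  rcases lt_or_ge t (κ ^ 2) with htT | htT
  · have h1 : (1 + t) ^ b ≤ (1 + κ ^ 2) ^ (b + 1) :=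
      (Real.rpow_le_rpow h1t.le (by linarith) hb0).trans
        (Real.rpow_le_rpow_of_exponent_le (by nlinarith) (by linarith))
    refine (he t ht R hR).trans ?_
    rw [Real.rpow_neg h1t.le, ← div_eq_mul_inv, le_div_iff₀ (Real.rpow_pos_of_pos h1t b)]
    have := mul_le_mul_of_nonneg_left h1 (abs_nonneg e)
    have : 0 ≤ 2 * (b + 1) * C := by positivity
    linarith
  choose! V hV1 hV2 using fun t (ht : 0 < t) =>
    h.sol.exists_hasDerivAt_le hm ht (h.total_le t ht.le) hsm hR
  have hT : 0 ≤ κ ^ 2 := by positivity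
  have key := le_rpow_of_deriv_le (f := fun s => total 0 R u F s + total m R u F s) (f' := V)
    (B := 2 * (b + 1) * C) hT hb0 (by positivity)
    ((h.sol.continuousOn_total_add hR).mono (Set.Ici_subset_Ici.2 hT))
    (add_nonneg (total_nonneg _ _ _ _ _) (total_nonneg _ _ _ _ _))
    (fun s hs => hV1 s (hT.trans_lt hs)) (fun s hs => ?_) htT
  · refine key.trans ?_
    gcongr
    exact he _ hT R hR
  · have hs0 : 0 ≤ s := hT.trans hs.le
    have h1s : 0 < 1 + s := by linarith
    have hsl := h.sol.slice hm hs0 (h.total_le s hs0)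
    have hlow' := hlow u F h hq s hs0
    have hρ := splitRadius_pos hκ hs0
    have hρ2 := splitRadius_sq (κ := κ) hs0
    set ρ := splitRadius κ s
    have hρ1 : ρ ^ 2 ≤ 1 := by
      rw [hρ2, div_le_one h1s]; linarith
    have s0 := hsl.energy_le_dissip_add_low 0 hR hρ
    have sm := hsl.energy_le_dissip_add_low m hR hρ
    have y0 := energy_nonneg (lowPass ρ) (vel u s)
    have yF0 := energy_nonneg (wt 0 R) (deform F s)
    have yFm := energy_nonneg (wt m R) (deform F s)
    have hρm : ρ ^ (2 * m) ≤ 1 := by rw [pow_mul]; exact pow_le_one₀ (by positivity) hρ1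
    have hρ20 : 0 ≤ ρ ^ 2 := by positivity
    rw [mul_zero, pow_zero, mul_one] at s0
    have sm' : ρ ^ 2 * energy (wt m R) (vel u s) ≤ energy (gw (wt m R)) (vel u s)
        + ρ ^ 2 * energy (lowPass ρ) (vel u s) := by
      refine sm.trans ?_
      gcongr
      exact mul_le_of_le_one_right hρ20 hρm
    have f0 := mul_le_of_le_one_left yF0 hρ1
    have fm := mul_le_of_le_one_left yFm hρ1
    have hsum : ρ ^ 2 * (total 0 R u F s + total m R u F s)
        - 2 * ρ ^ 2 * energy (lowPass ρ) (vel u s)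
        ≤ energy (gw (wt 0 R)) (vel u s) + energy (gw (wt m R)) (vel u s)
          + energy (wt 0 R) (deform F s) + energy (wt m R) (deform F s) := by
      unfold total
      linarith
    have h1 := mul_le_mul_of_nonneg_left hsum (show 0 ≤ c / 2 by positivity)
    have e1 : c / 2 * ρ ^ 2 = (b + 1) / (1 + s) := by
      rw [hρ2, hκ2]; field_simp
    have e2 : (1 + s) ^ (-1 - b) = (1 + s)⁻¹ * (1 + s) ^ (2 * p - 5 / 2) := by
      rw [← Real.rpow_neg_one, ← Real.rpow_add h1s]
      congr 1
      rw [hb]; ring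
    have h2 : c * ρ ^ 2 * energy (lowPass ρ) (vel u s) ≤ 2 * (b + 1) * C * (1 + s) ^ (-1 - b) := by
      have e3 : c * ρ ^ 2 = 2 * (b + 1) * (1 + s)⁻¹ := by
        rw [← div_eq_mul_inv, mul_div_assoc, ← e1]; ring
      rw [e3, e2]
      calc _ ≤ 2 * (b + 1) * (1 + s)⁻¹ * (C * (1 + s) ^ (2 * p - 5 / 2)) := by gcongr
        _ = _ := by ring
    have h3 := hV2 s (hT.trans_lt hs)
    rw [← e1]
    linarith

end SmallSolution

/-! ### Decay of all orders -/

namespace SmallSolution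

variable {m : ℕ} {μ ν e d : ℝ}

/-- The decay of the energy of order `m` at the rate of the heat flow with integrable data. -/
theorem exists_total_le_neg_three_halves (hm : 3 ≤ m) (hμ : 0 < μ) (hν : 0 < ν) (hd : 0 ≤ d)
    (hsm : balanceConst m * √e ≤ dampConst μ ν / 2) :
    ∃ C, 0 ≤ C ∧ ∀ u F, SmallSolution m μ ν e d u F → ∀ t, 0 ≤ t → ∀ R, 0 ≤ R →
      total 0 R u F t + total m R u F t ≤ C * (1 + t) ^ (-(3 / 2) : ℝ) := by
  -- A bounded energy decays like `(1 + t)^(-1/2)`, and this rate improves to `(1 + t)^(-3/2)`.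
  obtain ⟨Q, hQ, h1⟩ := exists_total_le (e := e) hm hμ hν hd hsm (p := 1) (by norm_num) le_rfl
    (abs_nonneg e)
  obtain ⟨C, hC, h2⟩ := exists_total_le (e := e) hm hμ hν hd hsm (p := 1 / 2) le_rfl (by norm_num) hQ
  refine ⟨C, hC, fun u F h t ht R hR => ?_⟩
  have h3 := h2 u F h (fun t ht => ?_) t ht R hR
  · convert h3 using 3; norm_num
  · have h4 := h1 u F h (fun t ht => ?_) t ht 0 le_rfl
    · have := total_nonneg m 0 u F t
      norm_num at h4 ⊢
      linarith
    · have := total_nonneg m 0 u F t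
      have := h.total_le t ht 0 le_rfl
      have := le_abs_self e
      norm_num
      linarith

theorem mul_sqrt_mul_sqrt_le {A c x y : ℝ} (hc : 0 < c) (hx : 0 ≤ x) (hy : 0 ≤ y) :
    A * (√x * √y) ≤ c / 4 * y + A ^ 2 / c * x := by
  have h1 := Real.sq_sqrt hx
  have h2 := Real.sq_sqrt hy
  have h : c / 4 * √y ^ 2 + A ^ 2 / c * √x ^ 2 - A * (√x * √y) = (c / 2 * √y - A * √x) ^ 2 / c := by
    field_simp; ring
  have h3 : 0 ≤ (c / 2 * √y - A * √x) ^ 2 / c := by positivity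
  rw [h1, h2] at h
  linarith

/-- The energy inequality of arbitrary order. Half of `dampConst` is left as coefficient of the
dissipation, and the remaining terms are small with `n`. -/
theorem exists_hasDerivAt_total_le (hm : 3 ≤ m) (hμ : 0 < μ) (hν : 0 < ν)
    {u : ℝ → E → Fin 3 → ℝ} {F : ℝ → E → Matrix (Fin 3) (Fin 3) ℝ}
    (h : IsGlobalSolution m μ ν u F) (j : ℕ) {t : ℝ} (ht : 0 < t) {n : ℝ}
    (hs : Slice (vel u t) (deform F t) n) {R : ℝ} (hR : 0 ≤ R) :
    ∃ V, HasDerivAt (total j R u F) V t ∧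
      V ≤ -(dampConst μ ν / 2) * energy (gw (wt j R)) (vel u t)
        - dampConst μ ν * energy (wt j R) (deform F t)
        + (nlConst j * n) ^ 2 / dampConst μ ν * energy (wt j R) (vel u t)
        + (4 * ((nlConst j * n) ^ 2 / dampConst μ ν) + nlConst j * n)
          * energy (wt j R) (deform F t) := by
  refine ⟨_, h.hasDerivAt_total hm ht j hR, ?_⟩
  have hc := dampConst_pos hμ hν
  have nj := (abs_le.1 (hs.abs_nonlinear_le j hR)).2
  have hd1 : dampConst μ ν ≤ 8 * Real.pi ^ 2 * μ := min_le_left _ _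
  have hd2 : dampConst μ ν ≤ 2 * ν := min_le_right _ _
  have p1 := energy_nonneg (wt j R) (vel u t)
  have p2 := energy_nonneg (gw (wt j R)) (vel u t)
  have p3 := energy_nonneg (wt j R) (deform F t)
  have r1 := mul_le_mul_of_nonneg_right hd1 p2
  have r2 := mul_le_mul_of_nonneg_right hd2 p3
  have q1 := mul_sqrt_mul_sqrt_le (A := nlConst j * n) hc p1 p2
  have q2 := mul_sqrt_mul_sqrt_le (A := 2 * (nlConst j * n)) hc p3 p2
  have e2 : (2 * (nlConst j * n)) ^ 2 / dampConst μ ν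
      = 4 * ((nlConst j * n) ^ 2 / dampConst μ ν) := by ring
  rw [e2] at q2
  linarith

/-- Decay of the energies of all orders that are finite initially. The constants do not depend on
the truncation of the weight. -/
theorem exists_total_le_order (hm : 3 ≤ m) (hμ : 0 < μ) (hν : 0 < ν) (hd : 0 ≤ d)
    (hsm : balanceConst m * √e ≤ dampConst μ ν / 2) (j : ℕ) {E₀ : ℝ} (hE₀ : 0 ≤ E₀) :
    ∃ T C, 0 ≤ T ∧ 0 ≤ C ∧ ∀ u F, SmallSolution m μ ν e d u F →
      (∀ R, 0 ≤ R → total j R u F 0 ≤ E₀) → ∀ t, T ≤ t → ∀ R, 0 ≤ R →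
        total j R u F t ≤ C * (1 + t) ^ (-(3 / 2 : ℝ) - j) := by
  have hc := dampConst_pos hμ hν
  have hN := nlConst_pos j
  have hK := embConst_pos
  obtain ⟨C₁, hC₁, hdec⟩ := exists_total_le_neg_three_halves (e := e) hm hμ hν hd hsm
  set c := dampConst μ ν
  set b : ℝ := 3 / 2 + j with hb
  have hb0 : 0 ≤ b := by positivity
  -- The damping rate `c / 2 * ρ ^ 2` is `(b + 2) / (1 + t)`; of this, `1 / (1 + t)` absorbs the
  -- nonlinear terms.
  set κ := √(2 * (b + 2) / c) with hκdef
  have hκ : 0 < κ := Real.sqrt_pos.2 (by positivity)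
  have hκ2 : κ ^ 2 = 2 * (b + 2) / c := Real.sq_sqrt (by positivity)
  obtain ⟨C₂, hC₂, hlow⟩ := exists_low_le (ν := ν) (e := e) hm hμ hd (p := 1 / 2) le_rfl hC₁ hκ
  -- The square of the nonlinear coefficient is at most `G (1 + t)^(-3/2)`.
  set G := (nlConst j * embConst) ^ 2 * C₁ with hG
  have hG0 : 0 ≤ G := by positivity
  set B := 4 * (G / c) + √G with hB
  -- From `T` on, the radius is below `1` and the nonlinear coefficients are at most `1 / (1 + t)` for
  -- the velocity and `c / 2` for the deformation.
  set T := κ ^ 2 + (G / c) ^ 2 + 16 / c with hT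
  have hT0 : 0 ≤ T := by positivity
  set M := (b + 2) * κ ^ (2 * j) * C₂ with hM
  have hM0 : 0 ≤ M := by positivity
  refine ⟨T, (1 + T) ^ (b + 1) * (Real.exp (B * T) * E₀) + M, hT0, by positivity,
    fun u F h h0 t htT R hR => ?_⟩
  have hsl : ∀ s, 0 ≤ s → Slice (vel u s) (deform F s)
      (embConst * √(C₁ * (1 + s) ^ (-(3 / 2) : ℝ))) := fun s hs =>
    h.sol.slice hm hs (hdec u F h s hs)
  have hcoef : ∀ s, 0 ≤ s → (nlConst j * (embConst * √(C₁ * (1 + s) ^ (-(3 / 2) : ℝ)))) ^ 2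
      = G * (1 + s) ^ (-(3 / 2) : ℝ) := fun s hs => by
    have h1s : 0 < 1 + s := by linarith
    rw [← mul_assoc, mul_pow, Real.sq_sqrt (by positivity), hG, mul_assoc]
  choose! V hV1 hV2 using fun t (ht : 0 < t) =>
    exists_hasDerivAt_total_le hm hμ hν h.sol j ht (hsl t ht.le) hR
  -- Up to time `T`, the energy grows at most exponentially.
  have hgrow : total j R u F T ≤ Real.exp (B * T) * E₀ := by
    refine (le_exp_of_deriv_le (h.sol.continuousOn_total j hR) (f' := V) hV1 (fun s hs => ?_)
      hT0).trans (mul_le_mul_of_nonneg_left (h0 R hR) (Real.exp_pos _).le)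
    have h1s : 0 < 1 + s := by linarith
    have hle : (1 + s) ^ (-(3 / 2) : ℝ) ≤ 1 :=
      Real.rpow_le_one_of_one_le_of_nonpos (by linarith) (by norm_num)
    have hv := hV2 s hs
    have n0 : 0 ≤ nlConst j * (embConst * √(C₁ * (1 + s) ^ (-(3 / 2) : ℝ))) := by positivity
    have hco := hcoef s hs.le
    set A := nlConst j * (embConst * √(C₁ * (1 + s) ^ (-(3 / 2) : ℝ)))
    have hA2 : A ^ 2 ≤ G := hco.trans_le (mul_le_of_le_one_right hG0 hle)
    have hA : A ≤ √G := Real.le_sqrt_of_sq_le hA2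
    have p1 := energy_nonneg (wt j R) (vel u s)
    have p2 := energy_nonneg (gw (wt j R)) (vel u s)
    have p3 := energy_nonneg (wt j R) (deform F s)
    have hA3 : A ^ 2 / c ≤ G / c := by gcongr
    have g0 : 0 ≤ G / c := by positivity
    have g1 := Real.sqrt_nonneg G
    have k1 := mul_le_mul_of_nonneg_right (show A ^ 2 / c ≤ B by rw [hB]; linarith) p1
    have k2 := mul_le_mul_of_nonneg_right (show 4 * (A ^ 2 / c) + A ≤ B by rw [hB]; linarith) p3
    have k3 := mul_nonneg hc.le p2
    have k4 := mul_nonneg hc.le p3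
    unfold total
    linarith
  -- After time `T`, the nonlinear terms are small enough for the splitting argument.
  have key := le_rpow_of_deriv_le (f := total j R u F) (f' := V) (B := M) hT0 hb0 hM0
    ((h.sol.continuousOn_total j hR).mono (Set.Ici_subset_Ici.2 hT0)) (total_nonneg _ _ _ _ _)
    (fun s hs => hV1 s (hT0.trans_lt hs)) (fun s hs => ?_) htT
  · rw [show -(3 / 2 : ℝ) - j = -b by rw [hb]; ring]
    have h1t : 0 < 1 + t := by linarith
    refine key.trans ?_
    gcongr
  have hs0 : 0 ≤ s := hT0.trans hs.le
  have h1s : 0 < 1 + s := by linarith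
  have hκT : κ ^ 2 ≤ s := by
    have : 0 ≤ (G / c) ^ 2 + 16 / c := by positivity
    linarith
  have hGT : (G / c) ^ 2 ≤ 1 + s := by
    have : 0 ≤ κ ^ 2 + 16 / c := by positivity
    linarith
  have hcT : 16 / c ≤ 1 + s := by
    have : 0 ≤ κ ^ 2 + (G / c) ^ 2 := by positivity
    linarith
  have hv := hV2 s (hT0.trans_lt hs)
  have n0 : 0 ≤ nlConst j * (embConst * √(C₁ * (1 + s) ^ (-(3 / 2) : ℝ))) := by positivity
  have hco := hcoef s hs0
  set A := nlConst j * (embConst * √(C₁ * (1 + s) ^ (-(3 / 2) : ℝ)))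
  have hA2 : A ^ 2 / c ≤ 1 / (1 + s) := by
    have hsq : G / c ≤ √(1 + s) := Real.le_sqrt_of_sq_le hGT
    have e1 : (1 + s) ^ (-(3 / 2) : ℝ) = 1 / ((1 + s) * √(1 + s)) := by
      rw [Real.sqrt_eq_rpow, ← Real.rpow_one_add' h1s.le (by norm_num), one_div,
        ← Real.rpow_neg h1s.le]
      norm_num
    have hsp : 0 < √(1 + s) := Real.sqrt_pos.2 h1s
    rw [hco, e1, div_le_div_iff₀ hc h1s]
    rw [div_le_iff₀ hc] at hsq
    calc G * (1 / ((1 + s) * √(1 + s))) * (1 + s) = G / √(1 + s) := by field_simp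
      _ ≤ 1 * c := by rw [div_le_iff₀ hsp]; linarith
  have hinv : 1 / (1 + s) ≤ c / 16 := by
    rw [div_le_iff₀ hc] at hcT
    rw [div_le_iff₀ h1s]
    linarith
  have hA : A ≤ c / 4 := by
    refine abs_le_of_sq_le_sq' ?_ (by positivity) |>.2
    have h1 := hA2.trans hinv
    rw [div_le_iff₀ hc] at h1
    nlinarith
  have hρ := splitRadius_pos hκ hs0
  have hρ2 := splitRadius_sq (κ := κ) hs0
  have hlow' := hlow u F h (fun r hr => by
    have h1 := hdec u F h r hr 0 le_rfl
    have := total_nonneg m 0 u F r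
    have h1r : 0 < 1 + r := by linarith
    have h2 : (1 + r) ^ (-(3 / 2) : ℝ) ≤ (1 + r) ^ ((1 / 2 : ℝ) - 1) :=
      Real.rpow_le_rpow_of_exponent_le (by linarith) (by norm_num)
    have := mul_le_mul_of_nonneg_left h2 hC₁
    linarith) s hs0
  set ρ := splitRadius κ s
  have hρ1 : ρ ^ 2 ≤ 1 := by
    rw [hρ2, div_le_one h1s]; linarith
  have sj := (hsl s hs0).energy_le_dissip_add_low j hR hρ
  have p1 := energy_nonneg (wt j R) (vel u s)
  have p3 := energy_nonneg (wt j R) (deform F s)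
  have fj := mul_le_of_le_one_left p3 hρ1
  have e1 : c / 2 * ρ ^ 2 = (b + 2) / (1 + s) := by
    rw [hρ2, hκ2]; field_simp
  have hMs : c / 2 * ρ ^ 2 * ρ ^ (2 * j) * energy (lowPass ρ) (vel u s)
      ≤ M * (1 + s) ^ (-1 - b) := by
    have e2 : (1 + s) ^ (-1 - b) = (1 + s)⁻¹ * ((1 + s) ^ j)⁻¹
        * (1 + s) ^ (2 * (1 / 2 : ℝ) - 5 / 2) := by
      rw [← Real.rpow_natCast (1 + s) j, ← Real.rpow_neg h1s.le, ← Real.rpow_neg_one,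
        ← Real.rpow_add h1s, ← Real.rpow_add h1s]
      congr 1
      rw [hb]; ring
    rw [e1, pow_mul ρ, hρ2, div_pow, ← pow_mul, e2, hM]
    calc _ ≤ (b + 2) / (1 + s) * (κ ^ (2 * j) / (1 + s) ^ j)
          * (C₂ * (1 + s) ^ (2 * (1 / 2 : ℝ) - 5 / 2)) := by gcongr
      _ = _ := by ring
  have k1 := mul_le_mul_of_nonneg_right hA2 p1
  have k2 := mul_le_mul_of_nonneg_right (show 4 * (A ^ 2 / c) + A ≤ c / 2 by linarith) p3
  have k3 := mul_le_mul_of_nonneg_left sj (show 0 ≤ c / 2 by positivity)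
  have k4 := mul_le_mul_of_nonneg_left fj (show 0 ≤ c / 2 by positivity)
  have k5 : (b + 2) / (1 + s) * energy (wt j R) (vel u s)
      = (b + 1) / (1 + s) * energy (wt j R) (vel u s)
        + 1 / (1 + s) * energy (wt j R) (vel u s) := by ring
  have k6 : (b + 1) / (1 + s) * energy (wt j R) (deform F s)
      ≤ (b + 2) / (1 + s) * energy (wt j R) (deform F s) := by gcongr; linarith
  rw [← e1] at k5 k6
  unfold total
  linarith

end SmallSolution

/-! ### Energies and Sobolev norms of the data -/

/-- The Fourier transform of an integrable function is bounded. -/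
theorem norm_hat_le_of_integrable {f : E → ℝ} (hf : MemLp f 2 volume) (hi : Integrable f volume) :
    ∀ᵐ ξ, ‖hat f ξ‖ ≤ ∫ x, ‖f x‖ := by
  have hi' : Integrable (toL2 f : E → ℂ) volume := hi.ofReal.congr (coe_toL2 hf).symm
  have e : ∫ x, ‖toL2 f x‖ = ∫ x, ‖f x‖ := by
    refine integral_congr_ae ?_
    filter_upwards [coe_toL2 hf] with x hx
    rw [hx, Complex.norm_real]
  rw [← e]
  exact norm_fourier_le (toL2 f) hi'

/-- Bounds of the truncated energies, uniform in the truncation, bound `‖∇^k w‖²`, and with it comes the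
existence of the weak derivatives. -/
theorem gradNormSq_le_of_energy_le {κ : Type} [Fintype κ] {k : ℕ} {w : E → κ → ℝ}
    (hw : ∀ a, MemLp (fun x => w x a) 2 volume) {X : ℝ}
    (h : ∀ R, 0 ≤ R → energy (wt k R) (fun a x => w x a) ≤ X) :
    gradNormSq k w ≤ ENNReal.ofReal ((2 * Real.pi) ^ (2 * k) * X) := by
  have hpi := Real.pi_pos
  rw [gradNormSq_eq k hw, ENNReal.ofReal_mul (by positivity)]
  refine le_trans (le_of_eq ?_) (mul_le_mul_right (sum_lintegral_le_of_energy_le h) _)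
  rw [Finset.mul_sum]
  refine Finset.sum_congr rfl fun a _ => ?_
  rw [← lintegral_const_mul' _ _ ENNReal.ofReal_ne_top]
  refine lintegral_congr fun ξ => ?_
  rw [mul_pow (2 * Real.pi), ENNReal.ofReal_mul (by positivity), mul_assoc]

/-- The size of the data for which the energy method closes. -/
noncomputable def smallness (m : ℕ) (μ ν : ℝ) : ℝ := dampConst μ ν / (8 * balanceConst m)

theorem smallness_pos (m : ℕ) {μ ν : ℝ} (hμ : 0 < μ) (hν : 0 < ν) : 0 < smallness m μ ν := by
  have := dampConst_pos hμ hν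
  have := balanceConst_pos m
  unfold smallness; positivity

theorem balanceConst_mul_sqrt {m : ℕ} {μ ν : ℝ} (hμ : 0 < μ) (hν : 0 < ν) :
    balanceConst m * √(4 * (4 * smallness m μ ν ^ 2)) = dampConst μ ν / 2 := by
  have := balanceConst_pos m
  rw [show 4 * (4 * smallness m μ ν ^ 2) = (4 * smallness m μ ν) ^ 2 by ring,
    Real.sqrt_sq (by have := smallness_pos m hμ hν; positivity), smallness]
  field_simp
  ring

/-- The energy of the data at time zero, for curves that attain the data almost everywhere. -/
theorem total_zero_le {k m : ℕ} (hk : k ≤ m) {u₀ : E → Fin 3 → ℝ}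
    {F₀ : E → Matrix (Fin 3) (Fin 3) ℝ} {S₁ S₂ : ℝ} (hS₁ : 0 ≤ S₁) (hS₂ : 0 ≤ S₂)
    (h₁ : sobolevNorm m u₀ ≤ ENNReal.ofReal S₁)
    (h₂ : sobolevNorm m (entries F₀) ≤ ENNReal.ofReal S₂)
    {u : ℝ → E → Fin 3 → ℝ} {F : ℝ → E → Matrix (Fin 3) (Fin 3) ℝ}
    (hu : ∀ᵐ x, u 0 x = u₀ x) (hF : ∀ᵐ x, F 0 x = F₀ x) {R : ℝ} (hR : 0 ≤ R) :
    total k R u F 0 ≤ S₁ ^ 2 + S₂ ^ 2 := by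
  have c1 : ∀ a, hat (vel u 0 a) = hat (fun x => u₀ x a) := fun a =>
    (hat_congr (memLp_of_sobolevNorm (h₁.trans_lt ENNReal.ofReal_lt_top) a)
      (hu.mono fun x hx => (congrFun hx a).symm)).symm
  have c2 : ∀ a, hat (deform F 0 a) = hat (fun x => entries F₀ x a) := fun a =>
    (hat_congr (memLp_of_sobolevNorm (h₂.trans_lt ENNReal.ofReal_lt_top) a)
      (hF.mono fun x hx => (congrFun (congrFun hx a.1) a.2).symm)).symm
  rw [total, energy_congr (w' := fun a x => u₀ x a) c1,
    energy_congr (w' := fun a x => entries F₀ x a) c2]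
  exact add_le_add (energy_wt_le_sobolevNorm hk hS₁ h₁ hR) (energy_wt_le_sobolevNorm hk hS₂ h₂ hR)

/-- A global solution with small data in `H^m` and integrable initial velocity is a small solution
in the sense of `SmallSolution`. -/
theorem IsGlobalSolution.smallSolution {m : ℕ} (hm : 3 ≤ m) {μ ν : ℝ} (hμ : 0 < μ) (hν : 0 < ν)
    {u₀ : E → Fin 3 → ℝ} {F₀ : E → Matrix (Fin 3) (Fin 3) ℝ}
    (h₀ : sobolevNorm m u₀ + sobolevNorm m (entries F₀) ≤ ENNReal.ofReal (smallness m μ ν))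
    (hi : ∀ k, Integrable (fun x => u₀ x k) volume)
    {u : ℝ → E → Fin 3 → ℝ} {F : ℝ → E → Matrix (Fin 3) (Fin 3) ℝ}
    (h : IsGlobalSolution m μ ν u F) (hu : ∀ᵐ x, u 0 x = u₀ x) (hF : ∀ᵐ x, F 0 x = F₀ x) :
    SmallSolution m μ ν (4 * smallness m μ ν ^ 2) (∑ k, ∫ x, ‖u₀ x k‖) u F := by
  have hδ := smallness_pos m hμ hν
  have h₁ := le_self_add.trans h₀
  have h₂ := le_add_self.trans h₀
  refine ⟨h, fun t ht R hR => h.total_le hm hμ hν (by positivity) (balanceConst_mul_sqrt hμ hν).le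
    (fun R hR => ?_) ht hR, fun k => ?_⟩
  · have a0 := total_zero_le (Nat.zero_le m) hδ.le hδ.le h₁ h₂ hu hF hR
    have am := total_zero_le le_rfl hδ.le hδ.le h₁ h₂ hu hF hR
    linarith
  · have hL := memLp_of_sobolevNorm (h₁.trans_lt ENNReal.ofReal_lt_top) k
    rw [← hat_congr hL (hu.mono fun x hx => (congrFun hx k).symm : _ =ᵐ[volume] vel u 0 k)]
    filter_upwards [norm_hat_le_of_integrable hL (hi k)] with ξ hξ
    exact hξ.trans (Finset.single_le_sum (f := fun k => ∫ x, ‖u₀ x k‖)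
      (fun k _ => integral_nonneg fun x => norm_nonneg _) (Finset.mem_univ k))

end Oldroyd

theorem theorem1p3 (μ ν : ℝ) (hμ : 0 < μ) (hν : 0 < ν) (m : ℕ) (hm : 3 ≤ m) :
    ∃ δ₀ : ℝ, 0 < δ₀ ∧
      ∀ (u₀ : Oldroyd.E → Fin 3 → ℝ) (F₀ : Oldroyd.E → Matrix (Fin 3) (Fin 3) ℝ),
        Oldroyd.sobolevNorm m u₀ + Oldroyd.sobolevNorm m (Oldroyd.entries F₀)
          ≤ ENNReal.ofReal δ₀ →
        (∀ k, Integrable (fun x => u₀ x k) volume) →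
        (∀ k l, Integrable (fun x => F₀ x k l) volume) →
        ∀ j : ℕ,
          Oldroyd.sobolevNorm j u₀ < ⊤ →
          Oldroyd.sobolevNorm j (Oldroyd.entries F₀) < ⊤ →
          ∃ T₀ C : ℝ, 0 ≤ T₀ ∧ 0 < C ∧
            ∀ (u : ℝ → Oldroyd.E → Fin 3 → ℝ)
              (F : ℝ → Oldroyd.E → Matrix (Fin 3) (Fin 3) ℝ),
              Oldroyd.IsGlobalSolution m μ ν u F →
              (∀ᵐ x, u 0 x = u₀ x) →
              (∀ᵐ x, F 0 x = F₀ x) →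
              ∀ t : ℝ, T₀ < t →
                Oldroyd.gradNormSq j (u t) + Oldroyd.gradNormSq j (Oldroyd.entries (F t))
                  ≤ ENNReal.ofReal (C * (t + 1) ^ (-(3 / 2 : ℝ) - (j : ℝ))) := by
  refine ⟨Oldroyd.smallness m μ ν, Oldroyd.smallness_pos m hμ hν, fun u₀ F₀ h₀ hu₀ _ j hj hj' => ?_⟩
  have hpi := Real.pi_pos
  have hd : 0 ≤ ∑ k, ∫ x, ‖u₀ x k‖ :=
    Finset.sum_nonneg fun k _ => integral_nonneg fun x => norm_nonneg _
  have hsm : Oldroyd.balanceConst m * √(4 * Oldroyd.smallness m μ ν ^ 2)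
      ≤ Oldroyd.dampConst μ ν / 2 := by
    rw [← Oldroyd.balanceConst_mul_sqrt (m := m) hμ hν]
    have := Oldroyd.balanceConst_pos m
    gcongr
    have := sq_nonneg (Oldroyd.smallness m μ ν)
    linarith
  have hT₁ := (Oldroyd.sobolevNorm j u₀).toReal_nonneg
  have hT₂ := (Oldroyd.sobolevNorm j (Oldroyd.entries F₀)).toReal_nonneg
  obtain ⟨T, C, hT, hC, key⟩ := Oldroyd.SmallSolution.exists_total_le_order hm hμ hν hd hsm j
    (add_nonneg (sq_nonneg (Oldroyd.sobolevNorm j u₀).toReal)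
      (sq_nonneg (Oldroyd.sobolevNorm j (Oldroyd.entries F₀)).toReal))
  -- The factor `(2π)^(2j)` comes from the normalisation of the Fourier transform, and `+ 1` makes the
  -- constant positive.
  refine ⟨T, 2 * (2 * Real.pi) ^ (2 * j) * (C + 1), hT, by positivity,
    fun u F h hu hF t ht => ?_⟩
  have ht0 : 0 ≤ t := hT.trans ht.le
  have hdec := key u F (h.smallSolution hm hμ hν h₀ hu₀ hu hF) (fun R hR =>
    Oldroyd.total_zero_le le_rfl hT₁ hT₂ (ENNReal.ofReal_toReal hj.ne).ge
      (ENNReal.ofReal_toReal hj'.ne).ge hu hF hR) t ht.le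
  have b1 := Oldroyd.gradNormSq_le_of_energy_le (k := j) (w := u t) (h.memLp_vel ht0)
    fun R hR => le_trans (le_add_of_nonneg_right (Oldroyd.energy_nonneg _ _)) (hdec R hR)
  have b2 := Oldroyd.gradNormSq_le_of_energy_le (k := j) (w := Oldroyd.entries (F t))
    (h.memLp_deform ht0)
    fun R hR => le_trans (le_add_of_nonneg_left (Oldroyd.energy_nonneg _ _)) (hdec R hR)
  refine (add_le_add b1 b2).trans ?_
  have hp : 0 < (1 + t) ^ (-(3 / 2 : ℝ) - (j : ℝ)) := Real.rpow_pos_of_pos (by linarith) _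
  rw [← ENNReal.ofReal_add (by positivity) (by positivity), add_comm t 1]
  refine ENNReal.ofReal_le_ofReal ?_
  have hq : 0 ≤ (2 * Real.pi) ^ (2 * j) * (1 + t) ^ (-(3 / 2 : ℝ) - (j : ℝ)) := by positivity
  linarith
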